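/- **Theorem.** Let $A$ be an infinite-dimensional simple unital C*-algebra, let $G$ be a finite abelian group, and let $\alpha \colon G \to \operatorname{Aut}(A)$ be an action which is pointwise outer, that is, for every $g \in G \setminus \{1\}$ there is no unitary $u \in A$ with $\alpha_g(a) = u a u^*$ for all $a \in A$. Let $\widehat{\alpha} \colon \widehat{G} \to \operatorname{Aut}(C^*(G, A, \alpha))$ be the dual action of the Pontryagin dual $\widehat{G}$ on the crossed product, given by $\widehat{\alpha}_\omega(a)(g) = \overline{\omega(g)}\, a(g)$ for $\omega \in \widehat{G}$, $g \in G$ and $a \in C^*(G,A,\alpha)$, viewed as a function $G \to A$. Then: 1. $\alpha$ has the weak tracial Rokhlin property if and only if $\widehat{\alpha}$ is weakly tracially approximately representable. 2. $\alpha$ is weakly tracially approximately representable if and only if $\widehat{\alpha}$ has the weak tracial Rokhlin property. Here, for positive elements $a, b$ of a C*-algebra $B$, $a \precsim_B b$ (Cuntz subequivalence) means that there is a sequence $(y_n)$ in $B$ with $y_n b y_n^* \to a$, and $(a - \varepsilon)_+$ is the result of applying the function $t \mapsto \max(0, t - \varepsilon)$ to $a$ by functional calculus. For an action $\beta$ of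 a finite group $H$ on an infinite-dimensional simple unital C*-algebra $B$ (the crossed product above is such an algebra): * $\beta$ has the *weak tracial Rokhlin property* if for every $\varepsilon > 0$, every finite set $F \subset B$ and every positive $x \in B$ with $\|x\| = 1$, there are mutually orthogonal positive contractions $f_g \in B$, $g \in H$, such that, with $f = \sum_{g \in H} f_g$: $\|a f_g - f_g a\| < \varepsilon$ for all $g \in H$, $a \in F$; $\|\beta_g(f_h) - f_{gh}\| < \varepsilon$ for all $g, h \in H$; $1 - f \precsim_B x$; and $\|f x f\| > 1 - \varepsilon$. * $\beta$ is *weakly tracially approximately representable* if for every finite set $F \subset B$, every $\varepsilon > 0$ and every positive $x \in B$ with $\|x\| = 1$, there are a positive contraction $c \in B$ fixed by $\beta$ and contractions $s_g \in \overline{c B c}$, $g \in H$, such that: $\|s_1 - c\| < \varepsilon$ and $\|s_g^* - s_{g^{-1}}\| < \varepsilon$ for all $g \in H$; $\|s_g s_h - c s_{gh}\| < \varepsilon$ for all $g, h \in H$; $\|c a - a c\| < \varepsilon$ for all $a \in F \cup \{s_g : g \in H\}$; $\|\beta_g(c a c) - s_g a s_g^*\| < \varepsilon$ for all $a \in F$,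 $g \in H$; $\|\beta_g(s_h) - s_{g h g^{-1}}\| < \varepsilon$ for all $g, h \in H$; $(1 - c - \varepsilon)_+ \precsim_B x$; and $\|c x c\| > 1 - \varepsilon$. -/

import Mathlib

open Filter Topology

/-- A unital C*-algebra is simple if it is nonzero and has no closed two-sided ideals besides the
two trivial ones. -/
def IsSimpleCStarAlgebra (A : Type*) [CStarAlgebra A] : Prop :=
  Nontrivial A ∧ ∀ I : TwoSidedIdeal A, IsClosed (I : Set A) → I = ⊥ ∨ I = ⊤

/-- `α` is pointwise outer: for `g ≠ 1`, the automorphism `α g` is not of the form `Ad u` with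
`u` a unitary. -/
def IsPointwiseOuter {A : Type*} [CStarAlgebra A] {G : Type*} [Group G]
    (α : G →* (A ≃⋆ₐ[ℂ] A)) : Prop :=
  ∀ g : G, g ≠ 1 → ¬ ∃ u ∈ unitary A, ∀ a : A, α g a = u * a * star u

/-- Cuntz subequivalence of (positive) elements of `A`. -/
def CuntzSubequiv {A : Type*} [CStarAlgebra A] (a b : A) : Prop :=
  ∃ y : ℕ → A, Tendsto (fun n => y n * b * star (y n)) atTop (𝓝 a)

/-- `(a - ε)₊`, by functional calculus of `t ↦ max 0 (t - ε)` at a self-adjoint element `a`. -/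
noncomputable def cutDown {A : Type*} [CStarAlgebra A] (a : A) (ε : ℝ) : A :=
  cfc (fun t : ℝ => max 0 (t - ε)) a

/-- The weak tracial Rokhlin property of an action of a finite group. -/
def HasWeakTracialRokhlinProperty {A : Type*} [CStarAlgebra A] [PartialOrder A] [StarOrderedRing A]
    {G : Type*} [Group G] [Fintype G] (α : G →* (A ≃⋆ₐ[ℂ] A)) : Prop :=
  ∀ ε : ℝ, 0 < ε → ∀ F : Finset A, ∀ x : A, 0 ≤ x → ‖x‖ = 1 →
    ∃ f : G → A,
      (∀ g, 0 ≤ f g ∧ ‖f g‖ ≤ 1) ∧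
      (∀ g h, g ≠ h → f g * f h = 0) ∧
      (∀ g, ∀ a ∈ F, ‖a * f g - f g * a‖ < ε) ∧
      (∀ g h, ‖α g (f h) - f (g * h)‖ < ε) ∧
      CuntzSubequiv (1 - ∑ g, f g) x ∧
      1 - ε < ‖(∑ g, f g) * x * (∑ g, f g)‖

/-- Weak tracial approximate representability of an action of a finite group. -/
def IsWeaklyTraciallyApproxRepresentable {A : Type*} [CStarAlgebra A] [PartialOrder A]
    [StarOrderedRing A] {G : Type*} [Group G] [Fintype G] (α : G →* (A ≃⋆ₐ[ℂ] A)) : Prop :=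
  ∀ F : Finset A, ∀ ε : ℝ, 0 < ε → ∀ x : A, 0 ≤ x → ‖x‖ = 1 →
    ∃ (c : A) (s : G → A),
      (0 ≤ c ∧ (∀ g, α g c = c) ∧ ‖c‖ ≤ 1) ∧
      (∀ g, s g ∈ closure (Set.range fun a : A => c * a * c) ∧ ‖s g‖ ≤ 1) ∧
      (‖s 1 - c‖ < ε ∧ ∀ g, ‖star (s g) - s g⁻¹‖ < ε) ∧
      (∀ g h, ‖s g * s h - c * s (g * h)‖ < ε) ∧
      ((∀ a ∈ F, ‖c * a - a * c‖ < ε) ∧ ∀ g, ‖c * s g - s g * c‖ < ε) ∧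
      (∀ g, ∀ a ∈ F, ‖α g (c * a * c) - s g * a * star (s g)‖ < ε) ∧
      (∀ g h, ‖α g (s h) - s (g * h * g⁻¹)‖ < ε) ∧
      CuntzSubequiv (cutDown (1 - c) ε) x ∧
      1 - ε < ‖c * x * c‖

theorem star_mul_circle (z : Circle) : star (z : ℂ) * (z : ℂ) = 1 := by
  have h := Complex.normSq_eq_conj_mul_self (z := (z : ℂ))
  rw [Complex.normSq_eq_norm_sq, Circle.norm_coe] at h
  simpa using h.symm

/-- The crossed product `C*(G, A, α)` of a unital C*-algebra by a finite group. As a *-algebra this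
is `C_c(G, A, α)`: all functions `G → A`, with pointwise linear structure, twisted convolution and
twisted involution. The C*-norm comes from the regular representation on `M_G(A)`; since `G` is
finite, the algebra is already complete for it, hence it is the only C*-norm and there is no
difference between the full and the reduced crossed product. -/
def CrossedProduct {A : Type*} [CStarAlgebra A] {G : Type*} [Group G]
    (_α : G →* (A ≃⋆ₐ[ℂ] A)) : Type _ := G → A

namespace CrossedProduct

variable {A : Type*} [CStarAlgebra A] {G : Type*} [Group G] {α : G →* (A ≃⋆ₐ[ℂ] A)}

noncomputable instance : AddCommGroup (CrossedProduct α) := inferInstanceAs (AddCommGroup (G → A))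

noncomputable instance : Module ℂ (CrossedProduct α) := inferInstanceAs (Module ℂ (G → A))

/-- The coefficient `a_g` of `a = ∑ a_g u_g`. -/
def coeff (a : CrossedProduct α) (g : G) : A := (show G → A from a) g

/-- The element `∑ a_g u_g`. -/
def ofCoeff (a : G → A) : CrossedProduct α := a

@[simp] theorem coeff_ofCoeff (a : G → A) (g : G) :
    coeff (ofCoeff a : CrossedProduct α) g = a g := rfl

@[ext] theorem ext {a b : CrossedProduct α} (h : ∀ g, a.coeff g = b.coeff g) : a = b := funext h

@[simp] theorem coeff_zero (g : G) : (0 : CrossedProduct α).coeff g = 0 := rfl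

@[simp] theorem coeff_add (a b : CrossedProduct α) (g : G) :
    (a + b).coeff g = a.coeff g + b.coeff g := rfl

@[simp] theorem coeff_smul (z : ℂ) (a : CrossedProduct α) (g : G) :
    (z • a).coeff g = z • a.coeff g := rfl

/-- `(a b)(g) = ∑ h, a(h) α_h(b(h⁻¹ g))` -/
noncomputable instance [Fintype G] : Mul (CrossedProduct α) :=
  ⟨fun a b => ofCoeff fun g => ∑ h, a.coeff h * α h (b.coeff (h⁻¹ * g))⟩

/-- `a*(g) = α_g(a(g⁻¹)*)` -/
noncomputable instance : Star (CrossedProduct α) :=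
  ⟨fun a => ofCoeff fun g => α g (star (a.coeff g⁻¹))⟩

instance [DecidableEq G] : One (CrossedProduct α) := ⟨ofCoeff fun g => if g = 1 then 1 else 0⟩

theorem coeff_mul [Fintype G] (a b : CrossedProduct α) (g : G) :
    (a * b).coeff g = ∑ h, a.coeff h * α h (b.coeff (h⁻¹ * g)) := rfl

theorem coeff_star (a : CrossedProduct α) (g : G) :
    (star a).coeff g = α g (star (a.coeff g⁻¹)) := rfl

theorem coeff_one [DecidableEq G] (g : G) :
    (1 : CrossedProduct α).coeff g = if g = 1 then 1 else 0 := rfl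

/-- The regular representation: `a u_g` acts as `diag (α_s⁻¹ (a))_s` times the translation
by `g`. -/
def regularRep : CrossedProduct α →ₗ[ℂ] CStarMatrix G G A where
  toFun a := CStarMatrix.ofMatrix fun s t => α s⁻¹ (a.coeff (s * t⁻¹))
  map_add' a b := by
    ext s t
    exact map_add (α s⁻¹) _ _
  map_smul' z a := by
    ext s t
    exact map_smul (α s⁻¹) z _

theorem regularRep_apply (a : CrossedProduct α) (s t : G) :
    regularRep a s t = α s⁻¹ (a.coeff (s * t⁻¹)) := rfl

theorem regularRep_injective :
    Function.Injective (regularRep : CrossedProduct α →ₗ[ℂ] CStarMatrix G G A) := by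
  intro a b h
  ext g
  have := congrFun (congrFun h 1) g⁻¹
  simpa [regularRep_apply] using this

theorem regularRep_mul [Fintype G] (a b : CrossedProduct α) :
    regularRep (a * b) = regularRep a * regularRep b := by
  ext s t
  rw [CStarMatrix.mul_apply, regularRep_apply, coeff_mul, map_sum]
  refine Fintype.sum_equiv ((Equiv.inv G).trans (Equiv.mulRight s)) _ _ fun h => ?_
  have key : ∀ c : A, α s⁻¹ (α h c) = α (s⁻¹ * h) c := fun c => by
    rw [map_mul, StarAlgEquiv.mul_apply]
  simp only [regularRep_apply, Equiv.trans_apply, Equiv.inv_apply, Equiv.coe_mulRight, map_mul (α _),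
    key, mul_inv_rev, inv_inv, mul_inv_cancel_left, mul_assoc]

theorem regularRep_star (a : CrossedProduct α) : regularRep (star a) = star (regularRep a) := by
  ext s t
  rw [CStarMatrix.star_apply, regularRep_apply, regularRep_apply, coeff_star,
    ← StarAlgEquiv.mul_apply, ← map_mul α, inv_mul_cancel_left, map_star, mul_inv_rev, inv_inv]

theorem regularRep_one [DecidableEq G] :
    regularRep (1 : CrossedProduct α) = (1 : CStarMatrix G G A) := by
  ext s t
  rw [regularRep_apply, coeff_one, CStarMatrix.one_apply]
  by_cases h : s = t
  · simp [h]
  · have h' : s * t⁻¹ ≠ 1 := fun e => h (mul_inv_eq_one.mp e)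
    simp [h, h']

theorem mem_range_regularRep (x : CStarMatrix G G A) :
    (∃ a : CrossedProduct α, regularRep a = x) ↔
      ∀ s t, x s t = α s⁻¹ (x 1 (t * s⁻¹)) := by
  constructor
  · rintro ⟨a, rfl⟩ s t
    simp [regularRep_apply]
  · intro h
    refine ⟨ofCoeff fun g => x 1 g⁻¹, ?_⟩
    ext s t
    rw [regularRep_apply, coeff_ofCoeff, h s t]
    simp

variable [Fintype G] [DecidableEq G]

noncomputable instance : Ring (CrossedProduct α) where
  __ := (inferInstance : AddCommGroup (CrossedProduct α))
  left_distrib a b c := regularRep_injective <| by simp only [map_add, regularRep_mul, mul_add]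
  right_distrib a b c := regularRep_injective <| by simp only [map_add, regularRep_mul, add_mul]
  zero_mul a := regularRep_injective <| by simp only [map_zero, regularRep_mul, zero_mul]
  mul_zero a := regularRep_injective <| by simp only [map_zero, regularRep_mul, mul_zero]
  mul_assoc a b c := regularRep_injective <| by simp only [regularRep_mul, mul_assoc]
  one_mul a := regularRep_injective <| by simp only [regularRep_mul, regularRep_one, one_mul]
  mul_one a := regularRep_injective <| by simp only [regularRep_mul, regularRep_one, mul_one]

noncomputable instance : StarRing (CrossedProduct α) where
  star_involutive a := regularRep_injective <| by simp only [regularRep_star, star_star]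
  star_mul a b := regularRep_injective <| by simp only [regularRep_star, regularRep_mul, star_mul]
  star_add a b := regularRep_injective <| by simp only [regularRep_star, map_add, star_add]

noncomputable instance : Algebra ℂ (CrossedProduct α) :=
  Algebra.ofModule
    (fun z a b => regularRep_injective <| by
      simp only [regularRep_mul, map_smul, smul_mul_assoc])
    (fun z a b => regularRep_injective <| by
      simp only [regularRep_mul, map_smul, mul_smul_comm])

instance : StarModule ℂ (CrossedProduct α) where
  star_smul z a := regularRep_injective <| by
    simp only [regularRep_star, map_smul, star_smul]

section Norm

variable [PartialOrder A] [StarOrderedRing A]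

/-- The regular representation as a ring homomorphism. -/
noncomputable def regularRepRingHom : CrossedProduct α →+* CStarMatrix G G A where
  toFun := regularRep
  map_one' := regularRep_one
  map_mul' := regularRep_mul
  map_zero' := map_zero _
  map_add' := map_add _

noncomputable instance : NormedRing (CrossedProduct α) :=
  NormedRing.induced _ (CStarMatrix G G A) regularRepRingHom regularRep_injective

theorem norm_def (a : CrossedProduct α) : ‖a‖ = ‖regularRep a‖ := rfl

theorem isometry_regularRep :
    Isometry (regularRep : CrossedProduct α →ₗ[ℂ] CStarMatrix G G A) :=
  AddMonoidHomClass.isometry_of_norm _ fun _ => rfl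

noncomputable instance : NormedAlgebra ℂ (CrossedProduct α) where
  norm_smul_le z a := by rw [norm_def, map_smul, norm_smul, norm_def]

instance : CStarRing (CrossedProduct α) where
  norm_mul_self_le a := by
    rw [norm_def, norm_def, regularRep_mul, regularRep_star, CStarRing.norm_star_mul_self]

instance : CompleteSpace (CrossedProduct α) := by
  rw [completeSpace_iff_isComplete_range (isometry_regularRep (α := α)).isUniformInducing]
  refine IsClosed.isComplete ?_
  have hr : Set.range (regularRep : CrossedProduct α →ₗ[ℂ] CStarMatrix G G A) =
      ⋂ s, ⋂ t, {x : CStarMatrix G G A | x s t = α s⁻¹ (x 1 (t * s⁻¹))} := by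
    ext x
    simpa using mem_range_regularRep (α := α) x
  have hc : ∀ s t, Continuous fun x : CStarMatrix G G A => x s t := fun s t =>
    (continuous_apply t).comp (continuous_apply (A := fun _ : G => G → A) s)
  rw [hr]
  exact isClosed_iInter fun s => isClosed_iInter fun t =>
    isClosed_eq (hc s t) ((StarAlgEquiv.isometry (α s⁻¹)).continuous.comp (hc 1 _))

noncomputable instance : CStarAlgebra (CrossedProduct α) where

noncomputable instance : PartialOrder (CrossedProduct α) := CStarAlgebra.spectralOrder _

instance : StarOrderedRing (CrossedProduct α) := CStarAlgebra.spectralOrderedRing _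

/-- The automorphism `α̂_ω` of the crossed product: `α̂_ω(a)(g) = conj (ω(g)) a(g)`. -/
noncomputable def dualAut [TopologicalSpace G] (α : G →* (A ≃⋆ₐ[ℂ] A)) (ω : PontryaginDual G) :
    CrossedProduct α ≃⋆ₐ[ℂ] CrossedProduct α where
  toFun a := ofCoeff fun g => star (ω g : ℂ) • a.coeff g
  invFun a := ofCoeff fun g => (ω g : ℂ) • a.coeff g
  left_inv a := by
    ext g
    rw [coeff_ofCoeff, coeff_ofCoeff, smul_smul, mul_comm, star_mul_circle, one_smul]
  right_inv a := by
    ext g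
    rw [coeff_ofCoeff, coeff_ofCoeff, smul_smul, star_mul_circle, one_smul]
  map_mul' a b := by
    ext g
    simp only [coeff_ofCoeff, coeff_mul, Finset.smul_sum]
    refine Finset.sum_congr rfl fun h _ => ?_
    rw [map_smul, smul_mul_smul_comm, ← star_mul', ← Circle.coe_mul, ← map_mul,
      mul_inv_cancel_left]
  map_add' a b := by
    ext g
    simp only [coeff_ofCoeff, coeff_add, smul_add]
  map_star' a := by
    ext g
    simp only [coeff_ofCoeff, coeff_star, star_smul, star_star, map_smul]
    rw [map_inv, Circle.coe_inv_eq_conj]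
    rfl
  map_smul' z a := by
    ext g
    simp only [coeff_ofCoeff, coeff_smul, smul_smul, mul_comm]

/-- The dual action `α̂` of the Pontryagin dual on the crossed product. -/
noncomputable def dualAction [TopologicalSpace G] (α : G →* (A ≃⋆ₐ[ℂ] A)) :
    PontryaginDual G →* (CrossedProduct α ≃⋆ₐ[ℂ] CrossedProduct α) where
  toFun := dualAut α
  map_one' := by
    ext a g
    change star ((1 : Circle) : ℂ) • a.coeff g = a.coeff g
    simp
  map_mul' ω ω' := by
    ext a g
    change star ((ω g * ω' g : Circle) : ℂ) • a.coeff g = star (ω g : ℂ) • star (ω' g : ℂ) • a.coeff g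
    rw [Circle.coe_mul, star_mul', smul_smul]

end Norm

end CrossedProduct

/-!
Everything takes place in the sequence algebras `ℓ^∞(D) / c₀(D)` of `D = A` and of the crossed product
`B`: both tracial properties amount to the existence of certain elements there (`IsRokhlinTower`,
`IsApproxRepresentation`), together with a Cuntz comparison and a norm condition relative to a given
positive `x`. Two mechanisms produce one kind of object from the other.

*Fourier transform.* A family `s_h` of elements with `s_g s_h = c s_{gh}`, `s_h* = s_{h⁻¹}`, indexed by
a finite abelian group `H`, has spectral components `p_γ = |H|⁻¹ ∑ χ_γ(h) s_h`. They are
orthogonal with sum `c`, and positive because `p_γ³ = p_γ c p_γ`; they lift to exactly orthogonal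
positive contractions whose complement is Cuntz below that of `c`
(`exists_tower_of_approxRep`). Conversely a tower `f` has Fourier coefficients
`∑ conj (ω(g)) f_ω`, which can be moved into the corner of `c = ∑ f` (`exists_mem_corner`).

*Intertwining.* The relations `σ(c a c) = s a s*` for `a` and `a a*` force `s a = σ(a) s`, since
`z = s a - σ(a) s` satisfies `z z* = 0` (`SeqAlg.intertwine`). For the dual action, this says that
`s_ω` commutes with `A` and with the canonical unitaries `u_g` up to `ω(g)`; for `α` it says that
`s_g* u_g` commutes with `B`. In this way towers and representations pass between `A` and `B`: elements
fixed by the dual action come from `A` (`mk_map_incl_expSeq`), because averaging over the dual action is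
the conditional expectation `b ↦ b(1)`.

The data relative to `x` are transported as follows. Whatever is Cuntz below the part of `x` near
the top of its spectrum has the form `v x v*` with `v` almost contractive, up to a small error
(`exists_top_part`); if `v` commutes with `c`, then `‖c x c‖` is close to one once `‖c v x v* c‖` is
(`OneLeLiminfNorm.of_conj`). From `A` to `B`, one finds a positive element of `A` Cuntz below a given
one of `B` (`exists_incl_cuntzSubequiv_of_rokhlin`, `exists_incl_cuntzSubequiv_of_approxRep`). From `B`
to `A`, one replaces `x` by an element whose whole `α`-orbit fits orthogonally below the top of `x`
(`exists_orthogonal_translates`); the conditional expectation then turns comparison in `B` into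
comparison in `A` (`cuntzSubequiv_of_incl`). Both use that `A`, respectively `B`, is simple and
infinite-dimensional; simplicity of `B` is where pointwise outerness enters
(`isSimpleRing_of_isPointwiseOuter`).
-/

/-! ### Products in the continuous functional calculus -/

section FunctionalCalculus

variable {D : Type*} [CStarAlgebra D]

theorem cfc_mul_cfc {f g : ℝ → ℝ} (hf : Continuous f) (hg : Continuous g) (d : D) :
    cfc f d * cfc g d = cfc (fun t => f t * g t) d :=
  (cfc_mul f g d hf.continuousOn hg.continuousOn).symm

theorem cfc_mul_self {f : ℝ → ℝ} (hf : Continuous f) {d : D} (hd : IsSelfAdjoint d) :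
    cfc f d * d = cfc (fun t => f t * t) d := by
  conv_lhs => enter [2]; rw [← cfc_id' ℝ d hd]
  exact cfc_mul_cfc hf continuous_id d

theorem cfc_mul_mul_cfc {f : ℝ → ℝ} (hf : Continuous f) {d : D} (hd : IsSelfAdjoint d) :
    cfc f d * d * cfc f d = cfc (fun t => f t * t * f t) d := by
  rw [cfc_mul_self hf hd, cfc_mul_cfc (by fun_prop) hf]

end FunctionalCalculus

/-! ### Cuntz subequivalence -/

section Cuntz

variable {D : Type*} [CStarAlgebra D]

theorem cuntzSubequiv_iff {a b : D} :
    CuntzSubequiv a b ↔ ∀ ε : ℝ, 0 < ε → ∃ y : D, ‖y * b * star y - a‖ < ε := by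
  constructor
  · rintro ⟨y, hy⟩ ε hε
    obtain ⟨n, hn⟩ := ((Metric.tendsto_nhds.mp hy) ε hε).exists
    exact ⟨y n, by rwa [← dist_eq_norm]⟩
  · intro h
    choose y hy using fun n : ℕ => h (1 / ((n : ℝ) + 1)) Nat.one_div_pos_of_nat
    refine ⟨y, ?_⟩
    rw [tendsto_iff_norm_sub_tendsto_zero]
    exact squeeze_zero (fun _ => norm_nonneg _) (fun n => (hy n).le)
      tendsto_one_div_add_atTop_nhds_zero_nat

namespace CuntzSubequiv

theorem of_eq_mul {a b y : D} (h : a = y * b * star y) : CuntzSubequiv a b :=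
  ⟨fun _ => y, h ▸ tendsto_const_nhds⟩

theorem refl (a : D) : CuntzSubequiv a a := of_eq_mul (y := 1) (by simp)

theorem trans {a b c : D} (hab : CuntzSubequiv a b) (hbc : CuntzSubequiv b c) :
    CuntzSubequiv a c := by
  rw [cuntzSubequiv_iff] at hab ⊢
  intro ε hε
  obtain ⟨y, hy⟩ := hab (ε / 2) (by positivity)
  obtain ⟨w, hw⟩ := hbc
  have h1 : Tendsto (fun n => (y * w n) * c * star (y * w n)) atTop (𝓝 (y * b * star y)) := by
    have := (hw.const_mul y).mul_const (star y)
    refine this.congr fun n => ?_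
    simp only [star_mul, mul_assoc]
  obtain ⟨n, hn⟩ := ((Metric.tendsto_nhds.mp h1) (ε / 2) (by positivity)).exists
  rw [dist_eq_norm] at hn
  refine ⟨y * w n, ?_⟩
  calc _ = ‖(y * w n * c * star (y * w n) - y * b * star y) + (y * b * star y - a)‖ := by
        rw [sub_add_sub_cancel]
    _ ≤ _ := norm_add_le _ _
    _ < ε := by linarith

theorem of_tendsto {a b : D} {f : ℕ → D} (hf : Tendsto f atTop (𝓝 a))
    (h : ∀ n, CuntzSubequiv (f n) b) : CuntzSubequiv a b := by
  rw [cuntzSubequiv_iff]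
  intro ε hε
  obtain ⟨n, hn⟩ := ((Metric.tendsto_nhds.mp hf) (ε / 2) (by positivity)).exists
  rw [dist_eq_norm] at hn
  obtain ⟨y, hy⟩ := cuntzSubequiv_iff.mp (h n) (ε / 2) (by positivity)
  refine ⟨y, ?_⟩
  calc _ = ‖(y * b * star y - f n) + (f n - a)‖ := by rw [sub_add_sub_cancel]
    _ ≤ _ := norm_add_le _ _
    _ < ε := by linarith

theorem smul_left {a b : D} (h : CuntzSubequiv a b) {r : ℝ} (hr : 0 ≤ r) :
    CuntzSubequiv (r • a) b := by
  refine trans (of_eq_mul (y := ((√r : ℝ) : ℂ) • (1 : D)) ?_) h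
  rw [star_smul, star_one, smul_one_mul, mul_smul_one, smul_smul]
  rw [Complex.star_def, Complex.conj_ofReal, ← Complex.ofReal_mul, Real.mul_self_sqrt hr,
    Complex.coe_smul]

theorem map {D' : Type*} [CStarAlgebra D'] (φ : D →⋆ₐ[ℂ] D') {a b : D}
    (h : CuntzSubequiv a b) : CuntzSubequiv (φ a) (φ b) := by
  obtain ⟨y, hy⟩ := h
  refine ⟨fun n => φ (y n), ?_⟩
  have hc : Continuous φ :=
    AddMonoidHomClass.continuous_of_bound φ 1 (by simpa using NonUnitalStarAlgHom.norm_apply_le φ)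
  refine ((hc.tendsto a).comp hy).congr fun n => ?_
  simp [map_star]

variable [PartialOrder D] [StarOrderedRing D]

/-- With `y = c^½ (d + δ)^(-½)` one has `‖y d y* - c‖ ≤ δ`, as `c ≤ d`. -/
theorem of_le {c d : D} (hc : 0 ≤ c) (hcd : c ≤ d) : CuntzSubequiv c d := by
  have hd : 0 ≤ d := hc.trans hcd
  have hdsa : IsSelfAdjoint d := hd.isSelfAdjoint
  rw [cuntzSubequiv_iff]
  intro ε hε
  set δ := ε / 2 with hδ
  have hδ0 : 0 < δ := by positivity
  -- `r = (d + δ)^{-1/2}`, so that `r c r ≤ r d r ≤ 1`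
  let k : ℝ → ℝ := fun t => (√(max t 0 + δ))⁻¹
  have hk : Continuous k := by
    refine Continuous.inv₀ (by fun_prop) fun t => ?_
    positivity
  let r := cfc k d
  have hr : IsSelfAdjoint r := cfc_predicate k d
  let s := CFC.sqrt c
  have hs : IsSelfAdjoint s := (CFC.sqrt_nonneg c).isSelfAdjoint
  have hss : s * s = c := CFC.sqrt_mul_sqrt_self c
  have hk' : ∀ t ∈ spectrum ℝ d, k t * t * k t + δ * (k t * k t) = 1 := fun t ht => by
    have ht0 : 0 ≤ t := spectrum_nonneg_of_nonneg hd ht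
    have h1 : k t * k t = (t + δ)⁻¹ := by
      simp only [k, max_eq_left ht0]
      rw [← mul_inv, Real.mul_self_sqrt (by positivity)]
    have h2 : t + δ ≠ 0 := by positivity
    calc k t * t * k t + δ * (k t * k t) = (k t * k t) * (t + δ) := by ring
      _ = 1 := by rw [h1, inv_mul_cancel₀ h2]
  have hrdr : r * d * r + δ • (r * r) = 1 := by
    rw [cfc_mul_mul_cfc hk hdsa, cfc_mul_cfc hk hk, ← cfc_const_mul δ _ d (by fun_prop),
      ← cfc_add _ _ _ (by fun_prop) (by fun_prop), ← cfc_one ℝ d hdsa]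
    exact cfc_congr hk'
  have hrr : 0 ≤ r * r := hr.mul_self_nonneg
  have hle : r * d * r ≤ 1 := by
    rw [← hrdr]
    exact le_add_of_nonneg_right (smul_nonneg hδ0.le hrr)
  have hrcr : ‖r * s‖ * ‖r * s‖ ≤ 1 := by
    rw [← CStarRing.norm_self_mul_star, star_mul, hs.star_eq, hr.star_eq,
      show r * s * (s * r) = r * (s * s) * r by noncomm_ring, hss]
    have h0 : 0 ≤ r * c * r := hr.conjugate_nonneg hc
    rw [CStarAlgebra.norm_le_one_iff_of_nonneg _ h0]
    exact (hr.conjugate_le_conjugate hcd).trans hle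
  refine ⟨s * r, ?_⟩
  have key : s * r * d * star (s * r) - c = -(δ • (star (r * s) * (r * s))) := by
    rw [star_mul, star_mul, hs.star_eq, hr.star_eq, ← hss]
    calc s * r * d * (r * s) - s * s = s * (r * d * r) * s - s * s := by noncomm_ring
      _ = _ := by
        rw [eq_sub_of_add_eq hrdr]
        simp only [mul_sub, sub_mul, mul_one, mul_smul_comm, smul_mul_assoc, mul_assoc]
        abel
  rw [key, norm_neg, norm_smul, CStarRing.norm_star_mul_self, Real.norm_of_nonneg hδ0.le]
  nlinarith

/-- If `a ≤ d + ε` then compressing by `p = (a - ε)₊` gives `p³ = p (a - ε) p ≤ p d p`, and `p` is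
Cuntz equivalent to `p³`. -/
theorem cutDown_of_le {a d : D} (ha : IsSelfAdjoint a) {ε : ℝ}
    (h : a ≤ d + algebraMap ℝ D ε) : CuntzSubequiv (cutDown a ε) d := by
  let m : ℝ → ℝ := fun t => max 0 (t - ε)
  have hm : Continuous m := by fun_prop
  have hm0 : ∀ t, 0 ≤ m t := fun t => le_max_left _ _
  have hpsa : IsSelfAdjoint (cfc m a) := cfc_predicate m a
  have h3 : cfc m a * (a - algebraMap ℝ D ε) * cfc m a = cfc (fun t => m t ^ 3) a := by
    have e1 : a - algebraMap ℝ D ε = cfc (fun t => t - ε) a := by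
      rw [cfc_sub .., cfc_id' ℝ a, cfc_const ε a]
    rw [e1, cfc_mul_cfc hm (by fun_prop), cfc_mul_cfc (by fun_prop) hm]
    refine cfc_congr fun t _ => ?_
    simp only [m]
    rcases le_total 0 (t - ε) with h | h
    · rw [max_eq_right h]; ring
    · rw [max_eq_left h]; ring
  have h3' : 0 ≤ cfc (fun t => m t ^ 3) a := cfc_nonneg fun t _ => pow_nonneg (hm0 t) 3
  have h1 : CuntzSubequiv (cfc (fun t => m t ^ 3) a) d := by
    refine trans (of_le h3' ?_) (of_eq_mul (y := cfc m a) rfl)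
    rw [hpsa.star_eq, ← h3]
    exact hpsa.conjugate_le_conjugate (sub_le_iff_le_add.mpr h)
  refine trans ?_ h1
  rw [cuntzSubequiv_iff]
  intro δ hδ
  let q : ℝ → ℝ := fun t => (m t + δ / 4)⁻¹
  have hq : Continuous q := by
    refine Continuous.inv₀ (by fun_prop) fun t => ?_
    have := hm0 t
    positivity
  refine ⟨cfc q a, ?_⟩
  rw [(cfc_predicate q a : IsSelfAdjoint _).star_eq, cfc_mul_cfc hq (by fun_prop),
    cfc_mul_cfc (by fun_prop) hq, cutDown, ← cfc_sub _ _ _ (by fun_prop) (by fun_prop)]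
  refine (norm_cfc_le (c := δ / 2) (by positivity) fun t _ => ?_).trans_lt (by linarith)
  have := hm0 t
  have e : q t * m t ^ 3 * q t - m t = - (δ / 4 * (m t / (m t + δ / 4)) * (1 + m t / (m t + δ / 4))) := by
    simp only [q]
    field_simp
    ring
  have h0 : 0 ≤ m t / (m t + δ / 4) := by positivity
  have h1 : m t / (m t + δ / 4) ≤ 1 := by
    rw [div_le_one (by positivity)]; linarith
  rw [show max 0 (t - ε) = m t from rfl, e, norm_neg, Real.norm_of_nonneg (by positivity)]
  nlinarith [mul_le_mul h1 (add_le_add_right h1 1) (by positivity) zero_le_one]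

theorem _root_.le_cutDown_add {a : D} (ha : IsSelfAdjoint a) (ε : ℝ) :
    a ≤ cutDown a ε + algebraMap ℝ D ε := by
  rw [← sub_le_iff_le_add]
  have e1 : a - algebraMap ℝ D ε = cfc (fun t => t - ε) a := by
    rw [cfc_sub .., cfc_id' ℝ a, cfc_const ε a]
  rw [e1]
  exact cfc_mono fun t _ => le_max_right _ _

theorem cutDown_cutDown {a b : D} (ha : IsSelfAdjoint a) (hb : IsSelfAdjoint b) {ε δ : ℝ}
    (h : ‖a - b‖ ≤ δ) : CuntzSubequiv (cutDown a (ε + δ)) (cutDown b ε) := by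
  refine cutDown_of_le ha ?_
  have h1 : a ≤ b + algebraMap ℝ D δ := by
    rw [← sub_le_iff_le_add']
    exact (ha.sub hb).le_algebraMap_norm_self.trans (algebraMap_mono D h)
  calc a ≤ b + algebraMap ℝ D δ := h1
    _ ≤ (cutDown b ε + algebraMap ℝ D ε) + algebraMap ℝ D δ := by gcongr; exact le_cutDown_add hb ε
    _ = _ := by rw [map_add, add_assoc]

end CuntzSubequiv
end Cuntz

/-! ### Simple infinite-dimensional C*-algebras -/

section Simple

theorem IsSimpleCStarAlgebra.isSimpleRing {D : Type*} [CStarAlgebra D]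
    (h : IsSimpleCStarAlgebra D) : IsSimpleRing D := by
  have := h.1
  refine .of_eq_bot_or_eq_top fun I => ?_
  let J : TwoSidedIdeal D := TwoSidedIdeal.mk' (closure (I : Set D))
    (subset_closure I.zero_mem)
    (fun hx hy => map_mem_closure₂ continuous_add hx hy fun _ ha _ hb => I.add_mem ha hb)
    (fun hx => map_mem_closure continuous_neg hx fun _ ha => I.neg_mem ha)
    (fun {x y} hy => map_mem_closure (continuous_const_mul x) hy fun _ ha => I.mul_mem_left x _ ha)
    (fun {x y} hx => map_mem_closure (f := (· * y)) (continuous_mul_const y) hx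
      fun _ ha => I.mul_mem_right _ y ha)
  have hJ : (J : Set D) = closure (I : Set D) := TwoSidedIdeal.coe_mk' ..
  rcases h.2 J (hJ ▸ isClosed_closure) with h0 | h1
  · refine Or.inl (le_bot_iff.mp fun x hx => ?_)
    have : x ∈ (J : Set D) := hJ ▸ subset_closure hx
    rwa [h0] at this
  · -- an element of `I` close to `1` is invertible
    refine Or.inr ((TwoSidedIdeal.one_mem_iff I).mp ?_)
    have h1' : (1 : D) ∈ closure (I : Set D) := by rw [← hJ, h1]; trivial
    obtain ⟨y, hy, hdy⟩ := Metric.mem_closure_iff.mp h1' 1 one_pos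
    rw [dist_eq_norm] at hdy
    have hu : IsUnit y := by
      have := isUnit_one_sub_of_norm_lt_one hdy
      rwa [sub_sub_cancel] at this
    obtain ⟨u, rfl⟩ := hu
    have := I.mul_mem_left (↑u⁻¹ : D) _ hy
    rwa [Units.inv_mul] at this

/-- In a simple ring every nonzero element generates the unit ideal. -/
theorem exists_sum_mul_mul_eq_one {R : Type*} [Ring R] [IsSimpleRing R] {h : R} (hh : h ≠ 0) :
    ∃ (ι : Type) (_ : Fintype ι) (a b : ι → R), ∑ i, a i * h * b i = 1 := by
  have h1 : (1 : R) ∈ TwoSidedIdeal.span {h} :=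
    IsSimpleRing.one_mem_of_ne_zero_mem _ hh (TwoSidedIdeal.subset_span rfl)
  rw [TwoSidedIdeal.mem_span_iff_mem_addSubgroup_closure] at h1
  generalize (1 : R) = z at h1 ⊢
  induction h1 using AddSubgroup.closure_induction with
  | mem x hx =>
    obtain ⟨_, ⟨a, -, h', rfl, rfl⟩, b, -, rfl⟩ := hx
    exact ⟨Unit, inferInstance, fun _ => a, fun _ => b, by simp⟩
  | zero => exact ⟨Empty, inferInstance, fun _ => 0, fun _ => 0, by simp⟩
  | add x y _ _ hx hy =>
    obtain ⟨ι, _, a, b, rfl⟩ := hx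
    obtain ⟨κ, _, c, d, rfl⟩ := hy
    exact ⟨ι ⊕ κ, inferInstance, Sum.elim a c, Sum.elim b d, by simp⟩
  | neg x _ hx =>
    obtain ⟨ι, _, a, b, rfl⟩ := hx
    exact ⟨ι, inferInstance, fun i => - a i, b, by simp⟩

/-- If `p ≠ 0` and `p R p` is one-dimensional, then `1 = ∑ aᵢ p bᵢ` and `R` is spanned by the
elements `aᵢ p bⱼ`. -/
theorem finiteDimensional_of_corner {R : Type*} [Ring R] [Algebra ℂ R] [IsSimpleRing R] {p : R}
    (hp : p ≠ 0) (h : ∀ y, ∃ c : ℂ, p * y * p = c • p) : FiniteDimensional ℂ R := by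
  obtain ⟨ι, _, a, b, hab⟩ := exists_sum_mul_mul_eq_one hp
  refine Module.Finite.of_fg_top (Submodule.fg_def.mpr
    ⟨Set.range fun q : ι × ι => a q.1 * p * b q.2, Set.finite_range _, ?_⟩)
  refine eq_top_iff.mpr fun x _ => ?_
  have hx : x = ∑ i, ∑ j, a i * (p * (b i * x * a j) * p) * b j := by
    calc x = (∑ i, a i * p * b i) * x * (∑ j, a j * p * b j) := by rw [hab, one_mul, mul_one]
      _ = _ := by
        simp only [Finset.sum_mul, Finset.mul_sum, mul_assoc]
        rw [Finset.sum_comm]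
  rw [hx]
  refine Submodule.sum_mem _ fun i _ => Submodule.sum_mem _ fun j _ => ?_
  obtain ⟨c, hc⟩ := h (b i * x * a j)
  rw [hc, mul_smul_comm, smul_mul_assoc]
  exact Submodule.smul_mem _ _ (Submodule.subset_span ⟨(i, j), rfl⟩)

variable {D : Type*} [CStarAlgebra D]

/-- Two different nonzero points of the spectrum of `r y r` are separated by continuous functions,
and these give orthogonal elements below `r ^ 2`. -/
theorem spectrum_subsingleton_of_no_orthogonal {r : D} (hr : IsSelfAdjoint r)
    (hno : ∀ z w : D, z * (r * r) * star w = 0 → z * (r * r) * star z ≠ 0 →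
      w * (r * r) * star w = 0) {y : D} (hy : IsSelfAdjoint y) {s t : ℝ}
    (hs : s ∈ spectrum ℝ (r * y * r)) (ht : t ∈ spectrum ℝ (r * y * r)) (hs0 : s ≠ 0)
    (ht0 : t ≠ 0) : s = t := by
  by_contra hst
  set b := r * y * r with hb
  have hbsa : IsSelfAdjoint b := by
    rw [isSelfAdjoint_iff, hb, star_mul, star_mul, hr.star_eq, hy.star_eq, mul_assoc]
  let φ : ℝ → ℝ → ℝ := fun p u => max 0 (|s - t| / 2 - |u - p|)
  have hφ : ∀ p, Continuous (φ p) := fun p => by fun_prop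
  have hd : 0 < |s - t| := abs_pos.mpr (sub_ne_zero.mpr hst)
  have hφ0 : ∀ u, φ s u * φ t u = 0 := fun u => by
    by_contra hne
    obtain ⟨h1, h2⟩ := mul_ne_zero_iff.mp hne
    have h1' : 0 < |s - t| / 2 - |u - s| := by
      by_contra hc
      exact h1 (max_eq_left (not_lt.mp hc))
    have h2' : 0 < |s - t| / 2 - |u - t| := by
      by_contra hc
      exact h2 (max_eq_left (not_lt.mp hc))
    have := abs_sub_le s u t
    rw [abs_sub_comm s u] at this
    linarith
  have hprod : ∀ p q, (cfc (φ p) b * r * y) * (r * r) * star (cfc (φ q) b * r * y) =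
      cfc (fun u => φ p u * u * (u * φ q u)) b := fun p q => by
    have hq : IsSelfAdjoint (cfc (φ q) b) := cfc_predicate _ _
    rw [star_mul, star_mul, hq.star_eq, hr.star_eq, hy.star_eq]
    calc _ = (cfc (φ p) b * b) * (b * cfc (φ q) b) := by rw [hb]; noncomm_ring
      _ = _ := by
        rw [(cfc_commute_cfc (fun u : ℝ => u) (φ q) b |> fun h => by rwa [cfc_id' ℝ b] at h :
          Commute b (cfc (φ q) b)).eq, cfc_mul_self (hφ p) hbsa, cfc_mul_self (hφ q) hbsa,
          cfc_mul_cfc (by fun_prop) (by fun_prop)]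
        exact cfc_congr fun u _ => by ring
  have hpos : ∀ p ∈ spectrum ℝ b, p ≠ 0 →
      (cfc (φ p) b * r * y) * (r * r) * star (cfc (φ p) b * r * y) ≠ 0 := fun p hp hp0 h0 => by
    rw [hprod] at h0
    have h1 := norm_apply_le_norm_cfc (fun u => φ p u * u * (u * φ p u)) b hp
      (by fun_prop) hbsa
    rw [h0, norm_zero] at h1
    have h2 := norm_le_zero_iff.mp h1
    have h3 : φ p p = |s - t| / 2 := by
      simpa [φ] using (half_pos hd).le
    rw [h3] at h2
    have : |s - t| / 2 ≠ 0 := by positivity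
    simp_all
  refine hpos t ht ht0 (hno _ _ ?_ (hpos s hs hs0))
  rw [hprod, ← cfc_zero ℝ b]
  refine cfc_congr fun u _ => ?_
  change φ s u * u * (u * φ t u) = 0
  linear_combination u * u * hφ0 u

variable [PartialOrder D] [StarOrderedRing D]

/-- If no two elements `z x z*`, `w x w*` with `z x w* = 0` were both nonzero, then every self-adjoint
element of `x^½ D x^½` would have at most one nonzero spectral value. This makes `x` a multiple of a
projection with one-dimensional corner, so that `D` would be finite-dimensional. -/
theorem exists_orthogonal_pair [IsSimpleRing D] (hinf : ¬ FiniteDimensional ℂ D) {x : D}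
    (hx : 0 ≤ x) (hx0 : x ≠ 0) :
    ∃ z w : D, z * x * star w = 0 ∧ z * x * star z ≠ 0 ∧ w * x * star w ≠ 0 := by
  by_contra! hno
  set r := CFC.sqrt x with hr_def
  have hr : IsSelfAdjoint r := (CFC.sqrt_nonneg x).isSelfAdjoint
  have hrr : r * r = x := CFC.sqrt_mul_sqrt_self x
  have hsp := fun (y : D) (hy : IsSelfAdjoint y) (s t : ℝ) =>
    spectrum_subsingleton_of_no_orthogonal hr (hrr ▸ hno) hy (s := s) (t := t)
  have hsq : ∀ y : D, IsSelfAdjoint y → ∃ μ : ℝ, (r * y * r) * (r * y * r) = μ • (r * y * r) := by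
    intro y hy
    have hbsa : IsSelfAdjoint (r * y * r) := by
      rw [isSelfAdjoint_iff, star_mul, star_mul, hr.star_eq, hy.star_eq, mul_assoc]
    have key : ∀ μ : ℝ, (∀ u ∈ spectrum ℝ (r * y * r), u * u = μ * u) →
        (r * y * r) * (r * y * r) = μ • (r * y * r) := fun μ h => by
      conv_lhs => rw [← cfc_id' ℝ (r * y * r)]
      conv_rhs => rw [← cfc_id' ℝ (r * y * r)]
      rw [cfc_mul_cfc continuous_id' continuous_id', ← cfc_const_mul μ _ _ (by fun_prop)]
      exact cfc_congr h
    by_cases h : ∃ s ∈ spectrum ℝ (r * y * r), s ≠ 0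
    · obtain ⟨s, hs, hs0⟩ := h
      refine ⟨s, key s fun u hu => ?_⟩
      rcases eq_or_ne u 0 with rfl | hu0
      · simp
      · rw [hsp y hy u s hu hs hu0 hs0]
    · push Not at h
      exact ⟨0, key 0 fun u hu => by simp [h u hu]⟩
  obtain ⟨ν, hν⟩ := hsq 1 (.one _)
  rw [mul_one, hrr] at hν
  have hν0 : ν ≠ 0 := by
    rintro rfl
    rw [zero_smul] at hν
    have h1 : ‖star x * x‖ = 0 := by rw [hx.isSelfAdjoint.star_eq, hν, norm_zero]
    rw [CStarRing.norm_star_mul_self] at h1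
    exact hx0 (norm_eq_zero.mp (mul_self_eq_zero.mp h1))
  -- `x` is a multiple of a projection, and the corner it cuts out is one-dimensional
  have hcorner : ∀ y : D, IsSelfAdjoint y → ∃ c : ℝ, x * y * x = c • x := by
    intro y hy
    have hy' : IsSelfAdjoint (r * y * r) := by
      rw [isSelfAdjoint_iff, star_mul, star_mul, hr.star_eq, hy.star_eq, mul_assoc]
    have hb : ∀ k : ℝ, r * (r * y * r + k • 1) * r = x * y * x + k • x := fun k => by
      simp only [← hrr, mul_add, add_mul, mul_smul_comm, smul_mul_assoc, mul_one, mul_assoc]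
    set b := x * y * x with hb_def
    have hxb : x * b = ν • b := by rw [hb_def, ← mul_assoc, ← mul_assoc, hν]; simp
    have hbx : b * x = ν • b := by rw [hb_def, mul_assoc, hν]; simp
    have hk : ∀ k : ℝ, ∃ μ : ℝ, (b + k • x) * (b + k • x) = μ • (b + k • x) := fun k => by
      have := hsq (r * y * r + k • 1) (hy'.add (.smul (.all k) (.one _)))
      rwa [hb] at this
    obtain ⟨μ, hμ⟩ := hk 0
    rw [zero_smul, add_zero] at hμ
    by_contra! hc
    have hk' : ∀ k : ℝ, k ≠ 0 → μ + k * ν = 0 := fun k hk0 => by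
      obtain ⟨m, hm⟩ := hk k
      have e : (μ + 2 * k * ν - m) • b = (k * m - k * k * ν) • x := by
        simp only [mul_add, add_mul, smul_mul_assoc, mul_smul_comm, hxb, hbx, hν, hμ, smul_add] at hm
        rw [← sub_eq_zero] at hm ⊢
        rw [← hm]
        module
      by_cases h0 : μ + 2 * k * ν - m = 0
      · rw [h0, zero_smul] at e
        have h1 := (smul_eq_zero.mp e.symm).resolve_right hx0
        have h2 : k * (μ + k * ν) = 0 := by linear_combination h1 + k * h0
        exact (mul_eq_zero.mp h2).resolve_left hk0
      · refine absurd ?_ (hc ((μ + 2 * k * ν - m)⁻¹ * (k * m - k * k * ν)))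
        rw [mul_smul, ← e, smul_smul, inv_mul_cancel₀ h0, one_smul]
    have h1 := hk' 1 one_ne_zero
    have h2 := hk' 2 two_ne_zero
    exact hν0 (by linarith)
  refine hinf (finiteDimensional_of_corner hx0 fun y => ?_)
  obtain ⟨c, hc⟩ := hcorner (realPart y) (realPart y).2
  obtain ⟨d, hd⟩ := hcorner (imaginaryPart y) (imaginaryPart y).2
  refine ⟨c + Complex.I * d, ?_⟩
  conv_lhs => rw [← realPart_add_I_smul_imaginaryPart y]
  rw [mul_add, add_mul, hc, mul_smul_comm, smul_mul_assoc, hd, add_smul, mul_smul,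
    Complex.coe_smul, Complex.coe_smul]

theorem exists_orthogonal_fin [IsSimpleRing D] (hinf : ¬ FiniteDimensional ℂ D) (n : ℕ) {x : D}
    (hx : 0 ≤ x) (hx0 : x ≠ 0) :
    ∃ z : Fin n → D, (∀ i j, i ≠ j → z i * x * star (z j) = 0) ∧
      ∀ i, z i * x * star (z i) ≠ 0 := by
  induction n generalizing x with
  | zero => exact ⟨Fin.elim0, fun i => i.elim0, fun i => i.elim0⟩
  | succ n ih =>
    obtain ⟨z, w, hzw, hz, hw⟩ := exists_orthogonal_pair hinf hx hx0
    obtain ⟨v, hv, hv0⟩ := ih (star_right_conjugate_nonneg hx w) hw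
    have hwz : w * x * star z = 0 := by
      have := congrArg star hzw
      rwa [star_mul, star_mul, star_star, hx.isSelfAdjoint.star_eq, star_zero, ← mul_assoc] at this
    refine ⟨Fin.cons z fun j => v j * w, fun i j => ?_, fun i => ?_⟩
    · refine Fin.cases (Fin.cases ?_ fun j => ?_) (fun i => Fin.cases ?_ fun j => ?_) i j
      · simp
      · intro _
        simp only [Fin.cons_zero, Fin.cons_succ, star_mul]
        rw [← mul_assoc, hzw, zero_mul]
      · intro _
        simp only [Fin.cons_zero, Fin.cons_succ]
        rw [mul_assoc, mul_assoc, ← mul_assoc w, hwz, mul_zero]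
      · intro h
        simp only [Fin.cons_succ, star_mul]
        have := hv i j fun e => h (congrArg Fin.succ e)
        rw [← this]; noncomm_ring
    · refine Fin.cases ?_ (fun i => ?_) i
      · simpa using hz
      · have := hv0 i
        simp only [Fin.cons_succ, star_mul]
        intro h
        exact this (by rw [← h]; noncomm_ring)

/-- Two nonzero positive elements `a`, `b` of a simple C*-algebra dominate a common one: take
`(a z) b (a z)*` for some `z` with `a z b ≠ 0`. -/
theorem exists_cuntzSubequiv_both [IsSimpleRing D] {a b : D} (ha : 0 ≤ a) (ha0 : a ≠ 0)
    (hb : 0 ≤ b) (hb0 : b ≠ 0) :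
    ∃ c : D, 0 ≤ c ∧ c ≠ 0 ∧ CuntzSubequiv c a ∧ CuntzSubequiv c b := by
  obtain ⟨z, hz⟩ : ∃ z, a * z * b ≠ 0 := by
    by_contra! h
    obtain ⟨ι, _, p, q, hpq⟩ := exists_sum_mul_mul_eq_one ha0
    refine hb0 ?_
    rw [← one_mul b, ← hpq, Finset.sum_mul]
    exact Finset.sum_eq_zero fun i _ => by rw [mul_assoc, mul_assoc, ← mul_assoc a, h, mul_zero]
  have hasa := ha.isSelfAdjoint
  have hd : 0 ≤ z * b * star z := star_right_conjugate_nonneg hb z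
  have hc : 0 ≤ (a * z) * b * star (a * z) := star_right_conjugate_nonneg hb _
  refine ⟨(a * z) * b * star (a * z), hc, fun h0 => hz ?_, ?_, .of_eq_mul rfl⟩
  · set r := CFC.sqrt b
    have hr : IsSelfAdjoint r := (CFC.sqrt_nonneg b).isSelfAdjoint
    have hrr : r * r = b := CFC.sqrt_mul_sqrt_self b
    have h1 : (a * z * r) * star (a * z * r) = 0 := by
      rw [← h0, star_mul _ r, hr.star_eq, ← hrr]; noncomm_ring
    have h2 : a * z * r = 0 := by
      have := congrArg norm h1
      rwa [CStarRing.norm_self_mul_star, norm_zero, mul_self_eq_zero, norm_eq_zero] at this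
    rw [← hrr, ← mul_assoc, h2, zero_mul]
  · have e : (a * z) * b * star (a * z) = a * (z * b * star z) * a := by
      rw [star_mul, hasa.star_eq]; noncomm_ring
    have h1 : (a * z) * b * star (a * z) ≤ ‖z * b * star z‖ • (a * a) := by
      have h2 : z * b * star z ≤ algebraMap ℝ D ‖z * b * star z‖ :=
        hd.isSelfAdjoint.le_algebraMap_norm_self
      have := hasa.conjugate_le_conjugate h2
      rw [Algebra.algebraMap_eq_smul_one, mul_smul_comm, mul_one, smul_mul_assoc] at this
      rwa [e]
    refine (CuntzSubequiv.of_le hc h1).trans ?_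
    refine CuntzSubequiv.smul_left ?_ (norm_nonneg _)
    have h3 : a * a ≤ ‖a‖ • a := by
      set r := CFC.sqrt a
      have hr : IsSelfAdjoint r := (CFC.sqrt_nonneg a).isSelfAdjoint
      have hrr : r * r = a := CFC.sqrt_mul_sqrt_self a
      have := hr.conjugate_le_conjugate (hasa.le_algebraMap_norm_self)
      rw [Algebra.algebraMap_eq_smul_one, mul_smul_comm, mul_one, smul_mul_assoc, hrr] at this
      calc a * a = r * a * r := by rw [← hrr]; noncomm_ring
        _ ≤ _ := this
    exact (CuntzSubequiv.of_le hasa.mul_self_nonneg h3).trans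
      (.smul_left (.refl a) (norm_nonneg _))

theorem map_nonneg_starAlgEquiv (σ : D ≃⋆ₐ[ℂ] D) {a : D} (ha : 0 ≤ a) : 0 ≤ σ a := by
  rw [← CFC.sqrt_mul_sqrt_self a, map_mul]
  exact IsSelfAdjoint.mul_self_nonneg ((CFC.sqrt_nonneg a).isSelfAdjoint.map σ)

theorem CuntzSubequiv.map_equiv (σ : D ≃⋆ₐ[ℂ] D) {a b : D} (h : CuntzSubequiv a b) :
    CuntzSubequiv (σ a) (σ b) := h.map (σ : D →⋆ₐ[ℂ] D)

/-- Finitely many nonzero positive elements dominate the images of a single `c` under prescribed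
automorphisms. -/
theorem exists_forall_cuntzSubequiv [IsSimpleRing D] {ι : Type*} (σ : ι → (D ≃⋆ₐ[ℂ] D))
    {b : ι → D} (hb : ∀ i, 0 ≤ b i) (hb0 : ∀ i, b i ≠ 0) (s : Finset ι) :
    ∃ c : D, 0 ≤ c ∧ c ≠ 0 ∧ ∀ i ∈ s, CuntzSubequiv (σ i c) (b i) := by
  classical
  induction s using Finset.induction_on with
  | empty => exact ⟨1, zero_le_one, one_ne_zero, by simp⟩
  | insert i s _ ih =>
    obtain ⟨c, hc, hc0, h⟩ := ih
    obtain ⟨d, hd, hd0, hdc, hdb⟩ := exists_cuntzSubequiv_both hc hc0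
      (map_nonneg_starAlgEquiv (σ i).symm (hb i))
      (fun h => hb0 i ((map_eq_zero_iff _ (σ i).symm.injective).mp h))
    refine ⟨d, hd, hd0, fun j hj => ?_⟩
    rcases Finset.mem_insert.mp hj with rfl | hj
    · simpa using hdb.map_equiv (σ j)
    · exact (hdc.map_equiv (σ j)).trans (h j hj)

/-- Below a nonzero positive element `x` of an infinite-dimensional simple C*-algebra there are
mutually orthogonal elements `zᵢ x zᵢ*`, each of which dominates the image under the prescribed
automorphism `σᵢ` of a single positive element `c` of norm one. -/
theorem exists_orthogonal_translates [IsSimpleRing D] (hinf : ¬ FiniteDimensional ℂ D)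
    {ι : Type*} [Fintype ι] (σ : ι → (D ≃⋆ₐ[ℂ] D)) {x : D} (hx : 0 ≤ x) (hx0 : x ≠ 0) :
    ∃ (z : ι → D) (c : D), (∀ i j, i ≠ j → z i * x * star (z j) = 0) ∧ 0 ≤ c ∧ ‖c‖ = 1 ∧
      ∀ i, CuntzSubequiv (σ i c) (z i * x * star (z i)) := by
  obtain ⟨z, hz, hz0⟩ := exists_orthogonal_fin hinf (Fintype.card ι) hx hx0
  let e := Fintype.equivFin ι
  obtain ⟨c, hc, hc0, h⟩ := exists_forall_cuntzSubequiv σ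
    (b := fun i => z (e i) * x * star (z (e i))) (fun i => star_right_conjugate_nonneg hx _)
    (fun i => hz0 _) Finset.univ
  refine ⟨fun i => z (e i), ‖c‖⁻¹ • c, fun i j hij => hz _ _ (e.injective.ne hij),
    smul_nonneg (by positivity) hc, ?_, fun i => ?_⟩
  · rw [norm_smul, norm_inv, norm_norm, inv_mul_cancel₀ (norm_ne_zero_iff.mpr hc0)]
  · have : σ i (‖c‖⁻¹ • c) = ‖c‖⁻¹ • σ i c := by
      rw [← Complex.coe_smul, map_smul, Complex.coe_smul]
    rw [this]
    exact (h i (Finset.mem_univ i)).smul_left (by positivity)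

/-- A part `h` of `x` near the top of its spectrum: whatever is Cuntz below `h` is, up to `η`, of
the form `v x v*` with `‖v‖ ≤ 1 + η`. -/
theorem exists_top_part {x : D} (hx : 0 ≤ x) (hx1 : ‖x‖ = 1) {η : ℝ} (hη : 0 < η) :
    ∃ h : D, 0 ≤ h ∧ h ≠ 0 ∧ h ≤ x ∧ ∀ y : D, ‖y‖ = 1 → CuntzSubequiv y h →
      ∃ v : D, ‖v‖ ≤ 1 + η ∧ ‖v * x * star v - y‖ < η := by
  have hxsa := hx.isSelfAdjoint
  have : Nontrivial D := ⟨x, 0, fun h => by simp [h] at hx1⟩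
  set δ := min 1 (η / 10)
  have hδ : 0 < δ := by positivity
  have hδ1 : δ ≤ 1 := min_le_left _ _
  have hδη : δ ≤ η / 10 := min_le_right _ _
  have hspec : ∀ t ∈ spectrum ℝ x, 0 ≤ t ∧ t ≤ 1 := fun t ht =>
    ⟨spectrum_nonneg_of_nonneg hx ht, hx1 ▸ (Real.le_norm_self t).trans (spectrum.norm_le_norm_of_mem ht)⟩
  let m : ℝ → ℝ := fun t => max 0 (t - (1 - δ))
  have hm : Continuous m := by fun_prop
  let k : ℝ → ℝ := fun t => √(m t)
  have hk : Continuous k := by fun_prop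
  have hkk : cfc k x * cfc k x = cfc m x := by
    rw [cfc_mul_cfc hk hk]
    exact cfc_congr fun t _ => Real.mul_self_sqrt (le_max_left _ _)
  have hksa : IsSelfAdjoint (cfc k x) := cfc_predicate _ _
  refine ⟨cfc m x, cfc_nonneg fun t _ => le_max_left _ _, fun h0 => ?_, ?_, fun y hy hyh => ?_⟩
  · have h1 := norm_apply_le_norm_cfc m x
      (hx1 ▸ CStarAlgebra.norm_mem_spectrum_of_nonneg hx : (1 : ℝ) ∈ spectrum ℝ x)
    rw [h0, norm_zero, norm_le_zero_iff] at h1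
    have h2 : m 1 = δ := by
      simp only [m, sub_sub_cancel]
      exact max_eq_right hδ.le
    exact hδ.ne' (h2 ▸ h1)
  · conv_rhs => rw [← cfc_id' ℝ x]
    exact cfc_mono fun t ht => max_le (hspec t ht).1 (by linarith)
  · obtain ⟨w, hw⟩ := cuntzSubequiv_iff.mp hyh δ hδ
    let g : ℝ → ℝ := fun t => max (-δ) (t - 1)
    have hg : Continuous g := by fun_prop
    have hgx : ‖cfc g x‖ ≤ δ := norm_cfc_le hδ.le fun t ht => by
      rw [Real.norm_eq_abs, abs_le]
      exact ⟨le_max_left _ _, max_le (by linarith) (by linarith [(hspec t ht).2])⟩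
    -- on the support of `k`, the function `t - 1` agrees with its truncation `g`
    have hkg : cfc k x * (x - 1) * cfc k x = cfc k x * cfc g x * cfc k x := by
      have e1 : x - 1 = cfc (fun t : ℝ => t - 1) x := by
        rw [cfc_sub .., cfc_id' ℝ x, cfc_const_one ℝ x]
      rw [e1, cfc_mul_cfc hk (by fun_prop), cfc_mul_cfc (by fun_prop) hk, cfc_mul_cfc hk hg,
        cfc_mul_cfc (by fun_prop) hk]
      refine cfc_congr fun t _ => ?_
      rcases le_total 0 (t - (1 - δ)) with h | h
      · have : g t = t - 1 := max_eq_right (by linarith)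
        simp only [this]
      · have : k t = 0 := by simp [k, m, max_eq_left h]
        simp only [this, zero_mul]
    have hvv : (w * cfc k x) * star (w * cfc k x) = w * cfc m x * star w := by
      rw [star_mul, hksa.star_eq, ← hkk]; noncomm_ring
    have hv2 : ‖w * cfc k x‖ * ‖w * cfc k x‖ ≤ 1 + δ := by
      rw [← CStarRing.norm_self_mul_star, hvv]
      have := norm_add_le (w * cfc m x * star w - y) y
      rw [sub_add_cancel, hy] at this
      linarith
    have hdiff : ‖(w * cfc k x) * x * star (w * cfc k x) - w * cfc m x * star w‖ ≤ 2 * δ := by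
      have e : (w * cfc k x) * x * star (w * cfc k x) - w * cfc m x * star w =
          (w * cfc k x) * cfc g x * star (w * cfc k x) := by
        rw [← hvv, star_mul, hksa.star_eq]
        calc _ = w * (cfc k x * (x - 1) * cfc k x) * star w := by noncomm_ring
          _ = _ := by rw [hkg]; noncomm_ring
      rw [e]
      calc _ ≤ ‖w * cfc k x‖ * ‖cfc g x‖ * ‖star (w * cfc k x)‖ := norm_mul₃_le
        _ = (‖w * cfc k x‖ * ‖w * cfc k x‖) * ‖cfc g x‖ := by rw [norm_star]; ring
        _ ≤ 2 * δ := mul_le_mul (by linarith) hgx (norm_nonneg _) (by norm_num)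
    refine ⟨w * cfc k x, ?_, ?_⟩
    · nlinarith [norm_nonneg (w * cfc k x)]
    · calc _ = ‖((w * cfc k x) * x * star (w * cfc k x) - w * cfc m x * star w) +
            (w * cfc m x * star w - y)‖ := by rw [sub_add_sub_cancel]
        _ ≤ _ := norm_add_le _ _
        _ < η := by linarith

end Simple

/-! ### Bounded sequences modulo null sequences -/

section BoundedSequences

/-- The C*-algebra of bounded sequences in `D`, as a *-algebra. -/
def boundedSeq (D : Type*) [CStarAlgebra D] : StarSubalgebra ℂ (ℕ → D) where
  carrier := {a | ∃ C : ℝ, ∀ n, ‖a n‖ ≤ C}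
  mul_mem' := by
    rintro a b ⟨C, hC⟩ ⟨C', hC'⟩
    refine ⟨C * C', fun n => (norm_mul_le _ _).trans ?_⟩
    exact mul_le_mul (hC n) (hC' n) (norm_nonneg _) ((norm_nonneg _).trans (hC n))
  add_mem' := by
    rintro a b ⟨C, hC⟩ ⟨C', hC'⟩
    exact ⟨C + C', fun n => (norm_add_le _ _).trans (add_le_add (hC n) (hC' n))⟩
  algebraMap_mem' z := ⟨‖algebraMap ℂ D z‖, fun n => le_rfl⟩
  star_mem' := by
    rintro a ⟨C, hC⟩
    exact ⟨C, fun n => by simpa using hC n⟩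

/-- Bounded sequences in `D`. -/
abbrev BddSeq (D : Type*) [CStarAlgebra D] : Type _ := boundedSeq D

variable {D : Type*} [CStarAlgebra D]

namespace BddSeq

variable (D) in
/-- The `n`-th term of a bounded sequence, as a *-homomorphism. -/
def eval (n : ℕ) : BddSeq D →⋆ₐ[ℂ] D where
  toFun a := a.1 n
  map_one' := rfl
  map_mul' _ _ := rfl
  map_zero' := rfl
  map_add' _ _ := rfl
  commutes' _ := rfl
  map_star' _ := rfl

theorem ext {a b : BddSeq D} (h : ∀ n, eval D n a = eval D n b) : a = b :=
  Subtype.ext (funext h)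

/-- The bounded sequence with the given terms. -/
def of (a : ℕ → D) (h : ∃ C : ℝ, ∀ n, ‖a n‖ ≤ C) : BddSeq D := ⟨a, h⟩

@[simp] theorem eval_of (a : ℕ → D) (h : ∃ C : ℝ, ∀ n, ‖a n‖ ≤ C) (n : ℕ) :
    eval D n (of a h) = a n := rfl

theorem exists_bound (a : BddSeq D) : ∃ C : ℝ, 0 ≤ C ∧ ∀ n, ‖eval D n a‖ ≤ C := by
  obtain ⟨C, hC⟩ := a.2
  exact ⟨C, (norm_nonneg _).trans (hC 0), hC⟩

variable (D) in
/-- Constant sequences. -/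
def const : D →⋆ₐ[ℂ] BddSeq D where
  toFun d := ⟨fun _ => d, ‖d‖, fun _ => le_rfl⟩
  map_one' := rfl
  map_mul' _ _ := rfl
  map_zero' := rfl
  map_add' _ _ := rfl
  commutes' _ := rfl
  map_star' _ := rfl

@[simp] theorem eval_const (n : ℕ) (d : D) : eval D n (const D d) = d := rfl

variable {D' : Type*} [CStarAlgebra D']

/-- A *-homomorphism, applied term by term. -/
def map (φ : D →⋆ₐ[ℂ] D') : BddSeq D →⋆ₐ[ℂ] BddSeq D' where
  toFun a := ⟨fun n => φ (a.1 n), by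
    obtain ⟨C, hC⟩ := a.2
    exact ⟨C, fun n => (NonUnitalStarAlgHom.norm_apply_le φ _).trans (hC n)⟩⟩
  map_one' := ext fun _ => map_one φ
  map_mul' _ _ := ext fun _ => map_mul φ _ _
  map_zero' := ext fun _ => map_zero φ
  map_add' _ _ := ext fun _ => map_add φ _ _
  commutes' z := ext fun _ => AlgHomClass.commutes φ z
  map_star' _ := ext fun _ => map_star φ _

@[simp] theorem eval_map (φ : D →⋆ₐ[ℂ] D') (n : ℕ) (a : BddSeq D) :
    eval D' n (map φ a) = φ (eval D n a) := rfl

end BddSeq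

open BddSeq

/-- Asymptotic equality of bounded sequences. -/
def nullCon (D : Type*) [CStarAlgebra D] : RingCon (BddSeq D) where
  r a b := Tendsto (fun n => eval D n a - eval D n b) atTop (𝓝 0)
  iseqv :=
    { refl := fun a => by simp only [sub_self]; exact tendsto_const_nhds
      symm := fun h => by
        have := h.neg
        rw [neg_zero] at this
        exact this.congr fun n => neg_sub _ _
      trans := fun h h' => by
        have := h.add h'
        rw [add_zero] at this
        exact this.congr fun n => sub_add_sub_cancel _ _ _ }
  add' h h' := by
    have := h.add h'
    rw [add_zero] at this
    refine this.congr fun n => ?_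
    rw [map_add, map_add]; abel
  mul' {a b c d} h h' := by
    obtain ⟨C, hC0, hC⟩ := exists_bound a
    obtain ⟨C', hC'0, hC'⟩ := exists_bound d
    have h1 : Tendsto (fun n => C * ‖eval D n c - eval D n d‖ + ‖eval D n a - eval D n b‖ * C') atTop
        (𝓝 0) := by
      simpa using (h'.norm.const_mul C).add (h.norm.mul_const C')
    refine squeeze_zero_norm (fun n => ?_) h1
    have e : eval D n (a * c) - eval D n (b * d) =
        eval D n a * (eval D n c - eval D n d) + (eval D n a - eval D n b) * eval D n d := by
      rw [map_mul, map_mul]; noncomm_ring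
    rw [e]
    refine (norm_add_le _ _).trans (add_le_add ?_ ?_)
    · exact (norm_mul_le _ _).trans (mul_le_mul_of_nonneg_right (hC n) (norm_nonneg _))
    · exact (norm_mul_le _ _).trans (mul_le_mul_of_nonneg_left (hC' n) (norm_nonneg _))

/-- The sequence algebra `ℓ^∞(D) / c₀(D)`, as a *-algebra: bounded sequences up to asymptotic
equality. -/
abbrev SeqAlg (D : Type*) [CStarAlgebra D] := (nullCon D).Quotient

namespace SeqAlg

theorem nullCon_star {a b : BddSeq D} (h : nullCon D a b) : nullCon D (star a) (star b) := by
  have h' : Tendsto (fun n => eval D n a - eval D n b) atTop (𝓝 0) := h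
  have := (continuous_star.tendsto (0 : D)).comp h'
  rw [star_zero] at this
  refine Tendsto.congr (fun n => ?_) this
  simp [map_star]

noncomputable instance : StarRing (SeqAlg D) where
  star := Quotient.map star fun _ _ h => nullCon_star h
  star_involutive := by
    rintro ⟨a⟩
    exact congrArg ((↑) : BddSeq D → SeqAlg D) (star_star a)
  star_mul := by
    rintro ⟨a⟩ ⟨b⟩
    exact congrArg ((↑) : BddSeq D → SeqAlg D) (star_mul a b)
  star_add := by
    rintro ⟨a⟩ ⟨b⟩
    exact congrArg ((↑) : BddSeq D → SeqAlg D) (star_add a b)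

instance : StarModule ℂ (SeqAlg D) where
  star_smul := by
    rintro z ⟨a⟩
    exact congrArg ((↑) : BddSeq D → SeqAlg D) (star_smul z a)

variable (D) in
/-- The class of a bounded sequence. -/
noncomputable def mk : BddSeq D →⋆ₐ[ℂ] SeqAlg D where
  __ := RingCon.mkₐ (α := ℂ) (nullCon D)
  map_star' _ := rfl

theorem mk_surjective : Function.Surjective (mk D : BddSeq D →⋆ₐ[ℂ] SeqAlg D) :=
  Quotient.mk_surjective

theorem mk_eq_mk {a b : BddSeq D} :
    mk D a = mk D b ↔ Tendsto (fun n => eval D n a - eval D n b) atTop (𝓝 0) :=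
  RingCon.eq (nullCon D)

theorem mk_eq_mk_iff_norm {a b : BddSeq D} :
    mk D a = mk D b ↔ ∀ ε : ℝ, 0 < ε → ∀ᶠ n in atTop, ‖eval D n a - eval D n b‖ < ε := by
  rw [mk_eq_mk, Metric.tendsto_nhds]
  simp [dist_eq_norm]

variable {D' : Type*} [CStarAlgebra D']

/-- The *-homomorphism of sequence algebras induced by a *-homomorphism. -/
noncomputable def map (φ : D →⋆ₐ[ℂ] D') : SeqAlg D →⋆ₐ[ℂ] SeqAlg D' where
  toFun := Quotient.map (BddSeq.map φ) fun a b h => by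
    have h' : mk D a = mk D b := Quotient.sound h
    refine mk_eq_mk.mp (mk_eq_mk.mpr ?_)
    refine squeeze_zero_norm (fun n => ?_) (tendsto_zero_iff_norm_tendsto_zero.mp (mk_eq_mk.mp h'))
    rw [BddSeq.eval_map, BddSeq.eval_map, ← map_sub]
    exact NonUnitalStarAlgHom.norm_apply_le φ _
  map_one' := congrArg (mk D') (map_one (BddSeq.map φ))
  map_mul' := by
    rintro ⟨a⟩ ⟨b⟩
    exact congrArg (mk D') (map_mul (BddSeq.map φ) a b)
  map_zero' := congrArg (mk D') (map_zero (BddSeq.map φ))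
  map_add' := by
    rintro ⟨a⟩ ⟨b⟩
    exact congrArg (mk D') (map_add (BddSeq.map φ) a b)
  commutes' z := congrArg (mk D') (AlgHomClass.commutes (BddSeq.map φ) z)
  map_star' := by
    rintro ⟨a⟩
    exact congrArg (mk D') (map_star (BddSeq.map φ) a)

@[simp] theorem map_mk (φ : D →⋆ₐ[ℂ] D') (a : BddSeq D) : map φ (mk D a) = mk D' (BddSeq.map φ a) := rfl

theorem map_injective (φ : D →⋆ₐ[ℂ] D') (hφ : Function.Injective φ) :
    Function.Injective (map φ) := by
  intro a b h
  obtain ⟨a, rfl⟩ := mk_surjective a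
  obtain ⟨b, rfl⟩ := mk_surjective b
  rw [map_mk, map_mk, mk_eq_mk] at h
  rw [mk_eq_mk, tendsto_zero_iff_norm_tendsto_zero]
  refine (tendsto_zero_iff_norm_tendsto_zero.mp h).congr fun n => ?_
  rw [BddSeq.eval_map, BddSeq.eval_map, ← map_sub, NonUnitalStarAlgHom.norm_map φ hφ]

variable (D) in
/-- Constant sequences in the sequence algebra. -/
noncomputable def const : D →⋆ₐ[ℂ] SeqAlg D := (mk D).comp (BddSeq.const D)

theorem mk_const (d : D) : mk D (BddSeq.const D d) = const D d := rfl

@[simp] theorem map_const (φ : D →⋆ₐ[ℂ] D') (d : D) : map φ (const D d) = const D' (φ d) := rfl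

theorem eq_zero_of_mul_star {z : SeqAlg D} (h : z * star z = 0) : z = 0 := by
  obtain ⟨a, rfl⟩ := mk_surjective z
  rw [← map_star, ← map_mul, ← map_zero (mk D), mk_eq_mk] at h
  rw [← map_zero (mk D), mk_eq_mk]
  have h1 : Tendsto (fun n => ‖eval D n a‖ * ‖eval D n a‖) atTop (𝓝 0) := by
    refine (tendsto_zero_iff_norm_tendsto_zero.mp h).congr fun n => ?_
    rw [map_zero, sub_zero, map_mul, map_star, CStarRing.norm_self_mul_star]
  rw [tendsto_zero_iff_norm_tendsto_zero]
  have h2 := (Real.continuous_sqrt.tendsto 0).comp h1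
  rw [Real.sqrt_zero] at h2
  refine h2.congr fun n => ?_
  simp [Real.sqrt_mul_self (norm_nonneg _)]

end SeqAlg

end BoundedSequences

/-! ### Functional calculus for bounded sequences -/

section SequenceCalculus

open BddSeq

variable {D : Type*} [CStarAlgebra D]

theorem abs_le_norm_of_mem_spectrum {d : D} {t : ℝ} (ht : t ∈ spectrum ℝ d) : |t| ≤ ‖d‖ := by
  have : Nontrivial D := by
    by_contra h
    rw [not_nontrivial_iff_subsingleton] at h
    simp at ht
  exact spectrum.norm_le_norm_of_mem ht

theorem exists_bound_of_continuous {φ : ℝ → ℝ} (hφ : Continuous φ) (C : ℝ) :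
    ∃ K : ℝ, 0 ≤ K ∧ ∀ t, |t| ≤ C → |φ t| ≤ K := by
  obtain ⟨K, hK⟩ := (isCompact_Icc (a := -C) (b := C)).exists_bound_of_continuousOn hφ.continuousOn
  exact ⟨max K 0, le_max_right _ _, fun t ht =>
    (hK t (abs_le.mp ht)).trans (le_max_left _ _)⟩

/-- Continuous functional calculus, applied term by term. -/
noncomputable def BddSeq.cfcSeq (φ : C(ℝ, ℝ)) (a : BddSeq D) : BddSeq D :=
  BddSeq.of (fun n => cfc φ (eval D n a)) (by
    obtain ⟨C, -, hC⟩ := exists_bound a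
    obtain ⟨K, hK0, hK⟩ := exists_bound_of_continuous φ.continuous C
    exact ⟨K, fun n => norm_cfc_le hK0 fun t ht =>
      hK t ((abs_le_norm_of_mem_spectrum ht).trans (hC n))⟩)

@[simp] theorem BddSeq.eval_cfcSeq (φ : C(ℝ, ℝ)) (a : BddSeq D) (n : ℕ) :
    eval D n (cfcSeq φ a) = cfc φ (eval D n a) := rfl

theorem norm_cfc_sub_aeval_le {φ : C(ℝ, ℝ)} {q : Polynomial ℝ} {C ε : ℝ} (hε : 0 ≤ ε)
    (hq : ∀ t ∈ Set.Icc (-C) C, |q.eval t - φ t| < ε) {d : D} (hd : IsSelfAdjoint d)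
    (hdC : ‖d‖ ≤ C) : ‖cfc φ d - Polynomial.aeval d q‖ ≤ ε := by
  rw [← cfc_polynomial q d, ← cfc_sub φ q.eval d (by fun_prop) (by fun_prop)]
  refine norm_cfc_le hε fun t ht => ?_
  have := hq t (abs_le.mp ((abs_le_norm_of_mem_spectrum ht).trans hdC))
  rw [abs_sub_comm] at this
  exact this.le

/-- Functional calculus respects asymptotic equality, by polynomial approximation on a bounded
interval. -/
theorem mk_cfcSeq_congr (φ : C(ℝ, ℝ)) {a b : BddSeq D} (ha : ∀ n, IsSelfAdjoint (eval D n a))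
    (hb : ∀ n, IsSelfAdjoint (eval D n b)) (h : SeqAlg.mk D a = SeqAlg.mk D b) :
    SeqAlg.mk D (cfcSeq φ a) = SeqAlg.mk D (cfcSeq φ b) := by
  obtain ⟨C, -, hC⟩ := exists_bound a
  obtain ⟨C', -, hC'⟩ := exists_bound b
  rw [SeqAlg.mk_eq_mk_iff_norm]
  intro ε hε
  obtain ⟨q, hq⟩ := exists_polynomial_near_of_continuousOn (-(max C C')) (max C C') φ
    φ.continuous.continuousOn (ε / 3) (by positivity)
  have hpoly : ∀ q : Polynomial ℝ,
      Tendsto (fun n => Polynomial.aeval (eval D n a) q - Polynomial.aeval (eval D n b) q) atTop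
        (𝓝 0) := fun q => by
    induction q using Polynomial.induction_on' with
    | add p q hp hq =>
      have := hp.add hq
      rw [add_zero] at this
      refine this.congr fun n => ?_
      rw [map_add, map_add]; abel
    | monomial k c =>
      have h1 : SeqAlg.mk D (a ^ k) = SeqAlg.mk D (b ^ k) := by rw [map_pow, map_pow, h]
      have := (SeqAlg.mk_eq_mk.mp h1).const_smul c
      rw [smul_zero] at this
      refine this.congr fun n => ?_
      rw [Polynomial.aeval_monomial, Polynomial.aeval_monomial, map_pow, map_pow, smul_sub,
        Algebra.smul_def, Algebra.smul_def]
  filter_upwards [(Metric.tendsto_nhds.mp (hpoly q)) (ε / 3) (by positivity)] with n hn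
  rw [dist_zero_right] at hn
  have h1 := norm_cfc_sub_aeval_le (by positivity) hq (ha n) ((hC n).trans (le_max_left _ _))
  have h2 := norm_cfc_sub_aeval_le (by positivity) hq (hb n) ((hC' n).trans (le_max_right _ _))
  rw [eval_cfcSeq, eval_cfcSeq]
  calc _ = ‖(cfc φ (eval D n a) - Polynomial.aeval (eval D n a) q) +
        (Polynomial.aeval (eval D n a) q - Polynomial.aeval (eval D n b) q) -
        (cfc φ (eval D n b) - Polynomial.aeval (eval D n b) q)‖ := by congr 1; abel
    _ ≤ _ := (norm_sub_le _ _).trans (add_le_add_left (norm_add_le _ _) _)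
    _ < ε := by linarith

theorem mul_cfc_eq_zero (φ : C(ℝ, ℝ)) (hφ : φ 0 = 0) {z d : D} (hd : IsSelfAdjoint d)
    (h : z * d = 0) : z * cfc φ d = 0 := by
  refine norm_le_zero_iff.mp (le_of_forall_pos_le_add fun ε hε => ?_)
  set δ := ε / (2 * (‖z‖ + 1))
  have hδ : 0 < δ := by positivity
  obtain ⟨q, hq⟩ := exists_polynomial_near_of_continuousOn (-‖d‖) ‖d‖ φ
    φ.continuous.continuousOn δ hδ
  have h0 := hq 0 (by simp)
  rw [hφ, sub_zero] at h0
  have h1 := norm_cfc_sub_aeval_le hδ.le hq hd le_rfl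
  have h2 : z * Polynomial.aeval d q = q.eval 0 • z := by
    conv_lhs => rw [← Polynomial.X_mul_divX_add q]
    rw [map_add, map_mul, Polynomial.aeval_X, Polynomial.aeval_C, mul_add, ← mul_assoc, h, zero_mul,
      zero_add, ← Algebra.commutes, ← Algebra.smul_def, Polynomial.coeff_zero_eq_eval_zero]
  calc ‖z * cfc φ d‖ = ‖z * (cfc φ d - Polynomial.aeval d q) + q.eval 0 • z‖ := by
        rw [mul_sub, h2, sub_add_cancel]
    _ ≤ ‖z‖ * δ + δ * ‖z‖ := by
        refine (norm_add_le _ _).trans (add_le_add ?_ ?_)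
        · exact (norm_mul_le _ _).trans (mul_le_mul_of_nonneg_left h1 (norm_nonneg _))
        · rw [norm_smul, Real.norm_eq_abs]
          exact mul_le_mul_of_nonneg_right h0.le (norm_nonneg _)
    _ = ε * (‖z‖ / (‖z‖ + 1)) := by simp only [δ]; field_simp; ring
    _ ≤ 0 + ε := by
        rw [zero_add]
        refine mul_le_of_le_one_right hε.le ?_
        rw [div_le_one (by positivity)]; linarith

end SequenceCalculus

/-! ### Lifting orthogonal positive elements -/

section Lifting

open BddSeq

/-- The function `t ↦ max t 0`. -/
def posFun : C(ℝ, ℝ) := ⟨fun t => max t 0, by fun_prop⟩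

/-- The function `t ↦ max (-t) 0`. -/
def negFun : C(ℝ, ℝ) := ⟨fun t => max (-t) 0, by fun_prop⟩

/-- The cube root of the positive part. -/
noncomputable def cbrtFun : C(ℝ, ℝ) :=
  ⟨fun t => (max t 0) ^ (1 / 3 : ℝ),
    (continuous_id.max continuous_const).rpow_const fun _ => Or.inr (by norm_num)⟩

/-- The square root. -/
noncomputable def sqrtFun : C(ℝ, ℝ) := ⟨fun t => √t, by fun_prop⟩

theorem posFun_apply (t : ℝ) : posFun t = max t 0 := rfl
theorem negFun_apply (t : ℝ) : negFun t = max (-t) 0 := rfl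
theorem cbrtFun_apply (t : ℝ) : cbrtFun t = (max t 0) ^ (1 / 3 : ℝ) := rfl
theorem sqrtFun_apply (t : ℝ) : sqrtFun t = √t := rfl

theorem cbrtFun_cube (t : ℝ) : cbrtFun (t * t * t) = max t 0 := by
  rw [cbrtFun_apply]
  rcases le_total 0 t with h | h
  · rw [max_eq_left h, max_eq_left (by positivity), show t * t * t = t ^ (3 : ℝ) by
      rw [show (3 : ℝ) = ((3 : ℕ) : ℝ) by norm_num, Real.rpow_natCast]; ring,
      ← Real.rpow_mul h]
    norm_num
  · rw [max_eq_right h, max_eq_right]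
    · norm_num
    · nlinarith [mul_self_nonneg t, mul_nonneg (mul_self_nonneg t) (neg_nonneg.mpr h)]

variable {D : Type*} [CStarAlgebra D]

theorem cfc_posFun_sub_negFun {d : D} (hd : IsSelfAdjoint d) :
    cfc posFun d - cfc negFun d = d := by
  rw [← cfc_sub _ _ d (by fun_prop) (by fun_prop)]
  conv_rhs => rw [← cfc_id' ℝ d]
  refine cfc_congr fun t _ => ?_
  simp only [posFun_apply, negFun_apply]
  rcases le_total 0 t with h | h
  · rw [max_eq_left h, max_eq_right (by linarith), sub_zero]
  · rw [max_eq_right h, max_eq_left (by linarith)]; ring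

theorem cfc_posFun_mul_negFun (d : D) : cfc posFun d * cfc negFun d = 0 := by
  rw [cfc_mul_cfc posFun.continuous negFun.continuous, ← cfc_zero ℝ d]
  refine cfc_congr fun t _ => ?_
  simp only [posFun_apply, negFun_apply, Pi.zero_apply]
  rcases le_total 0 t with h | h
  · rw [max_eq_right (by linarith : -t ≤ 0), mul_zero]
  · rw [max_eq_right h, zero_mul]

theorem cfc_sqrtFun_mul_self {d : D} (hd : IsSelfAdjoint d) :
    cfc sqrtFun (d * d) = cfc posFun d + cfc negFun d := by
  have e : d * d = cfc (fun t : ℝ => t * t) d := by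
    rw [← cfc_mul_self continuous_id' hd, cfc_id' ℝ d]
  rw [e, ← cfc_comp' sqrtFun (fun t : ℝ => t * t) d (by fun_prop) (by fun_prop) hd,
    ← cfc_add _ _ _ (by fun_prop) (by fun_prop)]
  refine cfc_congr fun t _ => ?_
  simp only [posFun_apply, negFun_apply, sqrtFun_apply, Real.sqrt_mul_self_eq_abs]
  rcases le_total 0 t with h | h
  · rw [max_eq_left h, max_eq_right (by linarith), abs_of_nonneg h, add_zero]
  · rw [max_eq_right h, max_eq_left (by linarith), abs_of_nonpos h, zero_add]

theorem cfc_cbrtFun_cube {d : D} (hd : IsSelfAdjoint d) :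
    cfc cbrtFun (d * d * d) = cfc posFun d := by
  have e : d * d * d = cfc (fun t : ℝ => t * t * t) d := by
    conv_lhs => rw [← cfc_id' ℝ d]
    rw [cfc_mul_cfc continuous_id' continuous_id', cfc_mul_cfc (by fun_prop) continuous_id']
  rw [e, ← cfc_comp' cbrtFun (fun t : ℝ => t * t * t) d (by fun_prop) (by fun_prop) hd]
  exact cfc_congr fun t _ => cbrtFun_cube t

variable [PartialOrder D] [StarOrderedRing D]

theorem cfc_posFun_of_nonneg {d : D} (hd : 0 ≤ d) : cfc posFun d = d := by
  conv_rhs => rw [← cfc_id' ℝ d]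
  exact cfc_congr fun t ht => max_eq_left (spectrum_nonneg_of_nonneg hd ht)

theorem cfc_negFun_of_nonneg {d : D} (hd : 0 ≤ d) : cfc negFun d = 0 := by
  rw [← cfc_zero ℝ d]
  exact cfc_congr fun t ht => max_eq_right (neg_nonpos.mpr (spectrum_nonneg_of_nonneg hd ht))

theorem BddSeq.cfcSeq_nonneg {φ : C(ℝ, ℝ)} (hφ : ∀ t, 0 ≤ φ t) (a : BddSeq D) (n : ℕ) :
    0 ≤ eval D n (cfcSeq φ a) := cfc_nonneg fun t _ => hφ t

theorem posFun_nonneg (t : ℝ) : 0 ≤ posFun t := le_max_right _ _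
theorem negFun_nonneg (t : ℝ) : 0 ≤ negFun t := le_max_right _ _
theorem cbrtFun_nonneg (t : ℝ) : 0 ≤ cbrtFun t := Real.rpow_nonneg (le_max_right _ _) _

/-- Asymptotically orthogonal positive sequences `f`, `r` are recovered asymptotically as the
positive and the negative part of `f - r`, since `|f - r| = ((f - r)²)^½ ∼ ((f + r)²)^½ = f + r`. -/
theorem mk_posFun_negFun_sub {f r : BddSeq D} (hf : ∀ n, 0 ≤ eval D n f)
    (hr : ∀ n, 0 ≤ eval D n r) (h : SeqAlg.mk D f * SeqAlg.mk D r = 0)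
    (h' : SeqAlg.mk D r * SeqAlg.mk D f = 0) :
    SeqAlg.mk D (cfcSeq posFun (f - r)) = SeqAlg.mk D f ∧
      SeqAlg.mk D (cfcSeq negFun (f - r)) = SeqAlg.mk D r := by
  have hsub : ∀ n, IsSelfAdjoint (eval D n (f - r)) := fun n => by
    rw [map_sub]; exact (hf n).isSelfAdjoint.sub (hr n).isSelfAdjoint
  have hadd : ∀ n, 0 ≤ eval D n (f + r) := fun n => by
    rw [map_add]; exact add_nonneg (hf n) (hr n)
  have h1 : SeqAlg.mk D ((f - r) * (f - r)) = SeqAlg.mk D ((f + r) * (f + r)) := by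
    simp only [map_mul, map_sub, map_add, sub_mul, mul_sub, add_mul, mul_add, h, h']
    abel
  have h2 := mk_cfcSeq_congr sqrtFun (fun n => by
    rw [map_mul]; exact (hsub n).mul_self_nonneg.isSelfAdjoint) (fun n => by
    rw [map_mul]; exact (hadd n).isSelfAdjoint.mul_self_nonneg.isSelfAdjoint) h1
  have h3 : cfcSeq sqrtFun ((f - r) * (f - r)) =
      cfcSeq posFun (f - r) + cfcSeq negFun (f - r) := BddSeq.ext fun n => by
    rw [eval_cfcSeq, map_mul, cfc_sqrtFun_mul_self (hsub n)]; rfl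
  have h4 : cfcSeq sqrtFun ((f + r) * (f + r)) = f + r := BddSeq.ext fun n => by
    rw [eval_cfcSeq, map_mul, cfc_sqrtFun_mul_self (hadd n).isSelfAdjoint,
      cfc_posFun_of_nonneg (hadd n), cfc_negFun_of_nonneg (hadd n), add_zero]
  have h5 : cfcSeq posFun (f - r) - cfcSeq negFun (f - r) = f - r := BddSeq.ext fun n =>
    cfc_posFun_sub_negFun (hsub n)
  rw [h3, h4] at h2
  have h6 := congrArg (SeqAlg.mk D) h5
  rw [map_add, map_add] at h2
  rw [map_sub, map_sub] at h6
  set P := SeqAlg.mk D (cfcSeq posFun (f - r))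
  set N := SeqAlg.mk D (cfcSeq negFun (f - r))
  set F := SeqAlg.mk D f
  set R := SeqAlg.mk D r
  have hP : P = F := by
    have : P = (1 / 2 : ℂ) • ((P + N) + (P - N)) := by module
    rw [this, h2, h6]; module
  exact ⟨hP, by rw [hP] at h2; exact add_left_cancel h2⟩

/-- Asymptotically orthogonal positive sequences are asymptotic to exactly orthogonal ones, and the
latter can be chosen to be annihilated by everything that annihilates the former. -/
theorem exists_orthogonal_lift {ι : Type*} [DecidableEq ι] (s : Finset ι) (f : ι → BddSeq D)
    (hf : ∀ i n, 0 ≤ eval D n (f i))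
    (horth : ∀ i ∈ s, ∀ j ∈ s, i ≠ j → SeqAlg.mk D (f i) * SeqAlg.mk D (f j) = 0) :
    ∃ f' : ι → BddSeq D, (∀ i n, 0 ≤ eval D n (f' i)) ∧
      (∀ i ∈ s, ∀ j ∈ s, i ≠ j → f' i * f' j = 0) ∧
      (∀ i ∈ s, SeqAlg.mk D (f' i) = SeqAlg.mk D (f i)) ∧
      ∀ z : BddSeq D, (∀ i ∈ s, z * f i = 0) → ∀ i ∈ s, z * f' i = 0 := by
  induction s using Finset.induction_on generalizing f with
  | empty => exact ⟨f, hf, by simp, by simp, by simp⟩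
  | insert i₀ s hi₀ ih =>
    have hne : ∀ j ∈ s, j ≠ i₀ := fun j hj e => hi₀ (e ▸ hj)
    have hstar : ∀ (a : BddSeq D), (∀ n, 0 ≤ eval D n a) → star a = a := fun a ha =>
      BddSeq.ext fun n => by rw [map_star]; exact (ha n).isSelfAdjoint
    set r := ∑ j ∈ s, f j with hr_def
    have hr : ∀ n, 0 ≤ eval D n r := fun n => by
      rw [map_sum]; exact Finset.sum_nonneg fun j _ => hf j n
    have hFR : SeqAlg.mk D (f i₀) * SeqAlg.mk D r = 0 := by
      rw [map_sum, Finset.mul_sum]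
      exact Finset.sum_eq_zero fun j hj => horth _ (Finset.mem_insert_self _ _) _
        (Finset.mem_insert_of_mem hj) (hne j hj).symm
    have hRF : SeqAlg.mk D r * SeqAlg.mk D (f i₀) = 0 := by
      rw [map_sum, Finset.sum_mul]
      exact Finset.sum_eq_zero fun j hj => horth _ (Finset.mem_insert_of_mem hj) _
        (Finset.mem_insert_self _ _) (hne j hj)
    obtain ⟨hp, hm⟩ := mk_posFun_negFun_sub (hf i₀) hr hFR hRF
    set b := f i₀ - r with hb
    have hbsa : ∀ n, IsSelfAdjoint (eval D n b) := fun n => by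
      rw [hb, map_sub]; exact (hf i₀ n).isSelfAdjoint.sub (hr n).isSelfAdjoint
    set p := cfcSeq posFun b
    set m := cfcSeq negFun b
    have hp0 : ∀ n, 0 ≤ eval D n p := cfcSeq_nonneg posFun_nonneg b
    have hm0 : ∀ n, 0 ≤ eval D n m := cfcSeq_nonneg negFun_nonneg b
    have hpm : p * m = 0 := BddSeq.ext fun n => cfc_posFun_mul_negFun _
    have hmfm : ∀ j n, 0 ≤ eval D n (m * f j * m) := fun j n => by
      rw [map_mul, map_mul]
      exact (hm0 n).isSelfAdjoint.conjugate_nonneg (hf j n)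
    let g : ι → BddSeq D := fun j => cfcSeq cbrtFun (m * f j * m)
    have hg : ∀ i n, 0 ≤ eval D n (g i) := fun i n => cfcSeq_nonneg cbrtFun_nonneg _ n
    have hgf : ∀ i ∈ s, SeqAlg.mk D (g i) = SeqAlg.mk D (f i) := fun i hi => by
      have hRf : SeqAlg.mk D r * SeqAlg.mk D (f i) = SeqAlg.mk D (f i) * SeqAlg.mk D (f i) := by
        rw [map_sum, Finset.sum_mul, Finset.sum_eq_single i]
        · exact fun j hj hji => horth _ (Finset.mem_insert_of_mem hj) _
            (Finset.mem_insert_of_mem hi) hji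
        · exact fun h => absurd hi h
      have hfR : SeqAlg.mk D (f i) * SeqAlg.mk D r = SeqAlg.mk D (f i) * SeqAlg.mk D (f i) := by
        rw [map_sum, Finset.mul_sum, Finset.sum_eq_single i]
        · exact fun j hj hji => horth _ (Finset.mem_insert_of_mem hi) _
            (Finset.mem_insert_of_mem hj) hji.symm
        · exact fun h => absurd hi h
      have h1 : SeqAlg.mk D (m * f i * m) = SeqAlg.mk D (f i * f i * f i) := by
        rw [map_mul, map_mul, hm, hRf, mul_assoc, hfR, map_mul, map_mul, mul_assoc]
      have h2 := mk_cfcSeq_congr cbrtFun (fun n => (hmfm i n).isSelfAdjoint) (fun n => by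
        rw [map_mul, map_mul]
        exact ((hf i n).isSelfAdjoint.conjugate_nonneg (hf i n)).isSelfAdjoint) h1
      have h3 : cfcSeq cbrtFun (f i * f i * f i) = f i := BddSeq.ext fun n => by
        rw [eval_cfcSeq, map_mul, map_mul, cfc_cbrtFun_cube (hf i n).isSelfAdjoint,
          cfc_posFun_of_nonneg (hf i n)]
      rw [h3] at h2
      exact h2
    have hann : ∀ z : BddSeq D, z * m = 0 → ∀ i, z * g i = 0 := fun z hz i =>
      BddSeq.ext fun n => by
        rw [map_mul, map_zero]
        refine mul_cfc_eq_zero cbrtFun ?_ (hmfm i n).isSelfAdjoint ?_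
        · have := cbrtFun_cube 0
          simpa using this
        · rw [← map_mul, ← mul_assoc, ← mul_assoc, hz, zero_mul, zero_mul, map_zero]
    obtain ⟨f', hf'0, hf'o, hf'm, hf'a⟩ := ih g hg fun i hi j hj hij => by
      rw [hgf i hi, hgf j hj]
      exact horth _ (Finset.mem_insert_of_mem hi) _ (Finset.mem_insert_of_mem hj) hij
    have hpf' : ∀ j ∈ s, p * f' j = 0 := hf'a p fun i _ => hann p hpm i
    have hf'p : ∀ j ∈ s, f' j * p = 0 := fun j hj => by
      have := congrArg star (hpf' j hj)
      rwa [star_mul, star_zero, hstar p hp0, hstar _ (hf'0 j)] at this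
    have hupd : ∀ j ∈ s, Function.update f' i₀ p j = f' j := fun j hj =>
      Function.update_of_ne (hne j hj) _ _
    refine ⟨Function.update f' i₀ p, fun i n => ?_, ?_, ?_, fun z hz => ?_⟩
    · rcases eq_or_ne i i₀ with rfl | hi
      · rw [Function.update_self]; exact hp0 n
      · rw [Function.update_of_ne hi]; exact hf'0 i n
    · simp only [Finset.forall_mem_insert, Function.update_self, ne_eq, not_true_eq_false,
        false_implies, true_and]
      refine ⟨fun j hj _ => by rw [hupd j hj, hpf' j hj], fun i hi => ⟨fun _ => ?_, fun j hj hij => ?_⟩⟩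
      · rw [hupd i hi, hf'p i hi]
      · rw [hupd i hi, hupd j hj, hf'o i hi j hj hij]
    · simp only [Finset.forall_mem_insert, Function.update_self]
      exact ⟨hp, fun j hj => by rw [hupd j hj, hf'm j hj, hgf j hj]⟩
    · have hzb : z * b = 0 := by
        rw [hb, mul_sub, hz _ (Finset.mem_insert_self _ _), hr_def, Finset.mul_sum,
          Finset.sum_eq_zero fun j hj => hz _ (Finset.mem_insert_of_mem hj), sub_zero]
      have hzb' : ∀ n, eval D n z * eval D n b = 0 := fun n => by rw [← map_mul, hzb, map_zero]
      have hzp : z * p = 0 := BddSeq.ext fun n => by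
        rw [map_mul, map_zero]
        exact mul_cfc_eq_zero posFun (by simp [posFun_apply]) (hbsa n) (hzb' n)
      have hzm : z * m = 0 := BddSeq.ext fun n => by
        rw [map_mul, map_zero]
        exact mul_cfc_eq_zero negFun (by simp [negFun_apply]) (hbsa n) (hzb' n)
      simp only [Finset.forall_mem_insert, Function.update_self]
      exact ⟨hzp, fun j hj => by rw [hupd j hj, hf'a z (fun i _ => hann z hzm i) j hj]⟩

end Lifting

/-! ### Spectral decomposition of approximate representations -/

section Towers

open BddSeq

variable {D : Type*} [CStarAlgebra D] [PartialOrder D] [StarOrderedRing D]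

theorem le_one_of_norm_le_one {c : D} (hc : 0 ≤ c) (h : ‖c‖ ≤ 1) : c ≤ 1 :=
  (CStarAlgebra.norm_le_one_iff_of_nonneg c hc).mp h

theorem norm_sum_le_one_of_orthogonal {Γ : Type*} [Fintype Γ] {f : Γ → D} (hf : ∀ γ, 0 ≤ f γ)
    (hf1 : ∀ γ, ‖f γ‖ ≤ 1) (horth : ∀ γ δ, γ ≠ δ → f γ * f δ = 0) : ‖∑ γ, f γ‖ ≤ 1 := by
  classical
  have h0 : 0 ≤ ∑ γ, f γ := Finset.sum_nonneg fun γ _ => hf γ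
  have hsq : (∑ γ, f γ) * (∑ γ, f γ) = ∑ γ, f γ * f γ := by
    rw [Finset.sum_mul]
    refine Finset.sum_congr rfl fun γ _ => ?_
    rw [Finset.mul_sum, Finset.sum_eq_single γ (fun δ _ h => horth _ _ h.symm) (by simp)]
  have hle : ∀ γ, f γ * f γ ≤ f γ := fun γ => by
    set r := CFC.sqrt (f γ)
    have hr : IsSelfAdjoint r := (CFC.sqrt_nonneg (f γ)).isSelfAdjoint
    have hrr : r * r = f γ := CFC.sqrt_mul_sqrt_self (f γ)
    have := hr.conjugate_le_conjugate (le_one_of_norm_le_one (hf γ) (hf1 γ))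
    rw [mul_one, hrr] at this
    calc f γ * f γ = r * f γ * r := by rw [← hrr]; noncomm_ring
      _ ≤ _ := this
  have h1 : ‖∑ γ, f γ‖ * ‖∑ γ, f γ‖ ≤ ‖∑ γ, f γ‖ := by
    rw [← CStarRing.norm_star_mul_self, h0.isSelfAdjoint.star_eq]
    refine CStarAlgebra.norm_le_norm_of_nonneg_of_le h0.isSelfAdjoint.mul_self_nonneg ?_
    rw [hsq]
    exact Finset.sum_le_sum fun γ _ => hle γ
  by_contra! h
  nlinarith

/-- Multiplying an orthogonal family `f` by the function `t ↦ 1 / max t (1 - η)` of its sum turns it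
into a family of contractions whose sum is `min 1 (t / (1 - η))` of the old sum. -/
theorem exists_truncation {Γ : Type*} [Fintype Γ] {f : Γ → D} (hf : ∀ γ, 0 ≤ f γ)
    (horth : ∀ γ δ, γ ≠ δ → f γ * f δ = 0) {c : D} (hc0 : 0 ≤ c) (hc1 : ‖c‖ ≤ 1) {η : ℝ}
    (hη0 : 0 ≤ η) (hη1 : η ≤ 1 / 2) (hfc : ‖∑ γ, f γ - c‖ ≤ η) :
    ∃ f' : Γ → D, (∀ γ, 0 ≤ f' γ ∧ ‖f' γ‖ ≤ 1) ∧ (∀ γ δ, γ ≠ δ → f' γ * f' δ = 0) ∧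
      (∀ γ, ‖f' γ - f γ‖ ≤ 4 * η) ∧
      ∀ ε, ε + ‖∑ γ, f γ - c‖ ≤ η → CuntzSubequiv (1 - ∑ γ, f' γ) (cutDown (1 - c) ε) := by
  classical
  set F := ∑ γ, f γ with hF
  have hF0 : 0 ≤ F := Finset.sum_nonneg fun γ _ => hf γ
  have hFsa := hF0.isSelfAdjoint
  have hF1 : ‖F‖ ≤ 1 + η := by
    calc ‖F‖ = ‖c + (F - c)‖ := by rw [add_sub_cancel]
      _ ≤ ‖c‖ + ‖F - c‖ := norm_add_le _ _
      _ ≤ 1 + η := add_le_add hc1 hfc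
  have hspec : ∀ t ∈ spectrum ℝ F, 0 ≤ t ∧ t ≤ 1 + η := fun t ht =>
    ⟨spectrum_nonneg_of_nonneg hF0 ht,
      (le_abs_self t).trans ((abs_le_norm_of_mem_spectrum ht).trans hF1)⟩
  have hmpos : ∀ t, 0 < max t (1 - η) := fun t => lt_max_of_lt_right (by linarith)
  let j : ℝ → ℝ := fun t => √((max t (1 - η))⁻¹)
  have hj : Continuous j := by
    refine Real.continuous_sqrt.comp (Continuous.inv₀ (by fun_prop) fun t => (hmpos t).ne')
  have hjj : ∀ t, j t * j t = (max t (1 - η))⁻¹ := fun t =>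
    Real.mul_self_sqrt (inv_nonneg.mpr (hmpos t).le)
  set r := cfc j F
  have hrsa : IsSelfAdjoint r := cfc_predicate j F
  have hFf : ∀ γ, F * f γ = f γ * f γ := fun γ => by
    rw [hF, Finset.sum_mul, Finset.sum_eq_single γ (fun δ _ h => horth _ _ h) (by simp)]
  have hfF : ∀ γ, f γ * F = f γ * f γ := fun γ => by
    rw [hF, Finset.mul_sum, Finset.sum_eq_single γ (fun δ _ h => horth _ _ h.symm) (by simp)]
  have hcomm : ∀ γ, r * f γ = f γ * r := fun γ => by
    have h1 : Commute F (f γ) := (hFf γ).trans (hfF γ).symm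
    have h2 : Commute (star F) (f γ) := by rwa [hFsa.star_eq]
    exact (h1.cfc h2 j).eq
  have hsum : ∑ γ, r * f γ * r = cfc (fun t => j t * t * j t) F := by
    rw [← Finset.sum_mul, ← Finset.mul_sum, ← hF, cfc_mul_mul_cfc hj hFsa]
  have hsum1 : ∑ γ, r * f γ * r ≤ 1 := by
    rw [hsum]
    refine cfc_le_one _ _ fun t _ => ?_
    rw [show j t * t * j t = (j t * j t) * t by ring, hjj, inv_mul_le_one₀ (hmpos t)]
    exact le_max_left _ _
  have hpos : ∀ γ, 0 ≤ r * f γ * r := fun γ => hrsa.conjugate_nonneg (hf γ)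
  have hfF' : ∀ γ, f γ ≤ F := fun γ => Finset.single_le_sum (fun δ _ => hf δ) (Finset.mem_univ γ)
  have hf2 : ∀ γ, ‖f γ‖ ≤ 1 + η := fun γ =>
    (CStarAlgebra.norm_le_norm_of_nonneg_of_le (hf γ) (hfF' γ)).trans hF1
  refine ⟨fun γ => r * f γ * r, fun γ => ⟨hpos γ, ?_⟩, fun γ δ h => ?_, fun γ => ?_, fun ε hε => ?_⟩
  · rw [CStarAlgebra.norm_le_one_iff_of_nonneg _ (hpos γ)]
    exact (Finset.single_le_sum (fun δ _ => hpos δ) (Finset.mem_univ γ)).trans hsum1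
  · calc r * f γ * r * (r * f δ * r) = r * (f γ * r) * (r * f δ) * r := by noncomm_ring
      _ = r * r * (f γ * f δ) * r * r := by rw [← hcomm γ, hcomm δ]; noncomm_ring
      _ = 0 := by rw [horth γ δ h]; simp
  · have h1 : r * f γ * r - f γ = f γ * (r * r - 1) := by
      rw [hcomm γ]; noncomm_ring
    have h2 : ‖r * r - 1‖ ≤ 2 * η := by
      rw [cfc_mul_cfc hj hj, ← cfc_one ℝ F hFsa, ← cfc_sub _ _ _ (by fun_prop) (by fun_prop)]
      refine norm_cfc_le (by positivity) fun t ht => ?_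
      obtain ⟨ht0, ht1⟩ := hspec t ht
      rw [hjj, Pi.one_apply, Real.norm_eq_abs]
      have e : (max t (1 - η))⁻¹ - 1 = (1 - max t (1 - η)) / max t (1 - η) := by
        rw [sub_div, div_self (hmpos t).ne', one_div]
      have h3 : |1 - max t (1 - η)| ≤ η := by
        rw [abs_le]
        constructor
        · have : max t (1 - η) ≤ 1 + η := max_le ht1 (by linarith)
          linarith
        · linarith [le_max_right t (1 - η)]
      have h4 : 1 / 2 ≤ max t (1 - η) := le_trans (by linarith) (le_max_right t (1 - η))
      rw [e, abs_div, abs_of_pos (hmpos t), div_le_iff₀ (hmpos t)]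
      nlinarith
    rw [h1]
    calc _ ≤ ‖f γ‖ * ‖r * r - 1‖ := norm_mul_le _ _
      _ ≤ 2 * (2 * η) := mul_le_mul ((hf2 γ).trans (by linarith)) h2 (norm_nonneg _) (by norm_num)
      _ = 4 * η := by ring
  · -- `1 - f'` is a multiple of `(1 - η - F)₊`
    have h1 : 1 - ∑ γ, r * f γ * r = (1 - η)⁻¹ • cutDown (1 - F) η := by
      have e1 : (1 : D) - F = cfc (fun t : ℝ => 1 - t) F := by
        rw [cfc_sub .., cfc_id' ℝ F, cfc_const_one ℝ F]
      rw [hsum, cutDown, e1, ← cfc_comp' (fun t => max 0 (t - η)) (fun t : ℝ => 1 - t) F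
        (by fun_prop) (by fun_prop), ← cfc_const_mul _ _ _ (by fun_prop)]
      conv_lhs => enter [1]; rw [← cfc_const_one ℝ F]
      rw [← cfc_sub _ _ _ (by fun_prop) (by fun_prop)]
      refine cfc_congr fun t _ => ?_
      have h5 : 1 - η ≠ 0 := by linarith
      rw [show j t * t * j t = (j t * j t) * t by ring, hjj]
      rcases le_total t (1 - η) with h | h
      · rw [max_eq_right h, max_eq_right (by linarith)]
        field_simp
        ring
      · rw [max_eq_left h, max_eq_left (by linarith), inv_mul_cancel₀ (by linarith)]
        ring
    rw [h1]
    refine CuntzSubequiv.smul_left ?_ (inv_nonneg.mpr (by linarith))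
    have h2 : ‖(1 - F) - (1 - c)‖ ≤ η - ε := by
      rw [sub_sub_sub_cancel_left, norm_sub_rev]; linarith
    have h3 := CuntzSubequiv.cutDown_cutDown (ε := ε) ((IsSelfAdjoint.one D).sub hFsa)
      ((IsSelfAdjoint.one D).sub hc0.isSelfAdjoint) h2
    rwa [add_sub_cancel] at h3

/-- An exactly orthogonal positive lift of a decomposition of `c` can be corrected to one by
contractions, in such a way that its complement is Cuntz below the complement of `c`. -/
theorem exists_contractive_orthogonal {Γ : Type*} [Fintype Γ] {f : Γ → BddSeq D}
    (hf : ∀ γ n, 0 ≤ eval D n (f γ)) (horth : ∀ γ δ, γ ≠ δ → f γ * f δ = 0) {c : BddSeq D}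
    (hc : ∀ n, 0 ≤ eval D n c ∧ ‖eval D n c‖ ≤ 1)
    (hfc : ∑ γ, SeqAlg.mk D (f γ) = SeqAlg.mk D c) :
    ∃ f' : Γ → BddSeq D, (∀ γ n, 0 ≤ eval D n (f' γ) ∧ ‖eval D n (f' γ)‖ ≤ 1) ∧
      (∀ γ δ, γ ≠ δ → f' γ * f' δ = 0) ∧ (∀ γ, SeqAlg.mk D (f' γ) = SeqAlg.mk D (f γ)) ∧
      ∀ᶠ n in atTop, CuntzSubequiv (1 - ∑ γ, eval D n (f' γ))
        (cutDown (1 - eval D n c) (1 / ((n : ℝ) + 1))) := by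
  set η : ℕ → ℝ := fun n => 1 / ((n : ℝ) + 1) + ‖∑ γ, eval D n (f γ) - eval D n c‖ with hη
  have hη0 : Tendsto η atTop (𝓝 0) := by
    rw [← map_sum, SeqAlg.mk_eq_mk] at hfc
    have := tendsto_one_div_add_atTop_nhds_zero_nat (𝕜 := ℝ) |>.add
      (tendsto_zero_iff_norm_tendsto_zero.mp hfc)
    rw [add_zero] at this
    refine this.congr fun n => ?_
    rw [hη, map_sum]
  have hηpos : ∀ n, 0 ≤ η n := fun n => by positivity
  have key : ∀ n, ∃ g : Γ → D, (∀ γ, 0 ≤ g γ ∧ ‖g γ‖ ≤ 1) ∧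
      (∀ γ δ, γ ≠ δ → g γ * g δ = 0) ∧ (η n ≤ 1 / 2 →
        (∀ γ, ‖g γ - eval D n (f γ)‖ ≤ 4 * η n) ∧
        CuntzSubequiv (1 - ∑ γ, g γ) (cutDown (1 - eval D n c) (1 / ((n : ℝ) + 1)))) := fun n => by
    by_cases h : η n ≤ 1 / 2
    · obtain ⟨g, h1, h2, h3, h4⟩ := exists_truncation (fun γ => hf γ n)
        (fun γ δ hγδ => by rw [← map_mul, horth γ δ hγδ, map_zero]) (hc n).1 (hc n).2 (hηpos n) h
        (by simp only [hη]; exact le_add_of_nonneg_left (by positivity))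
      exact ⟨g, h1, h2, fun _ => ⟨h3, h4 _ le_rfl⟩⟩
    · exact ⟨0, by simp, by simp, fun h' => absurd h' h⟩
  choose g hg1 hg2 hg3 using key
  have hev : ∀ᶠ n in atTop, η n ≤ 1 / 2 :=
    hη0.eventually (eventually_le_nhds (by norm_num))
  refine ⟨fun γ => BddSeq.of (fun n => g n γ) ⟨1, fun n => (hg1 n γ).2⟩, fun γ n => hg1 n γ,
    fun γ δ h => BddSeq.ext fun n => hg2 n γ δ h, fun γ => ?_, ?_⟩
  · rw [SeqAlg.mk_eq_mk]
    have h4 : Tendsto (fun n => 4 * η n) atTop (𝓝 0) := by simpa using hη0.const_mul 4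
    refine squeeze_zero_norm' ?_ h4
    filter_upwards [hev] with n hn using (hg3 n hn).1 γ
  · filter_upwards [hev] with n hn using (hg3 n hn).2

/-- If `s s* ∼ c² ∼ s* s` asymptotically, then `s` may be replaced by contractions of the form
`c a c`: compress it by `c (c + 1/n)⁻¹`. -/
theorem exists_mem_corner {c s : BddSeq D} (hc : ∀ n, 0 ≤ eval D n c ∧ ‖eval D n c‖ ≤ 1)
    (h : SeqAlg.mk D s * star (SeqAlg.mk D s) = SeqAlg.mk D c * SeqAlg.mk D c)
    (h' : star (SeqAlg.mk D s) * SeqAlg.mk D s = SeqAlg.mk D c * SeqAlg.mk D c) :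
    ∃ t : BddSeq D, SeqAlg.mk D t = SeqAlg.mk D s ∧
      ∀ n, ‖eval D n t‖ ≤ 1 ∧ ∃ a, eval D n t = eval D n c * a * eval D n c := by
  let k : ℕ → ℝ → ℝ := fun n t => (max t 0 + 1 / ((n : ℝ) + 1))⁻¹
  have hkpos : ∀ (n : ℕ) (t : ℝ), 0 < max t 0 + 1 / ((n : ℝ) + 1) := fun n t =>
    add_pos_of_nonneg_of_pos (le_max_right _ _) (by positivity)
  have hk : ∀ n, Continuous (k n) := fun n =>
    Continuous.inv₀ (by fun_prop) fun t => (hkpos n t).ne'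
  have hcsa : ∀ n, IsSelfAdjoint (eval D n c) := fun n => (hc n).1.isSelfAdjoint
  have hspec : ∀ n, ∀ t ∈ spectrum ℝ (eval D n c), 0 ≤ t := fun n t ht =>
    spectrum_nonneg_of_nonneg (hc n).1 ht
  have hek : ∀ n, cfc (k n) (eval D n c) * eval D n c =
      cfc (fun t => k n t * t) (eval D n c) := fun n => cfc_mul_self (hk n) (hcsa n)
  have hek' : ∀ n, eval D n c * cfc (k n) (eval D n c) =
      cfc (fun t => k n t * t) (eval D n c) := fun n => by
    conv_lhs => enter [1]; rw [← cfc_id' ℝ (eval D n c)]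
    rw [cfc_mul_cfc continuous_id' (hk n)]
    exact cfc_congr fun t _ => mul_comm _ _
  have he1 : ∀ n, ‖cfc (fun t => k n t * t) (eval D n c)‖ ≤ 1 := fun n => by
    refine norm_cfc_le zero_le_one fun t ht => ?_
    have ht0 := hspec n t ht
    rw [Real.norm_of_nonneg (mul_nonneg (inv_nonneg.mpr (hkpos n t).le) ht0),
      inv_mul_le_one₀ (hkpos n t), max_eq_left ht0]
    exact le_add_of_nonneg_right (by positivity)
  let e : BddSeq D := BddSeq.of (fun n => cfc (fun t => k n t * t) (eval D n c)) ⟨1, he1⟩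
  have hesa : star e = e := BddSeq.ext fun n =>
    (cfc_predicate (fun t => k n t * t) (eval D n c) : IsSelfAdjoint _)
  have hec : (1 - SeqAlg.mk D e) * SeqAlg.mk D c = 0 := by
    rw [← map_one (SeqAlg.mk D), ← map_sub, ← map_mul, ← map_zero (SeqAlg.mk D), SeqAlg.mk_eq_mk]
    refine squeeze_zero_norm (fun n => ?_) (tendsto_one_div_add_atTop_nhds_zero_nat (𝕜 := ℝ))
    have e1 : eval D n ((1 - e) * c) - eval D n 0 =
        cfc (fun t => t - k n t * t * t) (eval D n c) := by
      rw [map_zero, sub_zero, map_mul, map_sub, map_one, sub_mul, one_mul, BddSeq.eval_of,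
        cfc_mul_self (by fun_prop) (hcsa n), cfc_sub _ _ _ (by fun_prop) (by fun_prop),
        cfc_id' ℝ _ (hcsa n)]
    rw [e1]
    refine norm_cfc_le (by positivity) fun t ht => ?_
    have ht0 := hspec n t ht
    set δ := 1 / ((n : ℝ) + 1) with hδ
    have hδ0 : 0 < δ := by positivity
    have e2 : t - k n t * t * t = δ * (t / (t + δ)) := by
      simp only [k, max_eq_left ht0, ← hδ]
      field_simp
      ring
    rw [e2, Real.norm_of_nonneg (by positivity)]
    refine mul_le_of_le_one_right hδ0.le ?_
    rw [div_le_one (by positivity)]; linarith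
  set C := SeqAlg.mk D c
  set S := SeqAlg.mk D s
  set E := SeqAlg.mk D e
  have hEsa : star E = E := by rw [← map_star, hesa]
  have hES : (1 - E) * S = 0 := by
    apply SeqAlg.eq_zero_of_mul_star
    rw [star_mul, show (1 - E) * S * (star S * star (1 - E)) =
      (1 - E) * (S * star S) * star (1 - E) by noncomm_ring, h, ← mul_assoc, hec, zero_mul, zero_mul]
  have hES' : (1 - E) * star S = 0 := by
    apply SeqAlg.eq_zero_of_mul_star
    rw [star_mul, star_star, show (1 - E) * star S * (S * star (1 - E)) =
      (1 - E) * (star S * S) * star (1 - E) by noncomm_ring, h', ← mul_assoc, hec, zero_mul, zero_mul]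
  have hSE : S * (1 - E) = 0 := by
    have := congrArg star hES'
    rwa [star_mul, star_star, star_sub, star_one, hEsa, star_zero] at this
  have hESE : E * S * E = S := by
    rw [sub_mul, one_mul, sub_eq_zero] at hES
    rw [mul_sub, mul_one, sub_eq_zero] at hSE
    rw [← hES, ← hSE]
  have hnorm : ∀ n, ‖eval D n (e * s * e)‖ ≤ ‖eval D n s‖ := fun n => by
    rw [map_mul, map_mul]
    refine norm_mul₃_le.trans ?_
    calc _ ≤ 1 * ‖eval D n s‖ * 1 := by gcongr <;> exact he1 n
      _ = _ := by ring
  let M : ℕ → ℝ := fun n => max 1 ‖eval D n s‖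
  have hM : ∀ n, 1 ≤ M n := fun n => le_max_left _ _
  have hM0 : ∀ n, 0 < M n := fun n => zero_lt_one.trans_le (hM n)
  have ht1 : ∀ n, ‖(M n)⁻¹ • eval D n (e * s * e)‖ ≤ 1 := fun n => by
    rw [norm_smul, norm_inv, Real.norm_of_nonneg (hM0 n).le, inv_mul_le_one₀ (hM0 n)]
    exact (hnorm n).trans (le_max_right _ _)
  refine ⟨BddSeq.of (fun n => (M n)⁻¹ • eval D n (e * s * e)) ⟨1, ht1⟩, ?_, fun n => ⟨ht1 n, ?_⟩⟩
  · rw [← hESE, ← map_mul, ← map_mul, SeqAlg.mk_eq_mk]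
    rw [← map_star, ← map_mul, ← map_mul, SeqAlg.mk_eq_mk] at h
    refine squeeze_zero_norm (fun n => ?_) (tendsto_zero_iff_norm_tendsto_zero.mp h)
    set w := eval D n (e * s * e)
    have e1 : (M n)⁻¹ • w - w = -((M n - 1) * (M n)⁻¹) • w := by
      rw [sub_mul, mul_inv_cancel₀ (hM0 n).ne', neg_sub, one_mul, sub_smul, one_smul]
    have h1 : (M n)⁻¹ * ‖w‖ ≤ 1 := by
      have := ht1 n
      rwa [norm_smul, norm_inv, Real.norm_of_nonneg (hM0 n).le] at this
    have h2 : ‖(M n)⁻¹ • w - w‖ ≤ M n - 1 := by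
      rw [e1, norm_smul, norm_neg, norm_mul, norm_inv, Real.norm_of_nonneg (hM0 n).le,
        Real.norm_of_nonneg (sub_nonneg.mpr (hM n)), mul_assoc]
      exact mul_le_of_le_one_right (sub_nonneg.mpr (hM n)) h1
    rw [BddSeq.eval_of]
    refine h2.trans ?_
    rw [sub_le_iff_le_add]
    refine max_le (le_add_of_nonneg_left (norm_nonneg _)) ?_
    have h3 : ‖eval D n s‖ * ‖eval D n s‖ ≤ ‖eval D n (s * star s) - eval D n (c * c)‖ + 1 := by
      rw [← CStarRing.norm_self_mul_star, ← map_star, ← map_mul]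
      calc _ = ‖(eval D n (s * star s) - eval D n (c * c)) + eval D n (c * c)‖ := by
            rw [sub_add_cancel]
        _ ≤ _ := norm_add_le _ _
        _ ≤ _ := by
          refine add_le_add_right ?_ _
          rw [map_mul]
          exact (norm_mul_le _ _).trans (mul_le_one₀ (hc n).2 (norm_nonneg _) (hc n).2)
    by_contra! h4
    have h5 : 0 ≤ ‖eval D n (s * star s) - eval D n (c * c)‖ := norm_nonneg _
    nlinarith
  · refine ⟨(M n)⁻¹ • (cfc (k n) (eval D n c) * eval D n s * cfc (k n) (eval D n c)), ?_⟩
    rw [BddSeq.eval_of, map_mul, map_mul, BddSeq.eval_of, mul_smul_comm, smul_mul_assoc]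
    congr 1
    calc _ = (eval D n c * cfc (k n) (eval D n c)) * eval D n s *
          (cfc (k n) (eval D n c) * eval D n c) := by rw [hek, hek']
      _ = _ := by noncomm_ring

/-- The spectral decomposition of an asymptotic representation `s` of a finite abelian group `H`
with `s₁ = c`: the elements `(1/|H|) ∑ₕ χ(γ, h) sₕ`, for the characters `χ(γ, ·)` of `H`, are
asymptotically orthogonal and positive with sum `c`, hence lift to exactly orthogonal positive
contractions. Positivity holds since `p_γ³ = p_γ c p_γ`. -/
theorem exists_tower_of_approxRep {H Γ : Type*} [CommGroup H] [Fintype H] [Fintype Γ]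
    (χ : Γ → H →* Circle) (hχ : ∀ γ δ, γ ≠ δ → ∑ h, (χ γ h : ℂ) * star (χ δ h : ℂ) = 0)
    (hχ' : ∀ h, h ≠ 1 → ∑ γ, (χ γ h : ℂ) = 0) (hcard : Fintype.card Γ = Fintype.card H)
    {c : BddSeq D} (hc : ∀ n, 0 ≤ eval D n c ∧ ‖eval D n c‖ ≤ 1) {s : H → SeqAlg D}
    (hs1 : s 1 = SeqAlg.mk D c) (hstar : ∀ h, star (s h) = s h⁻¹)
    (hmul : ∀ g h, s g * s h = SeqAlg.mk D c * s (g * h))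
    (hcomm : ∀ h, SeqAlg.mk D c * s h = s h * SeqAlg.mk D c) :
    ∃ f : Γ → BddSeq D, (∀ γ n, 0 ≤ eval D n (f γ) ∧ ‖eval D n (f γ)‖ ≤ 1) ∧
      (∀ γ δ, γ ≠ δ → f γ * f δ = 0) ∧
      (∀ γ, SeqAlg.mk D (f γ) = (Fintype.card H : ℂ)⁻¹ • ∑ h, (χ γ h : ℂ) • s h) ∧
      (∑ γ, SeqAlg.mk D (f γ) = SeqAlg.mk D c) ∧
      ∀ᶠ n in atTop, CuntzSubequiv (1 - ∑ γ, eval D n (f γ))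
        (cutDown (1 - eval D n c) (1 / ((n : ℝ) + 1))) := by
  classical
  set C := SeqAlg.mk D c
  set N : ℂ := (Fintype.card H : ℂ) with hN
  have hN0 : N ≠ 0 := by rw [hN]; exact_mod_cast Fintype.card_ne_zero
  have hχinv : ∀ γ h, (χ γ h⁻¹ : ℂ) = star (χ γ h : ℂ) := fun γ h => by
    rw [map_inv, Circle.coe_inv_eq_conj]; rfl
  let P : Γ → SeqAlg D := fun γ => N⁻¹ • ∑ h, (χ γ h : ℂ) • s h
  have hPstar : ∀ γ, star (P γ) = P γ := fun γ => by
    simp only [P]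
    rw [star_smul, star_sum, star_inv₀, hN, star_natCast]
    congr 1
    refine Fintype.sum_equiv (Equiv.inv H) _ _ fun h => ?_
    rw [star_smul, hstar, Equiv.inv_apply, hχinv]
  have hCP : ∀ γ, C * P γ = P γ * C := fun γ => by
    simp only [P, mul_smul_comm, smul_mul_assoc, Finset.mul_sum, Finset.sum_mul, hcomm]
  have hPP : ∀ γ δ, P γ * P δ = if γ = δ then C * P γ else 0 := fun γ δ => by
    have e1 : P γ * P δ = N⁻¹ • N⁻¹ • ∑ k, ((∑ g, (χ γ g : ℂ) * star (χ δ g : ℂ)) * (χ δ k : ℂ)) •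
        (C * s k) := by
      simp only [P]
      rw [smul_mul_assoc, mul_smul_comm, Finset.sum_mul]
      congr 2
      simp only [Finset.sum_mul, Finset.sum_smul, Finset.mul_sum]
      conv_rhs => rw [Finset.sum_comm]
      refine Finset.sum_congr rfl fun g _ => ?_
      refine Fintype.sum_equiv (Equiv.mulLeft g) _ _ fun h => ?_
      rw [Equiv.coe_mulLeft, smul_mul_smul_comm, hmul, map_mul, Circle.coe_mul]
      congr 1
      have := star_mul_circle (χ δ g)
      linear_combination -(χ γ g : ℂ) * (χ δ h : ℂ) * this
    rw [e1]
    split_ifs with h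
    · subst h
      have e2 : ∑ g, (χ γ g : ℂ) * star (χ γ g : ℂ) = N := by
        rw [Finset.sum_congr rfl fun g _ => (mul_comm _ _).trans (star_mul_circle (χ γ g))]
        simp [hN]
      simp only [e2, mul_smul, ← Finset.smul_sum]
      rw [smul_smul N⁻¹ N, inv_mul_cancel₀ hN0, one_smul]
      simp only [P, mul_smul_comm, Finset.mul_sum]
    · simp only [hχ γ δ h, zero_mul, zero_smul, Finset.sum_const_zero, smul_zero]
  have hPsum : ∑ γ, P γ = C := by
    simp only [P]
    rw [← Finset.smul_sum, Finset.sum_comm]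
    simp only [← Finset.sum_smul]
    rw [Finset.sum_eq_single 1 (fun h _ hh => by rw [hχ' h hh, zero_smul]) (by simp)]
    simp only [map_one, Circle.coe_one, Finset.sum_const, Finset.card_univ, nsmul_eq_mul, mul_one,
      hcard]
    rw [smul_smul, inv_mul_cancel₀ hN0, one_smul, hs1]
  -- self-adjoint representing sequences
  have hrep : ∀ γ, ∃ p : BddSeq D, (∀ n, IsSelfAdjoint (eval D n p)) ∧ SeqAlg.mk D p = P γ :=
    fun γ => by
      obtain ⟨a, ha⟩ := SeqAlg.mk_surjective (P γ)
      refine ⟨(1 / 2 : ℂ) • (a + star a), fun n => ?_, ?_⟩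
      · rw [isSelfAdjoint_iff, ← map_star, star_smul, star_add, star_star, add_comm (star a)]
        congr 2
        simp
      · rw [map_smul, map_add, map_star, ha, hPstar]
        module
  choose p hp hpP using hrep
  have hpos : ∀ γ, SeqAlg.mk D (cfcSeq posFun (p γ)) = P γ := fun γ => by
    have hpcp : ∀ n, 0 ≤ eval D n (p γ * c * p γ) := fun n => by
      rw [map_mul, map_mul]; exact (hp γ n).conjugate_nonneg (hc n).1
    have e1 : SeqAlg.mk D (-(p γ) * -(p γ) * -(p γ)) = SeqAlg.mk D (-(p γ * c * p γ)) := by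
      simp only [map_mul, map_neg, hpP]
      have h1 : P γ * P γ = C * P γ := by rw [hPP, if_pos rfl]
      calc _ = -(P γ * (P γ * P γ)) := by noncomm_ring
        _ = -(P γ * C * P γ) := by rw [h1, mul_assoc]
    have hpn : ∀ n, IsSelfAdjoint (eval D n (-(p γ))) := fun n => by
      rw [map_neg]; exact (hp γ n).neg
    have e2 := mk_cfcSeq_congr cbrtFun (fun n => by
      rw [map_mul, map_mul, isSelfAdjoint_iff, star_mul, star_mul, (hpn n).star_eq, mul_assoc])
      (fun n => by rw [map_neg]; exact (hpcp n).isSelfAdjoint.neg) e1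
    have e3 : cfcSeq cbrtFun (-(p γ) * -(p γ) * -(p γ)) = cfcSeq posFun (-(p γ)) :=
      BddSeq.ext fun n => by
        rw [eval_cfcSeq, map_mul, map_mul, cfc_cbrtFun_cube (hpn n)]; rfl
    have e4 : cfcSeq cbrtFun (-(p γ * c * p γ)) = 0 := BddSeq.ext fun n => by
      rw [eval_cfcSeq, map_zero, map_neg, ← cfc_zero ℝ (-(eval D n (p γ * c * p γ)))]
      refine cfc_congr fun t ht => ?_
      have ht0 : t ≤ 0 := by
        rw [← spectrum.neg_eq, Set.mem_neg] at ht
        have := spectrum_nonneg_of_nonneg (hpcp n) ht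
        linarith
      rw [cbrtFun_apply, max_eq_right ht0, Pi.zero_apply]
      norm_num
    have e5 : cfcSeq posFun (-(p γ)) = cfcSeq negFun (p γ) := BddSeq.ext fun n => by
      rw [eval_cfcSeq, eval_cfcSeq, map_neg, ← cfc_comp_neg posFun _ (by fun_prop) (hp γ n)]
      rfl
    have e6 : cfcSeq posFun (p γ) - cfcSeq negFun (p γ) = p γ := BddSeq.ext fun n =>
      cfc_posFun_sub_negFun (hp γ n)
    have e7 := congrArg (SeqAlg.mk D) e6
    rw [map_sub, ← e5, ← e3, e2, e4, map_zero, sub_zero] at e7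
    rw [e7, hpP]
  obtain ⟨f, hf0, hfo, hfm, -⟩ := exists_orthogonal_lift Finset.univ
    (fun γ => cfcSeq posFun (p γ)) (fun γ n => cfcSeq_nonneg posFun_nonneg _ n)
    (fun γ _ δ _ h => by rw [hpos, hpos, hPP, if_neg h])
  obtain ⟨f', h1, h2, h3, h4⟩ := exists_contractive_orthogonal hf0
    (fun γ δ h => hfo γ (Finset.mem_univ _) δ (Finset.mem_univ _) h) hc (by
      refine Eq.trans ?_ hPsum
      exact Finset.sum_congr rfl fun γ _ => (hfm γ (Finset.mem_univ _)).trans (hpos γ))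
  have h3' : ∀ γ, SeqAlg.mk D (f' γ) = P γ := fun γ =>
    (h3 γ).trans ((hfm γ (Finset.mem_univ _)).trans (hpos γ))
  exact ⟨f', h1, h2, h3', (Finset.sum_congr rfl fun γ _ => h3' γ).trans hPsum, h4⟩

end Towers

/-! ### Characters of finite abelian groups -/

section Characters

variable {G : Type*} [CommGroup G] [TopologicalSpace G]

namespace PontryaginDual

/-- The pairing of `G` with its dual group, as characters of the dual group. -/
noncomputable def evalChar (g : G) : PontryaginDual G →* Circle where
  toFun ω := ω g
  map_one' := rfl
  map_mul' _ _ := rfl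

theorem evalChar_apply (g : G) (ω : PontryaginDual G) : evalChar g ω = ω g := rfl

/-- The conjugate pairing of `G` with its dual group, as characters of `G`. -/
noncomputable def conjChar (ω : PontryaginDual G) : G →* Circle where
  toFun g := (ω g)⁻¹
  map_one' := by simp
  map_mul' g k := by rw [_root_.map_mul, mul_inv]

theorem coe_conjChar (ω : PontryaginDual G) (g : G) : (conjChar ω g : ℂ) = star (ω g : ℂ) :=
  Circle.coe_inv_eq_conj _

variable [Fintype G]

theorem sum_eq_zero_of_ne_one {ω : PontryaginDual G} (hω : ω ≠ 1) :
    ∑ g, (ω g : ℂ) = 0 := by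
  let f : G →* ℂ := Circle.coeHom.comp (ω : G →ₜ* Circle).toMonoidHom
  refine sum_hom_units_eq_zero f fun hf => hω ?_
  refine ContinuousMonoidHom.ext fun g => Circle.ext ?_
  exact DFunLike.congr_fun hf g

variable [DiscreteTopology G]

theorem exists_apply_ne_one {g : G} (hg : g ≠ 1) : ∃ ω : PontryaginDual G, ω g ≠ 1 := by
  have : NeZero (Monoid.exponent G) := ⟨Monoid.exponent_ne_zero_of_finite⟩
  obtain ⟨φ, hφ⟩ := CommGroup.exists_apply_ne_one_of_hasEnoughRootsOfUnity G Circle hg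
  let ψ : G →* Circle := (Units.coeHom Circle).comp φ
  refine ⟨(⟨ψ, continuous_of_discreteTopology⟩ : G →ₜ* Circle), fun h => hφ (Units.ext h)⟩

theorem sum_apply_eq_zero_of_ne_one {g : G} (hg : g ≠ 1) :
    ∑ ω : PontryaginDual G, (ω g : ℂ) = 0 := by
  let f : PontryaginDual G →* ℂ :=
    { toFun := fun ω => (ω g : ℂ)
      map_one' := by
        change ((1 : Circle) : ℂ) = 1
        simp
      map_mul' := fun ω ω' => by
        change ((ω g * ω' g : Circle) : ℂ) = _
        simp }
  refine sum_hom_units_eq_zero f fun hf => ?_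
  obtain ⟨ω, hω⟩ := exists_apply_ne_one hg
  exact hω (Circle.ext (by simpa [f] using DFunLike.congr_fun hf ω))

theorem card_eq : Fintype.card (PontryaginDual G) = Fintype.card G := by
  classical
  have h1 : ∑ g : G, ∑ ω : PontryaginDual G, (ω g : ℂ) = Fintype.card (PontryaginDual G) := by
    rw [Finset.sum_eq_single 1 (fun g _ hg => sum_apply_eq_zero_of_ne_one hg) (by simp)]
    simp
  have h2 : ∑ ω : PontryaginDual G, ∑ g : G, (ω g : ℂ) = Fintype.card G := by
    rw [Finset.sum_eq_single 1 (fun ω _ hω => sum_eq_zero_of_ne_one hω) (by simp)]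
    change ∑ g : G, ((1 : Circle) : ℂ) = _
    simp
  rw [Finset.sum_comm, h2] at h1
  exact_mod_cast h1.symm

theorem sum_evalChar_mul_star (g k : G) (h : g ≠ k) :
    ∑ ω, (evalChar g ω : ℂ) * star (evalChar k ω : ℂ) = 0 := by
  rw [← sum_apply_eq_zero_of_ne_one (g := g * k⁻¹) (by rwa [ne_eq, mul_inv_eq_one])]
  refine Finset.sum_congr rfl fun ω _ => ?_
  rw [evalChar_apply, evalChar_apply, _root_.map_mul, map_inv, Circle.coe_mul, Circle.coe_inv_eq_conj]
  rfl

theorem sum_conjChar_mul_star (ω τ : PontryaginDual G) (h : ω ≠ τ) :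
    ∑ g, (conjChar ω g : ℂ) * star (conjChar τ g : ℂ) = 0 := by
  rw [← sum_eq_zero_of_ne_one (ω := ω⁻¹ * τ) (by rwa [ne_eq, inv_mul_eq_one])]
  refine Finset.sum_congr rfl fun g _ => ?_
  rw [coe_conjChar, coe_conjChar, star_star]
  change _ = (((ω g)⁻¹ * τ g : Circle) : ℂ)
  rw [Circle.coe_mul, Circle.coe_inv_eq_conj]
  rfl

theorem sum_conjChar (g : G) (h : g ≠ 1) : ∑ ω : PontryaginDual G, (conjChar ω g : ℂ) = 0 := by
  simp only [coe_conjChar]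
  rw [← star_sum, sum_apply_eq_zero_of_ne_one h, star_zero]

end PontryaginDual

end Characters

/-! ### Crossed products by finite groups -/

section CrossedProducts

namespace CrossedProduct

section Algebraic

variable {A : Type*} [CStarAlgebra A] {G : Type*} [Group G] (α : G →* (A ≃⋆ₐ[ℂ] A))

theorem apply_mul (g h : G) (a : A) : α (g * h) a = α g (α h a) := by
  rw [map_mul, StarAlgEquiv.mul_apply]

theorem apply_one (a : A) : α 1 a = a := by
  rw [map_one]; rfl

section

variable [DecidableEq G]

/-- The canonical unitaries `u_g` of the crossed product. -/
def unitaryOf (g : G) : CrossedProduct α := ofCoeff fun h => if h = g then 1 else 0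

@[simp] theorem unitaryOf_one : unitaryOf α 1 = 1 := rfl

theorem star_unitaryOf (g : G) : star (unitaryOf α g) = unitaryOf α g⁻¹ := by
  ext h
  rw [coeff_star]
  by_cases hh : h = g⁻¹
  · simp [unitaryOf, hh]
  · have : h⁻¹ ≠ g := fun e => hh (by rw [← e, inv_inv])
    simp [unitaryOf, hh, this]

end

section

variable [Fintype G]

theorem coeff_one_star_mul_self (y : CrossedProduct α) :
    (star y * y).coeff 1 = ∑ g, star (α g (y.coeff g⁻¹)) * α g (y.coeff g⁻¹) := by
  rw [coeff_mul]
  refine Finset.sum_congr rfl fun g _ => ?_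
  rw [coeff_star, mul_one, map_star]

end

variable [Fintype G] [DecidableEq G]

theorem coeff_sum {ι : Type*} (s : Finset ι) (b : ι → CrossedProduct α) (g : G) :
    (∑ i ∈ s, b i).coeff g = ∑ i ∈ s, (b i).coeff g := by
  classical
  induction s using Finset.induction_on with
  | empty => simp
  | insert i s hi ih => rw [Finset.sum_insert hi, Finset.sum_insert hi, coeff_add, ih]

theorem coeff_sub (a b : CrossedProduct α) (g : G) : (a - b).coeff g = a.coeff g - b.coeff g := rfl

/-- The canonical inclusion `A → C*(G, A, α)`, onto the functions supported at `1`. -/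
noncomputable def incl : A →⋆ₐ[ℂ] CrossedProduct α where
  toFun a := ofCoeff fun g => if g = 1 then a else 0
  map_one' := rfl
  map_mul' a b := by
    ext g
    rw [coeff_mul, Finset.sum_eq_single 1 (fun h _ hh => by simp [hh]) (by simp)]
    by_cases hg : g = 1 <;> simp [hg]
  map_zero' := by ext g; simp
  map_add' a b := by ext g; by_cases hg : g = 1 <;> simp [hg]
  commutes' z := by
    rw [Algebra.algebraMap_eq_smul_one, Algebra.algebraMap_eq_smul_one]
    ext g; by_cases hg : g = 1 <;> simp [hg, coeff_one]
  map_star' a := by ext g; by_cases hg : g = 1 <;> simp [hg, coeff_star]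

theorem coeff_incl (a : A) (g : G) : (incl α a).coeff g = if g = 1 then a else 0 := rfl

@[simp] theorem coeff_incl_one (a : A) : (incl α a).coeff 1 = a := by simp [coeff_incl]

theorem incl_injective : Function.Injective (incl α) := fun a b h => by
  rw [← coeff_incl_one α a, h, coeff_incl_one]

theorem coeff_incl_mul (a : A) (b : CrossedProduct α) (g : G) :
    (incl α a * b).coeff g = a * b.coeff g := by
  rw [coeff_mul, Finset.sum_eq_single 1 (fun h _ hh => by simp [coeff_incl, hh]) (by simp)]
  simp

theorem coeff_mul_incl (a : A) (b : CrossedProduct α) (g : G) :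
    (b * incl α a).coeff g = b.coeff g * α g a := by
  rw [coeff_mul, Finset.sum_eq_single g (fun h _ hh => ?_) (by simp)]
  · simp
  · have : h⁻¹ * g ≠ 1 := fun e => hh (inv_mul_eq_one.mp e)
    simp [coeff_incl, this]

theorem coeff_mul_unitaryOf (g : G) (b : CrossedProduct α) (h : G) :
    (b * unitaryOf α g).coeff h = b.coeff (h * g⁻¹) := by
  rw [coeff_mul, Finset.sum_eq_single (h * g⁻¹) (fun k _ hk => ?_) (by simp)]
  · simp [unitaryOf]
  · have : k⁻¹ * h ≠ g := fun e => hk (by rw [← e]; group)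
    simp [unitaryOf, this]

theorem unitaryOf_mul_unitaryOf (g h : G) : unitaryOf α g * unitaryOf α h = unitaryOf α (g * h) := by
  ext k
  rw [coeff_mul_unitaryOf]
  simp [unitaryOf, mul_inv_eq_iff_eq_mul]

theorem unitaryOf_mul_star (g : G) : unitaryOf α g * star (unitaryOf α g) = 1 := by
  rw [star_unitaryOf, unitaryOf_mul_unitaryOf, mul_inv_cancel, unitaryOf_one]

theorem star_mul_unitaryOf (g : G) : star (unitaryOf α g) * unitaryOf α g = 1 := by
  rw [star_unitaryOf, unitaryOf_mul_unitaryOf, inv_mul_cancel, unitaryOf_one]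

theorem unitaryOf_mul_incl (g : G) (a : A) :
    unitaryOf α g * incl α a = incl α (α g a) * unitaryOf α g := by
  ext h
  rw [coeff_mul_incl, coeff_incl_mul]
  by_cases hh : h = g <;> simp [unitaryOf, hh]

theorem unitaryOf_mul_incl_mul_star (g : G) (a : A) :
    unitaryOf α g * incl α a * star (unitaryOf α g) = incl α (α g a) := by
  rw [unitaryOf_mul_incl, mul_assoc, unitaryOf_mul_star, mul_one]

theorem eq_sum_incl_mul_unitaryOf (b : CrossedProduct α) :
    b = ∑ g, incl α (b.coeff g) * unitaryOf α g := by
  ext h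
  rw [coeff_sum]
  simp [coeff_incl_mul, unitaryOf]

theorem not_finiteDimensional (h : ¬ FiniteDimensional ℂ A) :
    ¬ FiniteDimensional ℂ (CrossedProduct α) := fun _ =>
  h (FiniteDimensional.of_injective (incl α).toAlgHom.toLinearMap (incl_injective α))

/-- The value at `1` of `y ι(a) y*`, for `ι` the inclusion of `A`. -/
theorem coeff_one_conj_incl (y : CrossedProduct α) (a : A) :
    (y * incl α a * star y).coeff 1 = ∑ g, y.coeff g * α g a * star (y.coeff g) := by
  rw [coeff_mul]
  refine Finset.sum_congr rfl fun g _ => ?_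
  rw [coeff_mul_incl, mul_one, coeff_star, inv_inv, ← apply_mul, mul_inv_cancel, apply_one]

end Algebraic

section Simplicity

variable {A : Type*} [CStarAlgebra A]

/-- In a simple unital C*-algebra, central elements are scalars. -/
theorem exists_algebraMap_eq_of_central [IsSimpleRing A] {z : A} (hz : ∀ a, a * z = z * a) :
    ∃ r : ℂ, z = algebraMap ℂ A r := by
  obtain ⟨r, hr⟩ := spectrum.nonempty z
  refine ⟨r, ?_⟩
  by_contra hne
  have hc : algebraMap ℂ A r - z ∈ Subring.center A := by
    rw [Subring.mem_center_iff]
    intro a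
    rw [mul_sub, sub_mul, hz, Algebra.commutes]
  obtain ⟨⟨y, hy⟩, hxy⟩ := (IsSimpleRing.isField_center A).mul_inv_cancel
    (a := ⟨_, hc⟩) (fun e => hne (sub_eq_zero.mp (congrArg Subtype.val e)).symm)
  have h1 : (algebraMap ℂ A r - z) * y = 1 := congrArg Subtype.val hxy
  refine hr ⟨⟨algebraMap ℂ A r - z, y, h1, ?_⟩, rfl⟩
  rw [Subring.mem_center_iff.mp hc y, h1]

/-- An automorphism `σ` of a simple unital C*-algebra which admits a nonzero `w` with
`a w = w σ(a)` for all `a` is inner. -/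
theorem exists_unitary_of_intertwiner [IsSimpleRing A] (σ : A ≃⋆ₐ[ℂ] A) {w : A} (hw : w ≠ 0)
    (h : ∀ a, a * w = w * σ a) : ∃ u ∈ unitary A, ∀ a, σ a = u * a * star u := by
  have h' : ∀ a, star w * a = σ a * star w := fun a => by
    have := congrArg star (h (star a))
    rwa [star_mul, star_mul, star_star, map_star, star_star] at this
  obtain ⟨r, hr⟩ := exists_algebraMap_eq_of_central (z := w * star w) fun a => by
    rw [← mul_assoc, h, mul_assoc, ← h', mul_assoc]
  obtain ⟨t, ht⟩ := exists_algebraMap_eq_of_central (z := star w * w) fun a => by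
    obtain ⟨b, rfl⟩ : ∃ b, σ b = a := σ.surjective a
    rw [← mul_assoc, ← h', mul_assoc, h, mul_assoc]
  -- `w* w` and `w w*` are the same positive scalar `‖w‖²`, so `w / ‖w‖` is unitary
  have hw' : star w ≠ 0 := star_ne_zero.mpr hw
  have hrt : r = t := by
    have e : w * star w * w = w * (star w * w) := mul_assoc _ _ _
    rw [hr, ht, ← Algebra.commutes, ← sub_eq_zero, ← sub_mul, ← map_sub,
      ← Algebra.smul_def] at e
    rcases smul_eq_zero.mp e with e | e
    · exact sub_eq_zero.mp e
    · exact absurd e hw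
  subst hrt
  have hinj : Function.Injective (algebraMap ℂ A) := FaithfulSMul.algebraMap_injective ℂ A
  obtain ⟨q, rfl⟩ : ∃ q : ℝ, r = q := by
    refine Complex.conj_eq_iff_real.mp (hinj ?_)
    change algebraMap ℂ A (star r) = _
    rw [algebraMap_star_comm, ← ht, star_mul, star_star]
  have hq : 0 ≤ q := by
    refine spectrum_star_mul_self_nonneg (b := w) q ?_
    rw [ht, show algebraMap ℂ A (q : ℂ) = algebraMap ℝ A q from
      (IsScalarTower.algebraMap_apply ℝ ℂ A q).symm, spectrum.scalar_eq]
    rfl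
  have hq0 : q ≠ 0 := by
    rintro rfl
    rw [Complex.ofReal_zero, map_zero, CStarRing.star_mul_self_eq_zero_iff] at ht
    exact hw ht
  set s : ℂ := (((√q)⁻¹ : ℝ) : ℂ) with hs
  have hss : star s * s * q = 1 := by
    have : star s = s := Complex.conj_ofReal _
    rw [this, hs, ← Complex.ofReal_mul, ← mul_inv, Real.mul_self_sqrt hq, ← Complex.ofReal_mul,
      inv_mul_cancel₀ hq0, Complex.ofReal_one]
  have e : ∀ x : A, (star s * s) • (algebraMap ℂ A (q : ℂ) * x) = x := fun x => by
    rw [← Algebra.smul_def, smul_smul, hss, one_smul]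
  refine ⟨s • star w, ⟨?_, ?_⟩, fun a => ?_⟩
  · rw [star_smul, star_star, smul_mul_smul_comm, hr, ← mul_one (algebraMap ℂ A _), e]
  · rw [star_smul, star_star, smul_mul_smul_comm, ht, ← mul_one (algebraMap ℂ A _), mul_comm s, e]
  · rw [star_smul, star_star, smul_mul_assoc, h', smul_mul_smul_comm, mul_comm s, mul_assoc, ht,
      ← Algebra.commutes, e]

variable {G : Type*} [Group G] [Fintype G] [DecidableEq G] {α : G →* (A ≃⋆ₐ[ℂ] A)}

/-- The crossed product of a simple unital C*-algebra by a pointwise outer action of a finite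
group is simple. -/
theorem isSimpleRing_of_isPointwiseOuter [IsSimpleRing A] (hα : IsPointwiseOuter α) :
    IsSimpleRing (CrossedProduct α) := by
  classical
  have key : ∀ (I : TwoSidedIdeal (CrossedProduct α)) (n : ℕ) (b : CrossedProduct α), b ∈ I →
      b ≠ 0 → (Finset.univ.filter fun g => b.coeff g ≠ 0).card ≤ n → (1 : CrossedProduct α) ∈ I := by
    intro I n
    induction n with
    | zero =>
      intro b _ hb hn
      refine absurd ?_ hb
      ext g
      by_contra hg
      have : g ∈ Finset.univ.filter fun g => b.coeff g ≠ 0 := by simpa using hg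
      rw [Finset.card_eq_zero.mp (Nat.le_zero.mp hn)] at this
      simp at this
    | succ n ih =>
      intro b hbI hb hn
      obtain ⟨k, hk⟩ : ∃ k, b.coeff k ≠ 0 := by
        by_contra! hcon
        exact hb (ext fun g => by simpa using hcon g)
      obtain ⟨ι, _, x, y, hxy⟩ := exists_sum_mul_mul_eq_one hk
      -- the coefficients of `b'` are those of `b`, shifted and compressed, and its first one is `1`
      let b' : CrossedProduct α := ∑ i, incl α (x i) * (b * unitaryOf α k⁻¹) * incl α (y i)
      have hb' : ∀ g, b'.coeff g = ∑ i, x i * b.coeff (g * k) * α g (y i) := fun g => by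
        rw [coeff_sum]
        refine Finset.sum_congr rfl fun i _ => ?_
        rw [coeff_mul_incl, coeff_incl_mul, coeff_mul_unitaryOf, inv_inv]
      have hb'1 : b'.coeff 1 = 1 := by simp [hb', hxy]
      have hb'I : b' ∈ I := sum_mem fun i _ =>
        I.mul_mem_right _ _ (I.mul_mem_left _ _ (I.mul_mem_right _ _ hbI))
      have hcard : (Finset.univ.filter fun g => b'.coeff g ≠ 0).card ≤ n + 1 := by
        refine le_trans (Finset.card_le_card_of_injOn (fun g => g * k) ?_ ?_) hn
        · intro g hg
          simp only [Finset.coe_filter, Finset.mem_univ, true_and, Set.mem_ofPred_eq] at hg ⊢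
          intro e
          exact hg (by simp [hb', e])
        · exact (mul_left_injective k).injOn
      by_cases hcomm : ∀ a, incl α a * b' - b' * incl α a = 0
      · have h0 : ∀ g, g ≠ 1 → b'.coeff g = 0 := by
          intro g hg
          by_contra hw
          refine hα g hg (exists_unitary_of_intertwiner (α g) hw fun a => ?_)
          have := congrArg (fun z => coeff z g) (sub_eq_zero.mp (hcomm a))
          simpa [coeff_incl_mul, coeff_mul_incl] using this
        have : b' = 1 := by
          ext g
          rw [coeff_one]
          by_cases hg : g = 1
          · simp [hg, hb'1]
          · simp [hg, h0 g hg]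
        exact this ▸ hb'I
      · push Not at hcomm
        obtain ⟨a, ha⟩ := hcomm
        have hc : ∀ g, (incl α a * b' - b' * incl α a).coeff g =
            a * b'.coeff g - b'.coeff g * α g a := fun g => by
          rw [coeff_sub, coeff_incl_mul, coeff_mul_incl]
        refine ih _ (I.sub_mem (I.mul_mem_left _ _ hb'I) (I.mul_mem_right _ _ hb'I)) ha ?_
        refine Nat.le_of_lt_succ (lt_of_lt_of_le (Finset.card_lt_card ?_) hcard)
        refine (Finset.ssubset_iff_of_subset fun g hg => ?_).mpr ⟨1, ?_, ?_⟩
        · simp only [Finset.mem_filter, Finset.mem_univ, true_and] at hg ⊢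
          intro e
          exact hg (by rw [hc, e]; simp)
        · simp [hb'1]
        · simp [hc, hb'1]
  have : Nontrivial (CrossedProduct α) := (incl_injective α).nontrivial
  refine .of_eq_bot_or_eq_top fun I => ?_
  by_cases hI : ∃ b ∈ I, b ≠ 0
  · obtain ⟨b, hb, hb0⟩ := hI
    exact Or.inr ((TwoSidedIdeal.one_mem_iff I).mp (key I _ b hb hb0 le_rfl))
  · push Not at hI
    exact Or.inl (le_bot_iff.mp fun x hx => (TwoSidedIdeal.mem_bot _).mpr (hI x hx))

end Simplicity

end CrossedProduct

end CrossedProducts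

/-! ### The tracial properties in terms of sequences -/

section SequenceForms

open BddSeq

variable {D : Type*} [CStarAlgebra D]

/-- An automorphism, as a *-homomorphism. -/
def autHom (σ : D ≃⋆ₐ[ℂ] D) : D →⋆ₐ[ℂ] D := (σ : D →⋆ₐ[ℂ] D)

@[simp] theorem autHom_apply (σ : D ≃⋆ₐ[ℂ] D) (a : D) : autHom σ a = σ a := rfl

theorem SeqAlg.mk_eq_mk_of_lt {a b : BddSeq D}
    (h : ∀ n : ℕ, ‖eval D n a - eval D n b‖ < 1 / ((n : ℝ) + 1)) : SeqAlg.mk D a = SeqAlg.mk D b :=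
  SeqAlg.mk_eq_mk.mpr
    (squeeze_zero_norm (fun n => (h n).le) tendsto_one_div_add_atTop_nhds_zero_nat)

/-- The lower limit of the norms of the terms is at least one. -/
def OneLeLiminfNorm (a : BddSeq D) : Prop :=
  ∀ δ : ℝ, 0 < δ → ∀ᶠ n in atTop, 1 - δ < ‖eval D n a‖

theorem OneLeLiminfNorm.congr {a b : BddSeq D} (ha : OneLeLiminfNorm a)
    (h : SeqAlg.mk D a = SeqAlg.mk D b) : OneLeLiminfNorm b := fun δ hδ => by
  filter_upwards [ha (δ / 2) (by positivity), SeqAlg.mk_eq_mk_iff_norm.mp h (δ / 2) (by positivity)]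
    with n h1 h2
  have := norm_sub_norm_le (eval D n a) (eval D n b)
  linarith

theorem OneLeLiminfNorm.of_forall {a : BddSeq D}
    (h : ∀ n : ℕ, 1 - 1 / ((n : ℝ) + 1) < ‖eval D n a‖) : OneLeLiminfNorm a := fun δ hδ => by
  filter_upwards [(tendsto_order.mp tendsto_one_div_add_atTop_nhds_zero_nat).2 δ hδ] with n hn
  have := h n
  linarith

theorem OneLeLiminfNorm.mk_ne_zero {a : BddSeq D} (ha : OneLeLiminfNorm a) : SeqAlg.mk D a ≠ 0 := by
  intro h
  rw [← map_zero (SeqAlg.mk D)] at h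
  obtain ⟨n, h1, h2⟩ := ((ha (1 / 2) (by norm_num)).and
    (SeqAlg.mk_eq_mk_iff_norm.mp h (1 / 2) (by norm_num))).exists
  rw [map_zero, sub_zero] at h2
  linarith

/-- If `v x v*` is close to `y`, where `v` is almost contractive and commutes asymptotically with
the contractions `cₙ`, then `cₙ x cₙ` has almost norm one as soon as `cₙ y cₙ` does. -/
theorem OneLeLiminfNorm.of_conj {c : BddSeq D} (hsa : ∀ n, IsSelfAdjoint (eval D n c))
    (hc1 : ∀ n, ‖eval D n c‖ ≤ 1) {x y v : D} {ε : ℝ} (hε : 0 < ε)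
    (hcv : SeqAlg.mk D c * SeqAlg.const D v = SeqAlg.const D v * SeqAlg.mk D c)
    (hv : ‖v‖ ≤ 1 + ε / 8) (hvx : ‖v * x * star v - y‖ < ε / 8)
    (hy : OneLeLiminfNorm (c * BddSeq.const D y * c)) :
    ∀ᶠ n in atTop, 1 - ε < ‖eval D n c * x * eval D n c‖ := by
  have hsc : star (SeqAlg.mk D c) = SeqAlg.mk D c := by
    rw [← map_star]
    exact congrArg _ (BddSeq.ext fun n => by rw [map_star, (hsa n).star_eq])
  have hcv' : SeqAlg.const D (star v) * SeqAlg.mk D c = SeqAlg.mk D c * SeqAlg.const D (star v) := by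
    have := congrArg star hcv
    rwa [star_mul, star_mul, hsc, ← map_star] at this
  have h1 : SeqAlg.mk D (c * BddSeq.const D (v * x * star v) * c) = SeqAlg.mk D
      (BddSeq.const D v * (c * BddSeq.const D x * c) * BddSeq.const D (star v)) := by
    simp only [map_mul, SeqAlg.mk_const]
    simp only [mul_assoc]
    rw [hcv']
    simp only [← mul_assoc]
    rw [hcv]
  filter_upwards [hy (ε / 8) (by positivity), SeqAlg.mk_eq_mk_iff_norm.mp h1 (ε / 8) (by positivity)]
    with n h2 h3
  simp only [map_mul, BddSeq.eval_const] at h2 h3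
  set k := eval D n c
  have hk := hc1 n
  have h4 : ‖k * y * k - k * (v * x * star v) * k‖ ≤ ε / 8 := by
    have : k * y * k - k * (v * x * star v) * k = - (k * (v * x * star v - y) * k) := by noncomm_ring
    rw [this, norm_neg]
    calc _ ≤ ‖k‖ * ‖v * x * star v - y‖ * ‖k‖ :=
          (norm_mul_le _ _).trans (mul_le_mul_of_nonneg_right (norm_mul_le _ _) (norm_nonneg _))
      _ ≤ 1 * (ε / 8) * 1 := by gcongr
      _ = _ := by ring
  have h5 : ‖v * (k * x * k) * star v‖ ≤ (1 + ε / 8) * ‖k * x * k‖ * (1 + ε / 8) := by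
    calc _ ≤ ‖v‖ * ‖k * x * k‖ * ‖star v‖ :=
          (norm_mul_le _ _).trans (mul_le_mul_of_nonneg_right (norm_mul_le _ _) (norm_nonneg _))
      _ ≤ _ := by rw [norm_star]; gcongr
  have h6 : 1 - 3 * (ε / 8) < (1 + ε / 8) * ‖k * x * k‖ * (1 + ε / 8) := by
    have e1 := norm_sub_norm_le (k * y * k) (k * (v * x * star v) * k)
    have e2 := norm_sub_norm_le (k * (v * x * star v) * k) (v * (k * x * k) * star v)
    linarith
  by_contra! hcon
  have h7 : (1 + ε / 8) * ‖k * x * k‖ * (1 + ε / 8) ≤ (1 + ε / 8) * (1 - ε) * (1 + ε / 8) := by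
    gcongr
  nlinarith [mul_pos hε hε, mul_pos (mul_pos hε hε) hε]

/-- In the sequence algebra, `s s* = c²`, `s a s* = σ(c a c)` and `s a a* s* = σ(c a a* c)` force the
intertwining relation `s a = σ(a) s`, because `z = s a - σ(a) s` satisfies `z z* = 0`. -/
theorem SeqAlg.intertwine {s c a : SeqAlg D} (σ : SeqAlg D →⋆ₐ[ℂ] SeqAlg D) (hc : star c = c)
    (hσ : σ c = c) (hs : s * star s = c * c) (hca : c * a = a * c)
    (h1 : σ (c * a * c) = s * a * star s)
    (h2 : σ (c * (a * star a) * c) = s * (a * star a) * star s) : s * a = σ a * s := by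
  have hca' : star a * c = c * star a := by
    have := congrArg star hca
    rwa [star_mul, star_mul, hc] at this
  have h1' : σ (c * star a * c) = s * star a * star s := by
    have := congrArg star h1
    rw [← map_star] at this
    simpa [star_mul, hc, mul_assoc] using this
  rw [← sub_eq_zero]
  refine SeqAlg.eq_zero_of_mul_star ?_
  have hσa : σ a * c = c * σ a := by rw [← hσ, ← map_mul, ← map_mul, hca]
  have hσa' : σ (star a) * c = c * σ (star a) := by rw [← hσ, ← map_mul, ← map_mul, hca']
  calc (s * a - σ a * s) * star (s * a - σ a * s)
      = s * (a * star a) * star s - (s * a * star s) * σ (star a) - σ a * (s * star a * star s)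
        + σ a * (s * star s) * σ (star a) := by
        rw [star_sub, star_mul, star_mul, ← map_star]; noncomm_ring
    _ = 0 := by
        rw [← h2, ← h1, ← h1', hs]
        simp only [map_mul, hσ]
        simp only [mul_assoc, hσa']
        simp only [← mul_assoc]
        simp only [hσa]
        simp only [mul_assoc]
        abel

variable [PartialOrder D] {H : Type*} [Group H]

/-- The relations in the definition of weak tracial approximate representability, for the finite
set `F`, holding asymptotically; positivity and `β`-invariance of the `cₙ` are exact. -/
structure IsApproxRepresentation (β : H →* (D ≃⋆ₐ[ℂ] D)) (F : Finset D) (c : BddSeq D)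
    (s : H → SeqAlg D) : Prop where
  nonneg : ∀ n, 0 ≤ eval D n c ∧ ‖eval D n c‖ ≤ 1
  fixed : ∀ n g, β g (eval D n c) = eval D n c
  one : s 1 = SeqAlg.mk D c
  star : ∀ g, star (s g) = s g⁻¹
  mul : ∀ g h, s g * s h = SeqAlg.mk D c * s (g * h)
  comm : ∀ a ∈ F, SeqAlg.mk D c * SeqAlg.const D a = SeqAlg.const D a * SeqAlg.mk D c
  comm_s : ∀ g, SeqAlg.mk D c * s g = s g * SeqAlg.mk D c
  conj : ∀ g, ∀ a ∈ F, SeqAlg.map (autHom (β g))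
    (SeqAlg.mk D c * SeqAlg.const D a * SeqAlg.mk D c) = s g * SeqAlg.const D a * Star.star (s g)
  equivariant : ∀ g h, SeqAlg.map (autHom (β g)) (s h) = s (g * h * g⁻¹)

theorem IsApproxRepresentation.mul_star {β : H →* (D ≃⋆ₐ[ℂ] D)} {F : Finset D} {c : BddSeq D}
    {s : H → SeqAlg D} (h : IsApproxRepresentation β F c s) (g : H) :
    s g * Star.star (s g) = SeqAlg.mk D c * SeqAlg.mk D c := by
  rw [h.star, h.mul, mul_inv_cancel, h.one]

theorem IsApproxRepresentation.star_mul {β : H →* (D ≃⋆ₐ[ℂ] D)} {F : Finset D} {c : BddSeq D}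
    {s : H → SeqAlg D} (h : IsApproxRepresentation β F c s) (g : H) :
    Star.star (s g) * s g = SeqAlg.mk D c * SeqAlg.mk D c := by
  rw [h.star, h.mul, inv_mul_cancel, h.one]

/-- The relations in the definition of the weak tracial Rokhlin property, for the finite set `F`,
holding asymptotically; positivity and orthogonality of the `f_g` are exact. -/
structure IsRokhlinTower (β : H →* (D ≃⋆ₐ[ℂ] D)) (F : Finset D) (f : H → BddSeq D) : Prop where
  nonneg : ∀ g n, 0 ≤ eval D n (f g) ∧ ‖eval D n (f g)‖ ≤ 1
  orthogonal : ∀ g h, g ≠ h → f g * f h = 0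
  comm : ∀ g, ∀ a ∈ F,
    SeqAlg.const D a * SeqAlg.mk D (f g) = SeqAlg.mk D (f g) * SeqAlg.const D a
  equivariant : ∀ g h, SeqAlg.map (autHom (β g)) (SeqAlg.mk D (f h)) = SeqAlg.mk D (f (g * h))

variable [StarOrderedRing D]

/-- For an approximate representation of `β`, the relation `β_g(c a c) ∼ s_g a s_g*` for `a` and
`a a*` yields `s_g a ∼ β_g(a) s_g`. -/
theorem IsApproxRepresentation.intertwine {β : H →* (D ≃⋆ₐ[ℂ] D)} {F : Finset D} {c : BddSeq D}
    {s : H → SeqAlg D} (h : IsApproxRepresentation β F c s) {g : H} {a : D} (ha : a ∈ F)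
    (haa : a * Star.star a ∈ F) :
    s g * SeqAlg.const D a = SeqAlg.const D (β g a) * s g := by
  have hc : Star.star (SeqAlg.mk D c) = SeqAlg.mk D c := by
    rw [← map_star]
    exact congrArg _ (BddSeq.ext fun n => by rw [map_star, (h.nonneg n).1.isSelfAdjoint.star_eq])
  have hfix : SeqAlg.map (autHom (β g)) (SeqAlg.mk D c) = SeqAlg.mk D c := by
    rw [SeqAlg.map_mk]
    exact congrArg _ (BddSeq.ext fun n => h.fixed n g)
  exact SeqAlg.intertwine (σ := SeqAlg.map (autHom (β g))) hc hfix (h.mul_star g) (h.comm a ha)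
    (h.conj g a ha) (by
      have := h.conj g _ haa
      rwa [map_mul (SeqAlg.const D), map_star (SeqAlg.const D)] at this)

variable [Fintype H]

theorem HasWeakTracialRokhlinProperty.exists_isRokhlinTower {β : H →* (D ≃⋆ₐ[ℂ] D)}
    (hβ : HasWeakTracialRokhlinProperty β) (F : Finset D) {x : D} (hx : 0 ≤ x) (hx1 : ‖x‖ = 1) :
    ∃ f : H → BddSeq D, IsRokhlinTower β F f ∧
      (∀ n, CuntzSubequiv (1 - ∑ g, eval D n (f g)) x) ∧
      OneLeLiminfNorm ((∑ g, f g) * BddSeq.const D x * ∑ g, f g) := by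
  have hpos : ∀ n : ℕ, (0 : ℝ) < 1 / ((n : ℝ) + 1) := fun n => by positivity
  choose f hf horth hcomm hequi hcuntz hnorm using fun n : ℕ => hβ _ (hpos n) F x hx hx1
  let f' : H → BddSeq D := fun g => BddSeq.of (fun n => f n g) ⟨1, fun n => (hf n g).2⟩
  refine ⟨f', ⟨fun g n => hf n g, fun g h hgh => BddSeq.ext fun n => ?_, fun g a ha => ?_,
    fun g h => ?_⟩, hcuntz, .of_forall fun n => ?_⟩
  · rw [map_mul, map_zero]
    exact horth n g h hgh
  · rw [← SeqAlg.mk_const, ← map_mul, ← map_mul]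
    exact SeqAlg.mk_eq_mk_of_lt fun n => hcomm n g a ha
  · rw [SeqAlg.map_mk]
    exact SeqAlg.mk_eq_mk_of_lt fun n => hequi n g h
  · rw [map_mul, map_mul, map_sum]
    exact hnorm n

theorem IsWeaklyTraciallyApproxRepresentable.exists_isApproxRepresentation
    {β : H →* (D ≃⋆ₐ[ℂ] D)} (hβ : IsWeaklyTraciallyApproxRepresentable β) (F : Finset D) {x : D}
    (hx : 0 ≤ x) (hx1 : ‖x‖ = 1) :
    ∃ (c : BddSeq D) (s : H → SeqAlg D), IsApproxRepresentation β F c s ∧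
      (∀ n : ℕ, CuntzSubequiv (cutDown (1 - eval D n c) (1 / ((n : ℝ) + 1))) x) ∧
      OneLeLiminfNorm (c * BddSeq.const D x * c) := by
  have hpos : ∀ n : ℕ, (0 : ℝ) < 1 / ((n : ℝ) + 1) := fun n => by positivity
  choose c s hc hs hs1 hmul hcomm hconj hequi hcuntz hnorm using
    fun n : ℕ => hβ F _ (hpos n) x hx hx1
  let c' : BddSeq D := BddSeq.of c ⟨1, fun n => (hc n).2.2⟩
  let s' : H → BddSeq D := fun g => BddSeq.of (fun n => s n g) ⟨1, fun n => (hs n g).2⟩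
  refine ⟨c', fun g => SeqAlg.mk D (s' g), ⟨fun n => ⟨(hc n).1, (hc n).2.2⟩, fun n => (hc n).2.1,
    ?_, fun g => ?_, fun g h => ?_, fun a ha => ?_, fun g => ?_, fun g a ha => ?_, fun g h => ?_⟩,
    hcuntz, .of_forall fun n => ?_⟩
  · exact SeqAlg.mk_eq_mk_of_lt fun n => (hs1 n).1
  · rw [← map_star]
    exact SeqAlg.mk_eq_mk_of_lt fun n => (hs1 n).2 g
  · rw [← map_mul, ← map_mul]
    exact SeqAlg.mk_eq_mk_of_lt fun n => hmul n g h
  · rw [← SeqAlg.mk_const, ← map_mul, ← map_mul]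
    exact SeqAlg.mk_eq_mk_of_lt fun n => (hcomm n).1 a ha
  · rw [← map_mul, ← map_mul]
    exact SeqAlg.mk_eq_mk_of_lt fun n => (hcomm n).2 g
  · rw [← SeqAlg.mk_const, ← map_mul, ← map_mul, ← map_star, ← map_mul, ← map_mul, SeqAlg.map_mk]
    exact SeqAlg.mk_eq_mk_of_lt fun n => hconj n g a ha
  · rw [SeqAlg.map_mk]
    exact SeqAlg.mk_eq_mk_of_lt fun n => hequi n g h
  · rw [map_mul, map_mul]
    exact hnorm n

theorem HasWeakTracialRokhlinProperty.of_exists_isRokhlinTower {β : H →* (D ≃⋆ₐ[ℂ] D)}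
    (hβ : ∀ (F : Finset D) (x : D) (ε : ℝ), 0 ≤ x → ‖x‖ = 1 → 0 < ε →
      ∃ f : H → BddSeq D, IsRokhlinTower β F f ∧
        (∀ᶠ n in atTop, CuntzSubequiv (1 - ∑ g, eval D n (f g)) x) ∧
        ∀ᶠ n in atTop, 1 - ε < ‖eval D n (∑ g, f g) * x * eval D n (∑ g, f g)‖) :
    HasWeakTracialRokhlinProperty β := by
  intro ε hε F x hx hx1
  obtain ⟨f, hf, hcuntz, hnorm⟩ := hβ F x ε hx hx1 hε
  have h1 : ∀ᶠ n in atTop, ∀ g, ∀ a ∈ F, ‖a * eval D n (f g) - eval D n (f g) * a‖ < ε := by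
    refine eventually_all.mpr fun g => (F.eventually_all).mpr fun a ha => ?_
    have := hf.comm g a ha
    rw [← SeqAlg.mk_const, ← map_mul, ← map_mul] at this
    simpa using SeqAlg.mk_eq_mk_iff_norm.mp this ε hε
  have h2 : ∀ᶠ n in atTop, ∀ g h, ‖β g (eval D n (f h)) - eval D n (f (g * h))‖ < ε := by
    refine eventually_all.mpr fun g => eventually_all.mpr fun h => ?_
    have := hf.equivariant g h
    rw [SeqAlg.map_mk] at this
    exact SeqAlg.mk_eq_mk_iff_norm.mp this ε hε
  obtain ⟨n, h1, h2, h3, h4⟩ := (h1.and (h2.and (hcuntz.and hnorm))).exists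
  refine ⟨fun g => eval D n (f g), fun g => hf.nonneg g n, fun g h hgh => ?_, h1, h2, h3, ?_⟩
  · rw [← map_mul, hf.orthogonal g h hgh, map_zero]
  · rwa [map_sum] at h4

theorem IsWeaklyTraciallyApproxRepresentable.of_exists_isApproxRepresentation
    {β : H →* (D ≃⋆ₐ[ℂ] D)}
    (hβ : ∀ (F : Finset D) (x : D) (ε : ℝ), 0 ≤ x → ‖x‖ = 1 → 0 < ε →
      ∃ (c : BddSeq D) (s : H → SeqAlg D), IsApproxRepresentation β F c s ∧
      (∀ᶠ n in atTop, CuntzSubequiv (cutDown (1 - eval D n c) ε) x) ∧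
      ∀ᶠ n in atTop, 1 - ε < ‖eval D n c * x * eval D n c‖) :
    IsWeaklyTraciallyApproxRepresentable β := by
  intro F ε hε x hx hx1
  obtain ⟨c, s, hs, hcuntz, hnorm⟩ := hβ F x ε hx hx1 hε
  have hlift : ∀ g, ∃ t : BddSeq D, SeqAlg.mk D t = s g ∧
      ∀ n, ‖eval D n t‖ ≤ 1 ∧ ∃ a, eval D n t = eval D n c * a * eval D n c := fun g => by
    obtain ⟨s', hs'⟩ := SeqAlg.mk_surjective (s g)
    obtain ⟨t, ht, ht'⟩ := exists_mem_corner hs.nonneg (s := s') (by rw [hs', hs.mul_star])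
      (by rw [hs', hs.star_mul])
    exact ⟨t, ht.trans hs', ht'⟩
  choose t ht ht' using hlift
  have ev : ∀ {a b : BddSeq D}, SeqAlg.mk D a = SeqAlg.mk D b →
      ∀ᶠ n in atTop, ‖eval D n a - eval D n b‖ < ε := fun h => SeqAlg.mk_eq_mk_iff_norm.mp h ε hε
  have h1 : ∀ᶠ n in atTop, ‖eval D n (t 1) - eval D n c‖ < ε := ev (by rw [ht, hs.one])
  have h2 : ∀ᶠ n in atTop, ∀ g, ‖Star.star (eval D n (t g)) - eval D n (t g⁻¹)‖ < ε :=
    eventually_all.mpr fun g => by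
      have := ev (a := Star.star (t g)) (b := t g⁻¹) (by rw [map_star, ht, ht, hs.star])
      simpa only [map_star] using this
  have h3 : ∀ᶠ n in atTop, ∀ g h,
      ‖eval D n (t g) * eval D n (t h) - eval D n c * eval D n (t (g * h))‖ < ε :=
    eventually_all.mpr fun g => eventually_all.mpr fun h => by
      have := ev (a := t g * t h) (b := c * t (g * h)) (by simp only [map_mul, ht, hs.mul])
      simpa only [map_mul] using this
  have h4 : ∀ᶠ n in atTop, ∀ a ∈ F, ‖eval D n c * a - a * eval D n c‖ < ε :=
    (F.eventually_all).mpr fun a ha => by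
      have := ev (a := c * BddSeq.const D a) (b := BddSeq.const D a * c)
        (by simp only [map_mul, SeqAlg.mk_const, hs.comm a ha])
      simpa only [map_mul, BddSeq.eval_const] using this
  have h5 : ∀ᶠ n in atTop, ∀ g, ‖eval D n c * eval D n (t g) - eval D n (t g) * eval D n c‖ < ε :=
    eventually_all.mpr fun g => by
      have := ev (a := c * t g) (b := t g * c) (by simp only [map_mul, ht, hs.comm_s])
      simpa only [map_mul] using this
  have h6 : ∀ᶠ n in atTop, ∀ g, ∀ a ∈ F, ‖β g (eval D n c * a * eval D n c) -
      eval D n (t g) * a * Star.star (eval D n (t g))‖ < ε :=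
    eventually_all.mpr fun g => (F.eventually_all).mpr fun a ha => by
      have := ev (a := BddSeq.map (autHom (β g)) (c * BddSeq.const D a * c))
        (b := t g * BddSeq.const D a * Star.star (t g))
        (by rw [← SeqAlg.map_mk]; simp only [map_mul _ (_ * _) _, map_mul _ c _, map_mul _ (t g) _,
              map_star, ht, SeqAlg.mk_const]
            rw [← hs.conj g a ha, ← map_mul])
      simp only [map_mul _ (t g * _) _, map_mul _ (t g) _, map_star] at this
      exact this
  have h7 : ∀ᶠ n in atTop, ∀ g h, ‖β g (eval D n (t h)) - eval D n (t (g * h * g⁻¹))‖ < ε :=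
    eventually_all.mpr fun g => eventually_all.mpr fun h =>
      ev (a := BddSeq.map (autHom (β g)) (t h)) (b := t (g * h * g⁻¹))
        (by rw [← SeqAlg.map_mk, ht, ht, hs.equivariant])
  obtain ⟨n, h1, h2, h3, h4, h5, h6, h7, h8, h9⟩ :=
    (h1.and (h2.and (h3.and (h4.and (h5.and (h6.and (h7.and (hcuntz.and hnorm)))))))).exists
  refine ⟨eval D n c, fun g => eval D n (t g), ⟨(hs.nonneg n).1, hs.fixed n, (hs.nonneg n).2⟩,
    fun g => ⟨subset_closure ?_, (ht' g n).1⟩, ⟨h1, h2⟩, h3, ⟨h4, h5⟩, h6, h7, h8, h9⟩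
  obtain ⟨a, ha⟩ := (ht' g n).2
  exact ⟨a, ha.symm⟩

end SequenceForms

/-! ### The conditional expectation and the dual action -/

section Expectation

open BddSeq

/-- Cuntz comparison adds up over mutually orthogonal elements `zᵢ x zᵢ*`. -/
theorem CuntzSubequiv.sum_conj_of_orthogonal {D : Type*} [CStarAlgebra D] {ι : Type*} [Fintype ι]
    {z p : ι → D} {x : D} (horth : ∀ i j, i ≠ j → z i * x * star (z j) = 0)
    (h : ∀ i, CuntzSubequiv (p i) (z i * x * star (z i))) (y : ι → D) :
    CuntzSubequiv (∑ i, y i * p i * star (y i)) x := by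
  choose w hw using h
  refine .of_tendsto (f := fun n => (∑ i, y i * w i n * z i) * x * star (∑ i, y i * w i n * z i))
    ?_ fun n => .of_eq_mul rfl
  have h1 : ∀ n, (∑ i, y i * w i n * z i) * x * star (∑ i, y i * w i n * z i) =
      ∑ i, y i * (w i n * (z i * x * star (z i)) * star (w i n)) * star (y i) := fun n => by
    rw [Finset.sum_mul, star_sum, Finset.sum_mul]
    refine Finset.sum_congr rfl fun i _ => ?_
    rw [Finset.mul_sum, Finset.sum_eq_single i (fun j _ hj => ?_) (by simp)]
    · simp only [star_mul, mul_assoc]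
    · calc _ = y i * w i n * (z i * x * star (z j)) * star (w j n) * star (y j) := by
            simp only [star_mul, mul_assoc]
        _ = 0 := by rw [horth i j hj.symm]; simp
  simp only [h1]
  exact tendsto_finsetSum _ fun i _ => ((hw i).const_mul (y i)).mul_const _

namespace CrossedProduct

variable {A : Type*} [CStarAlgebra A] [PartialOrder A] [StarOrderedRing A]
  {G : Type*} [Group G] [Fintype G] [DecidableEq G] (α : G →* (A ≃⋆ₐ[ℂ] A))

theorem norm_incl (a : A) : ‖incl α a‖ = ‖a‖ :=
  NonUnitalStarAlgHom.norm_map (incl α) (incl_injective α) a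

variable {α} in
theorem norm_coeff_one_le (b : CrossedProduct α) : ‖b.coeff 1‖ ≤ ‖b‖ := by
  have : b.coeff 1 = regularRep b 1 1 := by rw [regularRep_apply, inv_one, apply_one, mul_one]
  rw [this, norm_def]
  exact CStarMatrix.norm_entry_le_norm

variable {α} in
theorem coeff_one_nonneg {b : CrossedProduct α} (hb : 0 ≤ b) : 0 ≤ b.coeff 1 := by
  obtain ⟨y, rfl⟩ := CStarAlgebra.nonneg_iff_eq_star_mul_self.mp hb
  rw [coeff_one_star_mul_self]
  exact Finset.sum_nonneg fun g _ => star_mul_self_nonneg _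

variable {α} in
/-- The conditional expectation `b ↦ b(1)` is faithful. -/
theorem coeff_one_ne_zero {b : CrossedProduct α} (hb : 0 ≤ b) (hb0 : b ≠ 0) : b.coeff 1 ≠ 0 := by
  obtain ⟨y, rfl⟩ := CStarAlgebra.nonneg_iff_eq_star_mul_self.mp hb
  rw [coeff_one_star_mul_self]
  intro h
  refine hb0 ?_
  have : y = 0 := by
    ext g
    have := (Finset.sum_eq_zero_iff_of_nonneg fun g _ => star_mul_self_nonneg _).mp h g⁻¹
      (Finset.mem_univ _)
    rw [CStarRing.star_mul_self_eq_zero_iff, inv_inv] at this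
    exact (map_eq_zero_iff _ (α g⁻¹).injective).mp this
  rw [this, mul_zero]

theorem incl_nonneg {a : A} (ha : 0 ≤ a) : 0 ≤ incl α a := by
  obtain ⟨y, rfl⟩ := CStarAlgebra.nonneg_iff_eq_star_mul_self.mp ha
  rw [map_mul, map_star]
  exact star_mul_self_nonneg _

theorem incl_cutDown {a : A} (ha : IsSelfAdjoint a) (ε : ℝ) :
    incl α (cutDown a ε) = cutDown (incl α a) ε := by
  have hc : Continuous (incl α) :=
    AddMonoidHomClass.continuous_of_bound (incl α) 1
      (by simpa using NonUnitalStarAlgHom.norm_apply_le (incl α))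
  exact StarAlgHomClass.map_cfc (R := ℝ) (S := ℂ) (incl α) _ a
    (by fun_prop) hc ha (ha.map (incl α))

/-- Cuntz comparison below `x'` in the crossed product descends to comparison below `x` in `A`, if
the orbit of `x'` fits orthogonally into `x`. -/
theorem cuntzSubequiv_of_incl {a x' x : A} (h : CuntzSubequiv (incl α a) (incl α x'))
    {z : G → A} (horth : ∀ g k, g ≠ k → z g * x * star (z k) = 0)
    (hz : ∀ g, CuntzSubequiv (α g x') (z g * x * star (z g))) : CuntzSubequiv a x := by
  obtain ⟨y, hy⟩ := h
  refine .of_tendsto (f := fun n => (y n * incl α x' * star (y n)).coeff 1) ?_ fun n => ?_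
  · rw [tendsto_iff_norm_sub_tendsto_zero] at hy ⊢
    refine squeeze_zero (fun _ => norm_nonneg _) (fun n => ?_) hy
    have := norm_coeff_one_le (y n * incl α x' * star (y n) - incl α a)
    rwa [coeff_sub, coeff_incl_one] at this
  · rw [coeff_one_conj_incl]
    exact .sum_conj_of_orthogonal horth hz _

/-- The conditional expectation `b ↦ b(1)`, applied term by term. -/
noncomputable def expSeq (b : BddSeq (CrossedProduct α)) : BddSeq A :=
  BddSeq.of (fun n => (eval (CrossedProduct α) n b).coeff 1) <| by
    obtain ⟨C, -, hC⟩ := BddSeq.exists_bound b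
    exact ⟨C, fun n => (norm_coeff_one_le _).trans (hC n)⟩

@[simp] theorem eval_expSeq (b : BddSeq (CrossedProduct α)) (n : ℕ) :
    eval A n (expSeq α b) = (eval (CrossedProduct α) n b).coeff 1 := rfl

/-- In the crossed product, the action is implemented by the canonical unitaries. -/
theorem map_incl_map_autHom (g : G) (t : SeqAlg A) :
    SeqAlg.map (incl α) (SeqAlg.map (autHom (α g)) t) =
      SeqAlg.const (CrossedProduct α) (unitaryOf α g) * SeqAlg.map (incl α) t *
        SeqAlg.const (CrossedProduct α) (star (unitaryOf α g)) := by
  obtain ⟨a, rfl⟩ := SeqAlg.mk_surjective t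
  simp only [SeqAlg.map_mk, ← SeqAlg.mk_const, ← map_mul]
  refine congrArg _ (BddSeq.ext fun n => ?_)
  rw [map_mul, map_mul]
  exact (unitaryOf_mul_incl_mul_star α g _).symm

section Dual

variable {G : Type*} [CommGroup G] [Fintype G] [DecidableEq G] [TopologicalSpace G]
  (α : G →* (A ≃⋆ₐ[ℂ] A))

theorem coeff_dualAction (ω : PontryaginDual G) (b : CrossedProduct α) (g : G) :
    (dualAction α ω b).coeff g = star (ω g : ℂ) • b.coeff g := rfl

@[simp] theorem dualAction_incl (ω : PontryaginDual G) (a : A) :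
    dualAction α ω (incl α a) = incl α a := by
  ext g
  rw [coeff_dualAction, coeff_incl]
  split_ifs with hg
  · subst hg; simp
  · simp

@[simp] theorem dualAction_unitaryOf (ω : PontryaginDual G) (g : G) :
    dualAction α ω (unitaryOf α g) = star (ω g : ℂ) • unitaryOf α g := by
  ext k
  rw [coeff_dualAction, coeff_smul]
  by_cases hk : k = g <;> simp [unitaryOf, hk]

theorem map_dualAction_map_incl (ω : PontryaginDual G) (t : SeqAlg A) :
    SeqAlg.map (autHom (dualAction α ω)) (SeqAlg.map (incl α) t) = SeqAlg.map (incl α) t := by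
  obtain ⟨a, rfl⟩ := SeqAlg.mk_surjective t
  rw [SeqAlg.map_mk, SeqAlg.map_mk]
  exact congrArg _ (BddSeq.ext fun n => dualAction_incl α ω _)

variable [DiscreteTopology G]

/-- The conditional expectation onto `A` is the average of the dual action. -/
theorem sum_dualAction (b : CrossedProduct α) :
    ∑ ω, dualAction α ω b = (Fintype.card (PontryaginDual G) : ℂ) • incl α (b.coeff 1) := by
  ext g
  rw [coeff_sum, coeff_smul]
  simp only [coeff_dualAction]
  rw [← Finset.sum_smul, coeff_incl]
  split_ifs with hg
  · subst hg; simp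
  · have : ∑ ω : PontryaginDual G, star (ω g : ℂ) = 0 := by
      rw [← star_sum, PontryaginDual.sum_apply_eq_zero_of_ne_one hg, star_zero]
    rw [this, zero_smul, smul_zero]

theorem incl_coeff_one_of_fixed {b : CrossedProduct α} (h : ∀ ω, dualAction α ω b = b) :
    incl α (b.coeff 1) = b := by
  have h1 := sum_dualAction α b
  simp only [h, Finset.sum_const, Finset.card_univ, ← Nat.cast_smul_eq_nsmul ℂ] at h1
  exact (smul_right_injective _ (by simp [Fintype.card_ne_zero]) h1).symm

/-- Bounded sequences in the crossed product which are asymptotically fixed by the dual action come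
from bounded sequences in `A`. -/
theorem mk_map_incl_expSeq {b : BddSeq (CrossedProduct α)}
    (h : ∀ ω, SeqAlg.map (autHom (dualAction α ω))
      (SeqAlg.mk (CrossedProduct α) b) = SeqAlg.mk (CrossedProduct α) b) :
    SeqAlg.map (incl α) (SeqAlg.mk A (expSeq α b)) = SeqAlg.mk (CrossedProduct α) b := by
  have h1 : ∑ ω, BddSeq.map (autHom (dualAction α ω)) b =
      (Fintype.card (PontryaginDual G) : ℂ) • BddSeq.map (incl α) (expSeq α b) :=
    BddSeq.ext fun n => by
      rw [map_sum, map_smul]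
      exact sum_dualAction α (eval (CrossedProduct α) n b)
  have h2 := congrArg (SeqAlg.mk (CrossedProduct α)) h1
  simp only [map_sum, map_smul, ← SeqAlg.map_mk, h, Finset.sum_const, Finset.card_univ,
    ← Nat.cast_smul_eq_nsmul ℂ] at h2
  have hn : (Fintype.card (PontryaginDual G) : ℂ) ≠ 0 := by simp [Fintype.card_ne_zero]
  have h3 := congrArg (fun z => (Fintype.card (PontryaginDual G) : ℂ)⁻¹ • z) h2
  simpa only [smul_smul, inv_mul_cancel₀ hn, one_smul] using h3.symm

end Dual

end CrossedProduct

end Expectation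

/-! ### The four implications -/

section Duality

open BddSeq CrossedProduct

variable {A : Type*} [CStarAlgebra A] [PartialOrder A] [StarOrderedRing A]
  {G : Type*} [CommGroup G] [Fintype G] [DecidableEq G] {α : G →* (A ≃⋆ₐ[ℂ] A)}

/-- A norm-one element whose orbit embeds orthogonally into the top part of `x`. -/
theorem exists_orthogonal_translates_top [IsSimpleRing A] (hinf : ¬ FiniteDimensional ℂ A)
    (α : G →* (A ≃⋆ₐ[ℂ] A)) {x : A} (hx : 0 ≤ x) (hx1 : ‖x‖ = 1) {η : ℝ} (hη : 0 < η) :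
    ∃ y v : A, 0 ≤ y ∧ ‖y‖ = 1 ∧ ‖v‖ ≤ 1 + η ∧ ‖v * x * star v - y‖ < η ∧
      ∀ a, CuntzSubequiv (incl α a) (incl α y) → CuntzSubequiv a x := by
  obtain ⟨h, h0, hne, hle, htop⟩ := exists_top_part hx hx1 hη
  obtain ⟨z, y, horth, hy, hy1, hz⟩ := exists_orthogonal_translates hinf (fun g => α g) h0 hne
  have hyh : CuntzSubequiv y h := by
    have := hz 1
    rw [apply_one] at this
    exact this.trans (.of_eq_mul rfl)
  obtain ⟨v, hv, hvx⟩ := htop y hy1 hyh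
  exact ⟨y, v, hy, hy1, hv, hvx, fun a ha =>
    (cuntzSubequiv_of_incl α ha horth hz).trans (.of_le h0 hle)⟩

/-- Elements of the sequence algebra commuting with all `u_g` and with the coefficients of `b`
commute with `b`. -/
theorem mul_const_eq_const_mul {T : SeqAlg (CrossedProduct α)} {b : CrossedProduct α}
    (h : ∀ g, T * SeqAlg.const (CrossedProduct α) (incl α (b.coeff g)) =
      SeqAlg.const (CrossedProduct α) (incl α (b.coeff g)) * T)
    (h' : ∀ g, T * SeqAlg.const (CrossedProduct α) (unitaryOf α g) =
      SeqAlg.const (CrossedProduct α) (unitaryOf α g) * T) :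
    T * SeqAlg.const (CrossedProduct α) b = SeqAlg.const (CrossedProduct α) b * T := by
  rw [eq_sum_incl_mul_unitaryOf α b, map_sum, Finset.mul_sum, Finset.sum_mul]
  refine Finset.sum_congr rfl fun g _ => ?_
  rw [map_mul, ← mul_assoc, h, mul_assoc, h', mul_assoc]

/-- If a nonzero element `y` of the sequence algebra of the crossed product, with all `yₙ` Cuntz
below `h`, is represented by positive elements of `A`, then some norm-one positive element of `A`
is Cuntz below `h`. -/
theorem exists_incl_cuntzSubequiv {h : CrossedProduct α} {y : BddSeq (CrossedProduct α)}
    {a : BddSeq A} (ha : ∀ n, 0 ≤ eval A n a) (hysa : ∀ n, IsSelfAdjoint (eval (CrossedProduct α) n y))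
    (hay : SeqAlg.map (incl α) (SeqAlg.mk A a) = SeqAlg.mk (CrossedProduct α) y)
    (hy0 : SeqAlg.mk (CrossedProduct α) y ≠ 0)
    (hy : ∀ n, CuntzSubequiv (eval (CrossedProduct α) n y) h) :
    ∃ x : A, 0 ≤ x ∧ ‖x‖ = 1 ∧ CuntzSubequiv (incl α x) h := by
  have ha0 : SeqAlg.mk A a ≠ SeqAlg.mk A 0 := fun e => hy0 (by rw [← hay, e, map_zero, map_zero])
  rw [ne_eq, SeqAlg.mk_eq_mk_iff_norm] at ha0
  push Not at ha0
  obtain ⟨δ, hδ, hfreq⟩ := ha0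
  have hev := SeqAlg.mk_eq_mk_iff_norm.mp hay (δ / 2) (by positivity)
  obtain ⟨n, hn1, hn2⟩ := (hfreq.and_eventually hev).exists
  rw [map_zero, sub_zero] at hn1
  have h0 : 0 ≤ cutDown (eval A n a) (δ / 2) := cfc_nonneg fun t _ => le_max_left _ _
  have hne : cutDown (eval A n a) (δ / 2) ≠ 0 := by
    intro e
    have := le_cutDown_add (ha n).isSelfAdjoint (δ / 2)
    rw [e, zero_add] at this
    have := CStarAlgebra.norm_le_norm_of_nonneg_of_le (ha n) this
    rcases subsingleton_or_nontrivial A with hs | hs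
    · exact hδ.not_ge (hn1.trans (by rw [Subsingleton.elim (eval A n a) 0, norm_zero]))
    · rw [norm_algebraMap', Real.norm_of_nonneg (by positivity)] at this
      linarith
  refine ⟨‖cutDown (eval A n a) (δ / 2)‖⁻¹ • cutDown (eval A n a) (δ / 2),
    smul_nonneg (by positivity) h0, ?_, ?_⟩
  · rw [norm_smul, norm_inv, norm_norm, inv_mul_cancel₀ (norm_ne_zero_iff.mpr hne)]
  · have hs : incl α (‖cutDown (eval A n a) (δ / 2)‖⁻¹ • cutDown (eval A n a) (δ / 2)) =
        ‖cutDown (eval A n a) (δ / 2)‖⁻¹ • incl α (cutDown (eval A n a) (δ / 2)) := by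
      rw [← Complex.coe_smul, map_smul, Complex.coe_smul]
    rw [hs, incl_cutDown α (ha n).isSelfAdjoint]
    refine (CuntzSubequiv.trans ?_ (hy n)).smul_left (by positivity)
    have hsa : IsSelfAdjoint (incl α (eval A n a)) := (ha n).isSelfAdjoint.map (incl α)
    refine .cutDown_of_le hsa ?_
    rw [← sub_le_iff_le_add']
    exact (hsa.sub (hysa n)).le_algebraMap_norm_self.trans (algebraMap_mono _ hn2.le)

theorem sum_smul_mul_sum_smul {R Γ : Type*} [Ring R] [Algebra ℂ R] [Fintype Γ] {φ : Γ → R}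
    (horth : ∀ g k, g ≠ k → φ g * φ k = 0) (a b : Γ → ℂ) :
    (∑ g, a g • φ g) * ∑ g, b g • φ g = ∑ g, (a g * b g) • (φ g * φ g) := by
  rw [Finset.sum_mul]
  refine Finset.sum_congr rfl fun g _ => ?_
  rw [Finset.mul_sum, Finset.sum_eq_single g (fun k _ hk => ?_) (by simp), smul_mul_smul_comm]
  rw [smul_mul_smul_comm, horth g k hk.symm, smul_zero]

/-- The canonical unitaries permute a tower for `α`. -/
theorem unitaryOf_mul_tower {F : Finset A} {f : G → BddSeq A} (hf : IsRokhlinTower α F f) (g k : G) :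
    SeqAlg.const (CrossedProduct α) (unitaryOf α g) * SeqAlg.map (incl α) (SeqAlg.mk A (f k)) =
      SeqAlg.map (incl α) (SeqAlg.mk A (f (g * k))) *
        SeqAlg.const (CrossedProduct α) (unitaryOf α g) := by
  rw [← hf.equivariant, map_incl_map_autHom, mul_assoc, ← map_mul, star_mul_unitaryOf, map_one,
    mul_one]

/-- If `α` has the weak tracial Rokhlin property, every nonzero positive `h` in the crossed product
dominates a positive element of `A`: a tower kills the off-diagonal coefficients of `h`, so that
`f_g h f_g ∼ f_g h(1) f_g`. -/
theorem exists_incl_cuntzSubequiv_of_rokhlin (hα : HasWeakTracialRokhlinProperty α)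
    {h : CrossedProduct α} (h0 : 0 ≤ h) (hne : h ≠ 0) :
    ∃ x : A, 0 ≤ x ∧ ‖x‖ = 1 ∧ CuntzSubequiv (incl α x) h := by
  have h1 : 0 ≤ h.coeff 1 := coeff_one_nonneg h0
  have h1ne : h.coeff 1 ≠ 0 := coeff_one_ne_zero h0 hne
  obtain ⟨F, hF⟩ : ∃ F : Finset A, ∀ k, h.coeff k ∈ F := by
    classical
    exact ⟨Finset.univ.image h.coeff, fun k => Finset.mem_image_of_mem _ (Finset.mem_univ k)⟩
  obtain ⟨f, hf, -, hnorm⟩ := hα.exists_isRokhlinTower F (x := ‖h.coeff 1‖⁻¹ • h.coeff 1)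
    (smul_nonneg (by positivity) h1)
    (by rw [norm_smul, norm_inv, norm_norm, inv_mul_cancel₀ (norm_ne_zero_iff.mpr h1ne)])
  have horth : ∀ g k, g ≠ k → SeqAlg.mk A (f g) * SeqAlg.mk A (f k) = 0 := fun g k hgk => by
    rw [← map_mul, hf.orthogonal g k hgk, map_zero]
  have key : ∀ g, SeqAlg.map (incl α) (SeqAlg.mk A (f g * BddSeq.const A (h.coeff 1) * f g)) =
      SeqAlg.mk (CrossedProduct α) (BddSeq.map (incl α) (f g) *
        BddSeq.const (CrossedProduct α) h * BddSeq.map (incl α) (f g)) := by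
    intro g
    simp only [map_mul, SeqAlg.mk_const, SeqAlg.map_const, ← SeqAlg.map_mk]
    conv_rhs => rw [eq_sum_incl_mul_unitaryOf α h]
    rw [map_sum, Finset.mul_sum, Finset.sum_mul, Finset.sum_eq_single 1 (fun k _ hk => ?_) (by simp)]
    · rw [unitaryOf_one, mul_one]
    · rw [map_mul, mul_assoc, mul_assoc, unitaryOf_mul_tower hf, ← mul_assoc, ← mul_assoc,
        ← SeqAlg.map_const, ← map_mul, ← hf.comm g _ (hF k), map_mul,
        mul_assoc (SeqAlg.map _ _) (SeqAlg.map _ _), ← map_mul, horth _ _ (by simpa using hk)]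
      simp
  by_contra hcon
  have hz : ∀ g, SeqAlg.mk A (f g * BddSeq.const A (h.coeff 1) * f g) = 0 := by
    intro g
    by_contra hg
    refine hcon (exists_incl_cuntzSubequiv (fun n => ?_) (fun n => ?_) (key g)
      (fun e => hg ?_) fun n => ?_)
    · have := (hf.nonneg g n).1.isSelfAdjoint.conjugate_nonneg h1
      simpa only [map_mul, BddSeq.eval_const] using this
    · have e : IsSelfAdjoint (incl α (eval A n (f g))) :=
        (hf.nonneg g n).1.isSelfAdjoint.map (incl α)
      have := e.conjugate_nonneg h0
      simp only [map_mul]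
      exact this.isSelfAdjoint
    · refine SeqAlg.map_injective _ (incl_injective α) ?_
      rw [key g, e, map_zero]
    · have e : IsSelfAdjoint (incl α (eval A n (f g))) :=
        (hf.nonneg g n).1.isSelfAdjoint.map (incl α)
      refine .of_eq_mul (y := incl α (eval A n (f g))) ?_
      rw [e.star_eq, map_mul, map_mul]
      rfl
  refine hnorm.mk_ne_zero ?_
  have hconst : BddSeq.const A (‖h.coeff 1‖⁻¹ • h.coeff 1) =
      ((‖h.coeff 1‖⁻¹ : ℝ) : ℂ) • BddSeq.const A (h.coeff 1) := by
    rw [← map_smul, Complex.coe_smul]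
  rw [hconst, mul_smul_comm, smul_mul_assoc, map_smul]
  refine (congrArg _ ?_).trans (smul_zero _)
  rw [map_mul, map_mul, map_sum, Finset.sum_mul, Finset.sum_mul]
  refine Finset.sum_eq_zero fun g _ => ?_
  rw [Finset.mul_sum]
  refine Finset.sum_eq_zero fun k _ => ?_
  by_cases hgk : g = k
  · subst hgk
    rw [← map_mul, ← map_mul, hz]
  · rw [SeqAlg.mk_const, ← hf.comm g _ (hF 1), mul_assoc, horth g k hgk, mul_zero]

variable [TopologicalSpace G] [DiscreteTopology G]

/-- Given an approximate representation `s` of the dual action, all `s_ω` are asymptotically fixed by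
the dual action, hence come from `A`. They satisfy `α_g(s_ω) ∼ ω(g) s_ω`, so `α` permutes their spectral
decomposition. -/
theorem hasWeakTracialRokhlinProperty_of_dual [IsSimpleRing A] (hinf : ¬ FiniteDimensional ℂ A)
    (h : IsWeaklyTraciallyApproxRepresentable (dualAction α)) :
    HasWeakTracialRokhlinProperty α := by
  refine .of_exists_isRokhlinTower fun F x ε hx hx1 hε => ?_
  obtain ⟨y, v, hy, hy1, hv, hvx, htrans⟩ :=
    exists_orthogonal_translates_top hinf α hx hx1 (η := ε / 8) (by positivity)
  obtain ⟨S, hSa, hSu, hS1⟩ : ∃ S : Finset (CrossedProduct α),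
      (∀ a, a = v ∨ a ∈ F → incl α a ∈ S ∧ incl α a * star (incl α a) ∈ S) ∧
      (∀ g, unitaryOf α g ∈ S) ∧ 1 ∈ S := by
    classical
    refine ⟨(insert v F).image (incl α) ∪
      (insert v F).image (fun a => incl α a * star (incl α a)) ∪
        Finset.univ.image (unitaryOf α), fun a ha => ⟨?_, ?_⟩, fun g => ?_, ?_⟩
    · have : a ∈ insert v F := Finset.mem_insert.mpr ha
      exact Finset.mem_union_left _ (Finset.mem_union_left _ (Finset.mem_image_of_mem _ this))
    · have : a ∈ insert v F := Finset.mem_insert.mpr ha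
      exact Finset.mem_union_left _ (Finset.mem_union_right _
        (Finset.mem_image_of_mem (fun a => incl α a * star (incl α a)) this))
    · exact Finset.mem_union_right _ (Finset.mem_image_of_mem _ (Finset.mem_univ g))
    · exact Finset.mem_union_right _ (Finset.mem_image.mpr ⟨1, Finset.mem_univ _, rfl⟩)
  obtain ⟨c, s, hs, hcuntz, hnorm⟩ := h.exists_isApproxRepresentation S
    (incl_nonneg α hy) ((norm_incl α y).trans hy1)
  have hinj : Function.Injective (SeqAlg.map (incl α)) := SeqAlg.map_injective _ (incl_injective α)
  -- `c` and `s_ω` come from `A`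
  obtain ⟨c', hc'⟩ : ∃ c' : BddSeq A, c' = expSeq α c := ⟨_, rfl⟩
  have hc'n : ∀ n, incl α (eval A n c') = eval (CrossedProduct α) n c := fun n => by
    rw [hc', eval_expSeq, incl_coeff_one_of_fixed α (hs.fixed n)]
  have hmk : SeqAlg.map (incl α) (SeqAlg.mk A c') = SeqAlg.mk (CrossedProduct α) c :=
    congrArg (SeqAlg.mk (CrossedProduct α)) (BddSeq.ext hc'n)
  have hlift : ∀ ω, ∃ t : SeqAlg A, SeqAlg.map (incl α) t = s ω := fun ω => by
    obtain ⟨b, hb⟩ := SeqAlg.mk_surjective (s ω)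
    refine ⟨SeqAlg.mk A (expSeq α b), ?_⟩
    rw [mk_map_incl_expSeq α fun τ => ?_, hb]
    rw [hb, hs.equivariant, mul_comm τ, mul_inv_cancel_right]
  choose t ht using hlift
  have hc'0 : ∀ n, 0 ≤ eval A n c' ∧ ‖eval A n c'‖ ≤ 1 := fun n => by
    rw [hc', eval_expSeq]
    exact ⟨coeff_one_nonneg (hs.nonneg n).1, (norm_coeff_one_le _).trans (hs.nonneg n).2⟩
  -- `s_ω` commutes with the prescribed elements of `A`, and commutes with `u_g` up to a scalar
  have hta : ∀ ω, ∀ a, a = v ∨ a ∈ F → t ω * SeqAlg.const A a = SeqAlg.const A a * t ω := by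
    intro ω a ha
    refine hinj ?_
    rw [map_mul, map_mul, ht, SeqAlg.map_const, hs.intertwine (hSa a ha).1 (hSa a ha).2,
      dualAction_incl]
  have htu : ∀ g ω, SeqAlg.map (autHom (α g)) (t ω) = (ω g : ℂ) • t ω := by
    intro g ω
    refine hinj ?_
    have h1 := hs.intertwine (g := ω) (hSu g) (by rw [unitaryOf_mul_star]; exact hS1)
    rw [dualAction_unitaryOf, map_smul, smul_mul_assoc] at h1
    have h2 : (ω g : ℂ) • (s ω * SeqAlg.const (CrossedProduct α) (unitaryOf α g)) =
        SeqAlg.const (CrossedProduct α) (unitaryOf α g) * s ω := by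
      rw [h1, smul_smul, mul_comm (ω g : ℂ), star_mul_circle, one_smul]
    rw [map_incl_map_autHom, ht, ← h2, smul_mul_assoc, mul_assoc, ← map_mul, unitaryOf_mul_star,
      map_one, mul_one, map_smul, ht]
  obtain ⟨f, hf, horth, hft, hfc, hfcuntz⟩ := exists_tower_of_approxRep (H := PontryaginDual G)
    (Γ := G) (χ := PontryaginDual.evalChar)
    PontryaginDual.sum_evalChar_mul_star
    (fun _ => PontryaginDual.sum_eq_zero_of_ne_one) PontryaginDual.card_eq.symm hc'0
    (s := t) (hinj (by rw [ht, hs.one, hmk])) (fun ω => hinj (by rw [map_star, ht, ht, hs.star]))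
    (fun ω τ => hinj (by rw [map_mul, map_mul, ht, ht, ht, hs.mul, hmk]))
    (fun ω => hinj (by rw [map_mul, map_mul, ht, hmk, hs.comm_s]))
  have hfa : ∀ g a, a = v ∨ a ∈ F →
      SeqAlg.const A a * SeqAlg.mk A (f g) = SeqAlg.mk A (f g) * SeqAlg.const A a := by
    intro g a ha
    rw [hft, mul_smul_comm, smul_mul_assoc, Finset.mul_sum, Finset.sum_mul]
    refine congrArg _ (Finset.sum_congr rfl fun ω _ => ?_)
    rw [mul_smul_comm, smul_mul_assoc, hta ω a ha]
  have hsum : SeqAlg.mk A (∑ g, f g) = SeqAlg.mk A c' := by rw [map_sum, hfc]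
  refine ⟨f, ⟨hf, horth, fun g a ha => hfa g a (Or.inr ha), fun g k => ?_⟩, ?_, ?_⟩
  · rw [hft, hft, map_smul, map_sum]
    refine congrArg _ (Finset.sum_congr rfl fun ω _ => ?_)
    rw [map_smul, htu, smul_smul]
    refine congrArg (· • t ω) ?_
    change (ω k : ℂ) * (ω g : ℂ) = (ω (g * k) : ℂ)
    rw [map_mul, Circle.coe_mul, mul_comm]
  · filter_upwards [hfcuntz] with n hn
    refine hn.trans (htrans _ ?_)
    rw [incl_cutDown α (.sub (.one _) (hc'0 n).1.isSelfAdjoint), map_sub, map_one, hc'n]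
    exact hcuntz n
  · refine OneLeLiminfNorm.of_conj (y := y) (v := v) (fun n => ?_) (fun n => ?_) hε ?_ hv hvx ?_
    · rw [map_sum]
      exact (Finset.sum_nonneg fun g _ => (hf g n).1).isSelfAdjoint
    · rw [map_sum]
      exact norm_sum_le_one_of_orthogonal (fun g => (hf g n).1) (fun g => (hf g n).2)
        fun g k hgk => by rw [← map_mul, horth g k hgk, map_zero]
    · rw [map_sum, Finset.sum_mul, Finset.mul_sum]
      exact Finset.sum_congr rfl fun g _ => (hfa g v (Or.inl rfl)).symm
    · refine OneLeLiminfNorm.congr (a := c' * BddSeq.const A y * c') (fun δ hδ => ?_) ?_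
      · filter_upwards [hnorm δ hδ] with n hn
        rw [map_mul, map_mul, ← hc'n] at hn
        rw [← norm_incl α, map_mul, map_mul, map_mul, map_mul]
        exact hn
      · simp only [map_mul, hsum]

/-- The Fourier transforms `s_ω = ∑ conj (ω(g)) f_g` of a tower for `α` represent the dual action. -/
theorem isWeaklyTraciallyApproxRepresentable_dual (h : HasWeakTracialRokhlinProperty α) :
    IsWeaklyTraciallyApproxRepresentable (dualAction α) := by
  refine .of_exists_isApproxRepresentation fun F x ε hx hx1 hε => ?_
  obtain ⟨k, k0, kne, kle, ktop⟩ := exists_top_part hx hx1 (η := ε / 8) (by positivity)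
  obtain ⟨y, hy, hy1, hyk⟩ := exists_incl_cuntzSubequiv_of_rokhlin h k0 kne
  obtain ⟨v, hv, hvx⟩ := ktop _ ((norm_incl α y).trans hy1) hyk
  obtain ⟨S, hS⟩ : ∃ S : Finset A, ∀ b, b = v ∨ b ∈ F → ∀ g, b.coeff g ∈ S := by
    classical
    refine ⟨(insert v F).biUnion fun b => Finset.univ.image b.coeff, fun b hb g => ?_⟩
    exact Finset.mem_biUnion.mpr ⟨b, Finset.mem_insert.mpr hb,
      Finset.mem_image_of_mem _ (Finset.mem_univ g)⟩
  obtain ⟨f, hf, hcuntz, hnorm⟩ := h.exists_isRokhlinTower S hy hy1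
  let φ : G → SeqAlg (CrossedProduct α) := fun g => SeqAlg.map (incl α) (SeqAlg.mk A (f g))
  have hφ : ∀ g, SeqAlg.map (incl α) (SeqAlg.mk A (f g)) = φ g := fun g => rfl
  clear_value φ
  have hφstar : ∀ g, star (φ g) = φ g := fun g => by
    rw [← hφ, ← map_star, ← map_star]
    exact congrArg _ (congrArg _ (BddSeq.ext fun n => by
      rw [map_star, (hf.nonneg g n).1.isSelfAdjoint.star_eq]))
  have horth : ∀ g k, g ≠ k → φ g * φ k = 0 := fun g k hgk => by
    rw [← hφ, ← hφ, ← map_mul, ← map_mul, hf.orthogonal g k hgk, map_zero, map_zero]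
  have hφu : ∀ g k, SeqAlg.const (CrossedProduct α) (unitaryOf α g) * φ k =
      φ (g * k) * SeqAlg.const (CrossedProduct α) (unitaryOf α g) := fun g k => by
    rw [← hφ, ← hφ, unitaryOf_mul_tower hf]
  have hφa : ∀ g b, b = v ∨ b ∈ F → ∀ k, φ g * SeqAlg.const (CrossedProduct α) (incl α (b.coeff k)) =
      SeqAlg.const (CrossedProduct α) (incl α (b.coeff k)) * φ g := fun g b hb k => by
    rw [← hφ, ← SeqAlg.map_const, ← map_mul, ← map_mul, hf.comm g _ (hS b hb k)]
  let s : PontryaginDual G → SeqAlg (CrossedProduct α) := fun ω => ∑ g, star (ω g : ℂ) • φ g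
  have hs : ∀ ω, s ω = ∑ g, star (ω g : ℂ) • φ g := fun ω => rfl
  clear_value s
  let c : BddSeq (CrossedProduct α) := BddSeq.map (incl α) (∑ g, f g)
  have hcn : ∀ n, eval (CrossedProduct α) n c = incl α (∑ g, eval A n (f g)) := fun n => by
    rw [← map_sum (eval A n)]; rfl
  have hc : SeqAlg.mk (CrossedProduct α) c = ∑ g, φ g := by
    change SeqAlg.map (incl α) (SeqAlg.mk A (∑ g, f g)) = _
    rw [map_sum, map_sum]
    exact Finset.sum_congr rfl fun g _ => hφ g
  clear_value c
  have hc1 : SeqAlg.mk (CrossedProduct α) c = s 1 := by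
    rw [hc, hs]
    refine Finset.sum_congr rfl fun g _ => ?_
    change _ = star (((1 : Circle)) : ℂ) • φ g
    simp
  have hsmul : ∀ ω τ, s ω * s τ = ∑ g, star ((ω * τ) g : ℂ) • (φ g * φ g) := fun ω τ => by
    rw [hs, hs, sum_smul_mul_sum_smul horth]
    refine Finset.sum_congr rfl fun g _ => congrArg (· • (φ g * φ g)) ?_
    change _ = star ((ω g * τ g : Circle) : ℂ)
    rw [Circle.coe_mul, star_mul']
  have hsstar : ∀ ω, star (s ω) = s ω⁻¹ := fun ω => by
    rw [hs, hs, star_sum]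
    refine Finset.sum_congr rfl fun g _ => ?_
    rw [star_smul, hφstar]
    refine congrArg (· • φ g) ?_
    change _ = star (((ω g)⁻¹ : Circle) : ℂ)
    rw [Circle.coe_inv_eq_conj]
    rfl
  have hus : ∀ g ω, SeqAlg.const (CrossedProduct α) (unitaryOf α g) * s ω =
      (ω g : ℂ) • (s ω * SeqAlg.const (CrossedProduct α) (unitaryOf α g)) := fun g ω => by
    rw [hs, Finset.mul_sum, Finset.sum_mul, Finset.smul_sum]
    refine Fintype.sum_equiv (Equiv.mulLeft g) _ _ fun k => ?_
    rw [mul_smul_comm, hφu, smul_mul_assoc, smul_smul, Equiv.coe_mulLeft, map_mul, Circle.coe_mul,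
      star_mul', ← mul_assoc, mul_comm (ω g : ℂ), star_mul_circle, one_mul]
  have hsa : ∀ ω b, b = v ∨ b ∈ F → ∀ k,
      s ω * SeqAlg.const (CrossedProduct α) (incl α (b.coeff k)) =
        SeqAlg.const (CrossedProduct α) (incl α (b.coeff k)) * s ω := fun ω b hb k => by
    rw [hs, Finset.sum_mul, Finset.mul_sum]
    refine Finset.sum_congr rfl fun g _ => ?_
    rw [mul_smul_comm, smul_mul_assoc, hφa g b hb]
  have hcu : ∀ g, SeqAlg.mk (CrossedProduct α) c * SeqAlg.const (CrossedProduct α) (unitaryOf α g) =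
      SeqAlg.const (CrossedProduct α) (unitaryOf α g) * SeqAlg.mk (CrossedProduct α) c := fun g => by
    rw [hc1, hus]
    change _ = (((1 : Circle)) : ℂ) • _
    simp
  have hcb : ∀ b, b = v ∨ b ∈ F →
      SeqAlg.mk (CrossedProduct α) c * SeqAlg.const (CrossedProduct α) b =
        SeqAlg.const (CrossedProduct α) b * SeqAlg.mk (CrossedProduct α) c := fun b hb =>
    mul_const_eq_const_mul (fun g => by rw [hc1]; exact hsa 1 b hb g) hcu
  have hsfix : ∀ ω τ, SeqAlg.map (autHom (dualAction α ω)) (s τ) = s τ := fun ω τ => by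
    rw [hs, map_sum]
    refine Finset.sum_congr rfl fun g _ => ?_
    rw [map_smul, ← hφ, map_dualAction_map_incl]
  have hf0 : ∀ n, 0 ≤ ∑ g, eval A n (f g) := fun n => Finset.sum_nonneg fun g _ => (hf.nonneg g n).1
  have hf1 : ∀ n, ‖∑ g, eval A n (f g)‖ ≤ 1 := fun n =>
    norm_sum_le_one_of_orthogonal (fun g => (hf.nonneg g n).1) (fun g => (hf.nonneg g n).2)
      fun g k hgk => by rw [← map_mul, hf.orthogonal g k hgk, map_zero]
  refine ⟨c, s, ⟨fun n => ?_, fun n ω => ?_, hc1.symm, hsstar, fun ω τ => ?_,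
    fun b hb => hcb b (Or.inr hb), fun ω => ?_, fun ω b hb => ?_, fun ω τ => ?_⟩, ?_, ?_⟩
  · rw [hcn]
    exact ⟨incl_nonneg α (hf0 n), (norm_incl α _).trans_le (hf1 n)⟩
  · rw [hcn, dualAction_incl]
  · rw [hc1, hsmul, hsmul, one_mul]
  · rw [hc1, hsmul, hsmul, mul_comm]
  · rw [map_mul, map_mul, hc1, hsfix, SeqAlg.map_const, autHom_apply, eq_sum_incl_mul_unitaryOf α b]
    simp only [map_sum, Finset.mul_sum, Finset.sum_mul]
    refine Finset.sum_congr rfl fun g _ => ?_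
    rw [map_mul, dualAction_incl, dualAction_unitaryOf, map_mul, map_mul, map_smul]
    have e1 := hus g 1
    have e2 := hus g ω⁻¹
    have e3 : s ω * s ω⁻¹ = s 1 * s 1 := by rw [hsmul, hsmul, mul_inv_cancel, mul_one]
    rw [show (((1 : PontryaginDual G) g : Circle) : ℂ) = 1 from Circle.coe_one, one_smul] at e1
    rw [show ((ω⁻¹ g : Circle) : ℂ) = star (ω g : ℂ) from Circle.coe_inv_eq_conj _] at e2
    rw [hsstar, mul_smul_comm, mul_smul_comm, smul_mul_assoc, mul_assoc, mul_assoc _ _ (s 1), e1,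
      mul_assoc (s ω), mul_assoc _ _ (s ω⁻¹), e2, mul_smul_comm, mul_smul_comm, ← mul_assoc (s 1),
      hsa 1 b (Or.inr hb), ← mul_assoc (s ω), hsa ω b (Or.inr hb), mul_assoc, mul_assoc,
      ← mul_assoc (s 1), ← mul_assoc (s ω), e3]
  · rw [hsfix, mul_comm ω, mul_inv_cancel_right]
  · refine Eventually.of_forall fun n => ?_
    refine CuntzSubequiv.trans ?_ (((hcuntz n).map (incl α)).trans (hyk.trans (.of_le k0 kle)))
    rw [map_sub, map_one, ← hcn]
    have hsa : IsSelfAdjoint (eval (CrossedProduct α) n c) := by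
      rw [hcn]; exact (incl_nonneg α (hf0 n)).isSelfAdjoint
    exact .cutDown_of_le (.sub (.one _) hsa)
      (le_add_of_nonneg_right (algebraMap_nonneg _ hε.le))
  · refine OneLeLiminfNorm.of_conj (y := incl α y) (v := v) (fun n => ?_) (fun n => ?_) hε
      (hcb v (Or.inl rfl)) hv hvx fun δ hδ => ?_
    · rw [hcn]; exact (incl_nonneg α (hf0 n)).isSelfAdjoint
    · rw [hcn]; exact (norm_incl α _).trans_le (hf1 n)
    · filter_upwards [hnorm δ hδ] with n hn
      rw [map_mul, map_mul, hcn, ← map_sum (eval A n)]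
      rw [← norm_incl α] at hn
      simpa only [map_mul, BddSeq.eval_const] using hn

/-- A weak tracial approximate representation `s` of `α` yields towers for the dual action: since
`s_g a ∼ α_g(a) s_g`, the elements `t_g = s_g* u_g` of the crossed product commute asymptotically with
prescribed elements, represent `G` asymptotically, and satisfy `α̂_ω(t_g) = conj (ω(g)) t_g`. Their
spectral decomposition is permuted by the dual action. -/
theorem exists_dual_tower (h : IsWeaklyTraciallyApproxRepresentable α)
    (F : Finset (CrossedProduct α)) {x : A} (hx : 0 ≤ x) (hx1 : ‖x‖ = 1) :
    ∃ f : PontryaginDual G → BddSeq (CrossedProduct α), IsRokhlinTower (dualAction α) F f ∧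
      (∀ᶠ n in atTop, CuntzSubequiv (1 - ∑ ω, eval (CrossedProduct α) n (f ω)) (incl α x)) ∧
      OneLeLiminfNorm ((∑ ω, f ω) * BddSeq.const (CrossedProduct α) (incl α x) * ∑ ω, f ω) := by
  obtain ⟨S, hS⟩ : ∃ S : Finset A, ∀ b ∈ F, ∀ g k, α g (b.coeff k) ∈ S ∧
      α g (b.coeff k) * star (α g (b.coeff k)) ∈ S := by
    classical
    let T : Finset A := F.biUnion fun b => (Finset.univ : Finset (G × G)).image fun p =>
      α p.1 (b.coeff p.2)
    have hT : ∀ b ∈ F, ∀ g k, α g (b.coeff k) ∈ T := fun b hb g k =>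
      Finset.mem_biUnion.mpr ⟨b, hb, Finset.mem_image.mpr ⟨(g, k), Finset.mem_univ _, rfl⟩⟩
    exact ⟨T ∪ T.image fun a => a * star a, fun b hb g k =>
      ⟨Finset.mem_union_left _ (hT b hb g k),
        Finset.mem_union_right _ (Finset.mem_image.mpr ⟨_, hT b hb g k, rfl⟩)⟩⟩
  obtain ⟨c, s, hs, hcuntz, hnorm⟩ := h.exists_isApproxRepresentation S hx hx1
  let σ : G → SeqAlg (CrossedProduct α) := fun g => SeqAlg.map (incl α) (s g)
  have hσ : ∀ g, SeqAlg.map (incl α) (s g) = σ g := fun g => rfl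
  clear_value σ
  let U : G → SeqAlg (CrossedProduct α) := fun g => SeqAlg.const (CrossedProduct α) (unitaryOf α g)
  have hU : ∀ g, SeqAlg.const (CrossedProduct α) (unitaryOf α g) = U g := fun g => rfl
  have hUU : ∀ g k, U g * U k = U (g * k) := fun g k => by
    rw [← hU, ← hU, ← hU, ← map_mul, unitaryOf_mul_unitaryOf]
  have hU1 : U 1 = 1 := by rw [← hU, unitaryOf_one, map_one]
  have hUstar : ∀ g, star (U g) = U g⁻¹ := fun g => by
    rw [← hU, ← hU, ← map_star, star_unitaryOf]
  clear_value U
  have hUσ : ∀ g k, U g * σ k = σ k * U g := fun g k => by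
    have := map_incl_map_autHom α g (s k)
    rw [hs.equivariant, mul_comm g, mul_inv_cancel_right, hσ, map_star, hU] at this
    conv_rhs => rw [this]
    rw [mul_assoc, hUstar, hUU, inv_mul_cancel, hU1, mul_one]
  let c' : BddSeq (CrossedProduct α) := BddSeq.map (incl α) c
  have hc'n : ∀ n, eval (CrossedProduct α) n c' = incl α (eval A n c) := fun n => rfl
  have hc' : SeqAlg.mk (CrossedProduct α) c' = σ 1 := by
    rw [← hσ, hs.one, SeqAlg.map_mk]
  clear_value c'
  have hσstar : ∀ g, star (σ g) = σ g⁻¹ := fun g => by rw [← hσ, ← hσ, ← map_star, hs.star]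
  have hσmul : ∀ g k, σ g * σ k = σ 1 * σ (g * k) := fun g k => by
    rw [← hσ, ← hσ, ← hσ, ← hσ, ← map_mul, ← map_mul, hs.mul, hs.one]
  have hσcomm : ∀ g, σ 1 * σ g = σ g * σ 1 := fun g => by
    rw [hσmul g 1, mul_one]
  let t : G → SeqAlg (CrossedProduct α) := fun g => σ g⁻¹ * U g
  have ht : ∀ g, t g = σ g⁻¹ * U g := fun g => rfl
  clear_value t
  have htb : ∀ b ∈ F, ∀ g, t g * SeqAlg.const (CrossedProduct α) b =
      SeqAlg.const (CrossedProduct α) b * t g := by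
    intro b hb g
    refine mul_const_eq_const_mul (fun k => ?_) (fun k => ?_)
    · have h1 := hs.intertwine (g := g⁻¹) (hS b hb g k).1 (hS b hb g k).2
      rw [← apply_mul, inv_mul_cancel, apply_one] at h1
      have h2 := congrArg (SeqAlg.map (incl α)) h1
      rw [map_mul, map_mul, hσ, SeqAlg.map_const, SeqAlg.map_const] at h2
      rw [ht, mul_assoc, ← hU, ← map_mul, unitaryOf_mul_incl, map_mul, ← mul_assoc, h2, mul_assoc]
    · rw [hU, ht, mul_assoc, hUU, ← mul_assoc, hUσ, mul_assoc, hUU, mul_comm g]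
  have htdual : ∀ ω g, SeqAlg.map (autHom (dualAction α ω)) (t g) = star (ω g : ℂ) • t g := by
    intro ω g
    rw [ht, map_mul, ← hσ, map_dualAction_map_incl, ← hU, SeqAlg.map_const, autHom_apply,
      dualAction_unitaryOf, map_smul, mul_smul_comm]
  obtain ⟨f, hf, horth, hft, hfc, hfcuntz⟩ := exists_tower_of_approxRep (H := G)
    (Γ := PontryaginDual G) (χ := PontryaginDual.conjChar) PontryaginDual.sum_conjChar_mul_star
    PontryaginDual.sum_conjChar PontryaginDual.card_eq (c := c')
    (fun n => by
      rw [hc'n]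
      exact ⟨incl_nonneg α (hs.nonneg n).1, (norm_incl α _).trans_le (hs.nonneg n).2⟩)
    (s := t) (by rw [ht, hU1, mul_one, inv_one, hc'])
    (fun g => by rw [ht, ht, star_mul, hUstar, hσstar, hUσ])
    (fun g k => by
      rw [ht, ht, ht, mul_assoc, ← mul_assoc (U g), hUσ, mul_assoc, hUU, ← mul_assoc, hσmul, hc',
        mul_inv, mul_assoc])
    (fun g => by rw [ht, hc', mul_assoc, hUσ, ← mul_assoc, ← mul_assoc, hσcomm])
  refine ⟨f, ⟨hf, horth, fun ω b hb => ?_, fun ω τ => ?_⟩, ?_, ?_⟩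
  · rw [hft, mul_smul_comm, smul_mul_assoc, Finset.mul_sum, Finset.sum_mul]
    refine congrArg _ (Finset.sum_congr rfl fun g _ => ?_)
    rw [mul_smul_comm, smul_mul_assoc, htb b hb g]
  · rw [hft, hft, map_smul, map_sum]
    refine congrArg _ (Finset.sum_congr rfl fun g _ => ?_)
    rw [map_smul, htdual, smul_smul, PontryaginDual.coe_conjChar, PontryaginDual.coe_conjChar]
    refine congrArg (· • t g) ?_
    change _ = star ((ω g * τ g : Circle) : ℂ)
    rw [Circle.coe_mul, star_mul', mul_comm]
  · filter_upwards [hfcuntz] with n hn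
    refine hn.trans ?_
    have := (hcuntz n).map (incl α)
    rwa [incl_cutDown α (.sub (.one _) (hs.nonneg n).1.isSelfAdjoint), map_sub, map_one,
      ← hc'n] at this
  · refine OneLeLiminfNorm.congr (a := c' * BddSeq.const (CrossedProduct α) (incl α x) * c')
      (fun δ hδ => ?_) ?_
    · filter_upwards [hnorm δ hδ] with n hn
      rw [map_mul, map_mul, hc'n]
      rw [← norm_incl α] at hn
      simpa only [map_mul, BddSeq.eval_const] using hn
    · simp only [map_mul, map_sum, hfc]

/-- If `α` is weakly tracially approximately representable, every nonzero positive `h` in the crossed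
product dominates a positive element of `A`. Below `h` there is an orthogonal copy of the dual orbit
of some `k ≥ 0`. Spread along a tower `f` of the dual action, it gives
`y = ∑ f_ω α̂_ω(k) f_ω`, which is asymptotically fixed by the dual action and thus comes from `A`. -/
theorem exists_incl_cuntzSubequiv_of_approxRep [IsSimpleRing (CrossedProduct α)]
    (hinf : ¬ FiniteDimensional ℂ A) (hα : IsWeaklyTraciallyApproxRepresentable α)
    {h : CrossedProduct α} (h0 : 0 ≤ h) (hne : h ≠ 0) :
    ∃ x : A, 0 ≤ x ∧ ‖x‖ = 1 ∧ CuntzSubequiv (incl α x) h := by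
  obtain ⟨z, k, horth, k0, k1, hz⟩ := exists_orthogonal_translates
    (not_finiteDimensional α hinf) (fun ω => dualAction α ω) h0 hne
  have kne : k ≠ 0 := fun e => by simp [e] at k1
  obtain ⟨ι, _, p, q, hpq⟩ := exists_sum_mul_mul_eq_one kne
  obtain ⟨F, hF⟩ : ∃ F : Finset (CrossedProduct α), ∀ i, q i ∈ F ∧ p i ∈ F := by
    classical
    exact ⟨Finset.univ.image q ∪ Finset.univ.image p, fun i =>
      ⟨Finset.mem_union_left _ (Finset.mem_image_of_mem _ (Finset.mem_univ i)),
      Finset.mem_union_right _ (Finset.mem_image_of_mem _ (Finset.mem_univ i))⟩⟩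
  have : Nontrivial A := by
    by_contra hA
    rw [not_nontrivial_iff_subsingleton] at hA
    exact hinf inferInstance
  obtain ⟨f, hf, -, hnorm⟩ := exists_dual_tower hα F (x := 1) zero_le_one norm_one
  -- `y` is asymptotically invariant under the dual action, and lies below `h`
  let y : BddSeq (CrossedProduct α) :=
    ∑ ω, f ω * BddSeq.const (CrossedProduct α) (dualAction α ω k) * f ω
  have hyn : ∀ n, eval (CrossedProduct α) n y = ∑ ω, eval (CrossedProduct α) n (f ω) *
      dualAction α ω k * star (eval (CrossedProduct α) n (f ω)) := fun n => by
    rw [map_sum]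
    refine Finset.sum_congr rfl fun ω _ => ?_
    rw [map_mul, map_mul, BddSeq.eval_const, (hf.nonneg ω n).1.isSelfAdjoint.star_eq]
  have hmky : SeqAlg.mk (CrossedProduct α) y = ∑ ω, SeqAlg.mk (CrossedProduct α) (f ω) *
      SeqAlg.const (CrossedProduct α) (dualAction α ω k) * SeqAlg.mk (CrossedProduct α) (f ω) := by
    simp only [y, map_sum, map_mul, SeqAlg.mk_const]
  clear_value y
  have hyh : ∀ n, CuntzSubequiv (eval (CrossedProduct α) n y) h := fun n => by
    rw [hyn]
    exact .sum_conj_of_orthogonal horth hz _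
  have hy0 : ∀ n, 0 ≤ eval (CrossedProduct α) n y := fun n => by
    rw [hyn]
    exact Finset.sum_nonneg fun ω _ => star_right_conjugate_nonneg (map_nonneg_starAlgEquiv _ k0) _
  have hyfix : ∀ τ, SeqAlg.map (autHom (dualAction α τ)) (SeqAlg.mk (CrossedProduct α) y) =
      SeqAlg.mk (CrossedProduct α) y := fun τ => by
    rw [hmky, map_sum]
    refine Fintype.sum_equiv (Equiv.mulLeft τ) _ _ fun ω => ?_
    rw [map_mul, map_mul, hf.equivariant, SeqAlg.map_const, autHom_apply, Equiv.coe_mulLeft,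
      ← StarAlgEquiv.mul_apply, ← map_mul]
  refine exists_incl_cuntzSubequiv (a := expSeq α y) (fun n => coeff_one_nonneg (hy0 n))
    (fun n => (hy0 n).isSelfAdjoint) (mk_map_incl_expSeq α hyfix) (fun hyz => ?_) hyh
  have horthmk : ∀ ω τ, ω ≠ τ → SeqAlg.mk (CrossedProduct α) (f ω) * SeqAlg.mk (CrossedProduct α) (f τ)
      = 0 := fun ω τ e => by rw [← map_mul, hf.orthogonal ω τ e, map_zero]
  have hsa : ∀ ω, star (SeqAlg.mk (CrossedProduct α) (f ω)) = SeqAlg.mk (CrossedProduct α) (f ω) :=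
    fun ω => by
      rw [← map_star]
      exact congrArg _ (BddSeq.ext fun n => by
        rw [map_star, (hf.nonneg ω n).1.isSelfAdjoint.star_eq])
  set e := SeqAlg.mk (CrossedProduct α) (f 1) with he
  have h1 : (e * e) * SeqAlg.const (CrossedProduct α) k * (e * e) = 0 := by
    classical
    have : e * SeqAlg.mk (CrossedProduct α) y * e = 0 := by rw [hyz]; simp
    rw [hmky, Finset.mul_sum, Finset.sum_mul, Finset.sum_eq_single 1 (fun ω _ hω => ?_) (by simp),
      apply_one] at this
    · simpa only [mul_assoc] using this
    · rw [← mul_assoc, ← mul_assoc, horthmk 1 ω hω.symm]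
      simp
  -- since `k` generates the simple algebra as an ideal, the tower would vanish
  have h2 : (e * e) * (e * e) = 0 := by
    have hcomm : ∀ b ∈ F, SeqAlg.const (CrossedProduct α) b * (e * e) =
        (e * e) * SeqAlg.const (CrossedProduct α) b := fun b hb => by
      rw [← mul_assoc, hf.comm 1 b hb, mul_assoc, hf.comm 1 b hb, mul_assoc]
    calc (e * e) * (e * e) = (e * e) * SeqAlg.const (CrossedProduct α) (∑ i, p i * k * q i) * (e * e) := by
          rw [hpq, map_one, mul_one]
      _ = ∑ i, SeqAlg.const (CrossedProduct α) (p i) *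
            ((e * e) * SeqAlg.const (CrossedProduct α) k * (e * e)) *
            SeqAlg.const (CrossedProduct α) (q i) := by
          rw [map_sum, Finset.mul_sum, Finset.sum_mul]
          refine Finset.sum_congr rfl fun i _ => ?_
          have hp := hcomm _ (hF i).2
          have hq := hcomm _ (hF i).1
          rw [map_mul, map_mul]
          generalize e * e = E at hp hq ⊢
          calc _ = (E * SeqAlg.const _ (p i)) * SeqAlg.const _ k * (SeqAlg.const _ (q i) * E) := by
                simp only [mul_assoc]
            _ = _ := by rw [← hp, hq]; simp only [mul_assoc]
      _ = 0 := by simp [h1]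
  have h3 : e = 0 := by
    refine SeqAlg.eq_zero_of_mul_star (SeqAlg.eq_zero_of_mul_star ?_)
    rw [star_mul, star_star, hsa 1]
    exact h2
  have h4 : ∀ ω, SeqAlg.mk (CrossedProduct α) (f ω) = 0 := fun ω => by
    rw [← mul_one ω, ← hf.equivariant, ← he, h3, map_zero]
  refine hnorm.mk_ne_zero ?_
  rw [map_mul, map_sum, Finset.sum_eq_zero fun ω _ => h4 ω, mul_zero]

/-- The towers of `exists_dual_tower` are chosen large relative to an element of `A` which is Cuntz
below the top part of the given `x`. -/
theorem hasWeakTracialRokhlinProperty_dual [IsSimpleRing (CrossedProduct α)]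
    (hinf : ¬ FiniteDimensional ℂ A) (h : IsWeaklyTraciallyApproxRepresentable α) :
    HasWeakTracialRokhlinProperty (dualAction α) := by
  refine .of_exists_isRokhlinTower fun F x ε hx hx1 hε => ?_
  obtain ⟨k, k0, kne, kle, ktop⟩ := exists_top_part hx hx1 (η := ε / 8) (by positivity)
  obtain ⟨y, hy, hy1, hyk⟩ := exists_incl_cuntzSubequiv_of_approxRep hinf h k0 kne
  obtain ⟨v, hv, hvx⟩ := ktop _ ((norm_incl α y).trans hy1) hyk
  obtain ⟨S, hS⟩ : ∃ S : Finset (CrossedProduct α), ∀ b, b = v ∨ b ∈ F → b ∈ S := by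
    classical
    exact ⟨insert v F, fun b hb => Finset.mem_insert.mpr hb⟩
  obtain ⟨f, hf, hcuntz, hnorm⟩ := exists_dual_tower h S hy hy1
  refine ⟨f, ⟨hf.nonneg, hf.orthogonal, fun ω b hb => hf.comm ω b (hS b (Or.inr hb)),
    hf.equivariant⟩, ?_, ?_⟩
  · filter_upwards [hcuntz] with n hn
    exact hn.trans (hyk.trans (.of_le k0 kle))
  · refine OneLeLiminfNorm.of_conj (y := incl α y) (v := v) (fun n => ?_) (fun n => ?_) hε ?_ hv hvx
      hnorm
    · rw [map_sum]
      exact (Finset.sum_nonneg fun g _ => (hf.nonneg g n).1).isSelfAdjoint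
    · rw [map_sum]
      exact norm_sum_le_one_of_orthogonal (fun g => (hf.nonneg g n).1) (fun g => (hf.nonneg g n).2)
        fun g k hgk => by rw [← map_mul, hf.orthogonal g k hgk, map_zero]
    · rw [map_sum, Finset.sum_mul, Finset.mul_sum]
      exact Finset.sum_congr rfl fun g _ => (hf.comm g v (hS v (Or.inl rfl))).symm

/-- The rearrangement behind `α_g(c a c) ∼ s_g a s_g*` in the next theorem, where `s_g = y_g u_g`. -/
theorem conj_eq_of_commute {R : Type*} [Ring R] {y s t u w a : R} (hy : u * y = y * u)
    (ht : u * t = t * u) (ht' : w * t = t * w) (hya : y * a = a * y)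
    (hta : t * a = a * t) (h : y * y = s * t) :
    u * (y * a * y) * w = s * u * a * (w * t) := by
  have huy : Commute u (y * y) := Commute.mul_right hy hy
  have hut : Commute (u * a) t := Commute.mul_left ht (Commute.symm hta)
  calc u * (y * a * y) * w = u * (y * y) * a * w := by simp only [mul_assoc, ← hya]
    _ = s * (t * (u * a)) * w := by rw [huy.eq, h]; simp only [mul_assoc]
    _ = s * u * a * (w * t) := by rw [← hut.eq, ht']; simp only [mul_assoc]

set_option maxHeartbeats 400000 in
/-- For a tower `f` of the dual action, the Fourier coefficients `(∑ conj (ω(g)) f_ω) u_g` are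
asymptotically fixed by the dual action; the elements of `A` they come from represent `α`. -/
theorem isWeaklyTraciallyApproxRepresentable_of_dual [IsSimpleRing A]
    (hinf : ¬ FiniteDimensional ℂ A) (h : HasWeakTracialRokhlinProperty (dualAction α)) :
    IsWeaklyTraciallyApproxRepresentable α := by
  refine .of_exists_isApproxRepresentation fun F x ε hx hx1 hε => ?_
  obtain ⟨y, v, hy, hy1, hv, hvx, htrans⟩ :=
    exists_orthogonal_translates_top hinf α hx hx1 (η := ε / 8) (by positivity)
  obtain ⟨S, hSa, hSu⟩ : ∃ S : Finset (CrossedProduct α),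
      (∀ a, a = v ∨ a ∈ F → incl α a ∈ S) ∧ ∀ g, unitaryOf α g ∈ S := by
    classical
    exact ⟨(insert v F).image (incl α) ∪ Finset.univ.image (unitaryOf α), fun a ha =>
      Finset.mem_union_left _ (Finset.mem_image_of_mem _ (Finset.mem_insert.mpr ha)), fun g =>
      Finset.mem_union_right _ (Finset.mem_image_of_mem _ (Finset.mem_univ g))⟩
  obtain ⟨f, hf, hcuntz, hnorm⟩ := h.exists_isRokhlinTower S
    (incl_nonneg α hy) ((norm_incl α y).trans hy1)
  have hinj : Function.Injective (SeqAlg.map (incl α)) := SeqAlg.map_injective _ (incl_injective α)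
  have hf0 : ∀ n, 0 ≤ ∑ ω, eval (CrossedProduct α) n (f ω) := fun n =>
    Finset.sum_nonneg fun ω _ => (hf.nonneg ω n).1
  have hf1 : ∀ n, ‖∑ ω, eval (CrossedProduct α) n (f ω)‖ ≤ 1 := fun n =>
    norm_sum_le_one_of_orthogonal (fun ω => (hf.nonneg ω n).1) (fun ω => (hf.nonneg ω n).2)
      fun ω τ hne => by rw [← map_mul, hf.orthogonal ω τ hne, map_zero]
  let φ : PontryaginDual G → SeqAlg (CrossedProduct α) := fun ω => SeqAlg.mk (CrossedProduct α) (f ω)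
  have hφ : ∀ ω, SeqAlg.mk (CrossedProduct α) (f ω) = φ ω := fun ω => rfl
  clear_value φ
  have hφstar : ∀ ω, star (φ ω) = φ ω := fun ω => by
    rw [← hφ, ← map_star]
    exact congrArg _ (BddSeq.ext fun n => by
      rw [map_star, (hf.nonneg ω n).1.isSelfAdjoint.star_eq])
  have horth : ∀ ω τ, ω ≠ τ → φ ω * φ τ = 0 := fun ω τ hne => by
    rw [← hφ, ← hφ, ← map_mul, hf.orthogonal ω τ hne, map_zero]
  let U : G → SeqAlg (CrossedProduct α) := fun g => SeqAlg.const (CrossedProduct α) (unitaryOf α g)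
  have hU : ∀ g, SeqAlg.const (CrossedProduct α) (unitaryOf α g) = U g := fun g => rfl
  have hUU : ∀ g k, U g * U k = U (g * k) := fun g k => by
    rw [← hU, ← hU, ← hU, ← map_mul, unitaryOf_mul_unitaryOf]
  have hU1 : U 1 = 1 := by rw [← hU, unitaryOf_one, map_one]
  have hUstar : ∀ g, star (U g) = U g⁻¹ := fun g => by
    rw [← hU, ← hU, ← map_star, star_unitaryOf]
  clear_value U
  -- the Fourier coefficients of the tower
  let Y : G → SeqAlg (CrossedProduct α) := fun g => ∑ ω, star (ω g : ℂ) • φ ω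
  have hY : ∀ g, Y g = ∑ ω, star (ω g : ℂ) • φ ω := fun g => rfl
  clear_value Y
  have hcommY : ∀ b ∈ S, ∀ g, Y g * SeqAlg.const (CrossedProduct α) b =
      SeqAlg.const (CrossedProduct α) b * Y g := fun b hb g => by
    rw [hY, Finset.sum_mul, Finset.mul_sum]
    refine Finset.sum_congr rfl fun ω _ => ?_
    rw [mul_smul_comm, smul_mul_assoc, ← hφ, hf.comm ω b hb]
  have hUY : ∀ g k, U g * Y k = Y k * U g := fun g k => by
    rw [← hU, hcommY _ (hSu g)]
  have hYY : ∀ g k, Y g * Y k = ∑ ω, star (ω (g * k) : ℂ) • (φ ω * φ ω) := fun g k => by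
    rw [hY, hY, sum_smul_mul_sum_smul horth]
    refine Finset.sum_congr rfl fun ω _ => congrArg (· • (φ ω * φ ω)) ?_
    rw [map_mul, Circle.coe_mul, star_mul']
  have hYstar : ∀ g, star (Y g) = Y g⁻¹ := fun g => by
    rw [hY, hY, star_sum]
    refine Finset.sum_congr rfl fun ω _ => ?_
    rw [star_smul, hφstar, map_inv, Circle.coe_inv_eq_conj]
    rfl
  have hY1 : Y 1 = SeqAlg.mk (CrossedProduct α) (∑ ω, f ω) := by
    rw [hY, map_sum]
    refine Finset.sum_congr rfl fun ω _ => ?_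
    rw [map_one, Circle.coe_one, star_one, one_smul, hφ]
  have hYdual : ∀ τ g, SeqAlg.map (autHom (dualAction α τ)) (Y g) = (τ g : ℂ) • Y g := fun τ g => by
    rw [hY, map_sum, Finset.smul_sum]
    refine Fintype.sum_equiv (Equiv.mulLeft τ) _ _ fun ω => ?_
    rw [map_smul, ← hφ, hf.equivariant, hφ, smul_smul, Equiv.coe_mulLeft]
    refine congrArg (· • φ (τ * ω)) ?_
    change _ = (τ g : ℂ) * star ((τ g * ω g : Circle) : ℂ)
    rw [Circle.coe_mul, star_mul', ← mul_assoc, mul_comm (τ g : ℂ), star_mul_circle, one_mul]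
  have hlift : ∀ g, ∃ t : SeqAlg A, SeqAlg.map (incl α) t = Y g * U g := fun g => by
    obtain ⟨b, hb⟩ := SeqAlg.mk_surjective (Y g * U g)
    refine ⟨SeqAlg.mk A (expSeq α b), ?_⟩
    rw [mk_map_incl_expSeq α fun τ => ?_, hb]
    rw [hb, map_mul, hYdual, ← hU, SeqAlg.map_const, autHom_apply, dualAction_unitaryOf, map_smul,
      smul_mul_smul_comm, mul_comm (τ g : ℂ), star_mul_circle, one_smul]
  choose t ht using hlift
  let c₀ : BddSeq A := expSeq α (∑ ω, f ω)
  have hc₀n : ∀ n, eval A n c₀ = (∑ ω, eval (CrossedProduct α) n (f ω)).coeff 1 := fun n => by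
    rw [← map_sum]; rfl
  have hc₀ : SeqAlg.map (incl α) (SeqAlg.mk A c₀) = Y 1 := by
    rw [hY1]
    refine mk_map_incl_expSeq α fun τ => ?_
    rw [← hY1, hYdual]
    simp
  clear_value c₀
  -- averaging over `G` makes the sum of the tower exactly invariant
  let c : BddSeq A := (Fintype.card G : ℂ)⁻¹ • ∑ g, BddSeq.map (autHom (α g)) c₀
  have hcard : (Fintype.card G : ℂ) ≠ 0 := by simp [Fintype.card_ne_zero]
  have hcn : ∀ n, eval A n c = (Fintype.card G : ℂ)⁻¹ • ∑ g, α g (eval A n c₀) := fun n => by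
    rw [map_smul, map_sum]; rfl
  have hc : SeqAlg.map (incl α) (SeqAlg.mk A c) = Y 1 := by
    rw [map_smul, map_smul, map_sum, map_sum]
    have : ∀ g, SeqAlg.map (incl α) (SeqAlg.mk A (BddSeq.map (autHom (α g)) c₀)) = Y 1 := fun g => by
      rw [← SeqAlg.map_mk, map_incl_map_autHom, hc₀, map_star, hU, hUY, mul_assoc, hUstar, hUU,
        mul_inv_cancel, hU1, mul_one]
    simp only [this, Finset.sum_const, Finset.card_univ, ← Nat.cast_smul_eq_nsmul ℂ, smul_smul,
      inv_mul_cancel₀ hcard, one_smul]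
  clear_value c
  have hc0 : ∀ n, 0 ≤ eval A n c ∧ ‖eval A n c‖ ≤ 1 := fun n => by
    rw [hcn]
    constructor
    · rw [show (Fintype.card G : ℂ)⁻¹ = (((Fintype.card G : ℝ)⁻¹ : ℝ) : ℂ) by push_cast; rfl,
        Complex.coe_smul, hc₀n]
      exact smul_nonneg (by positivity) (Finset.sum_nonneg fun g _ =>
        map_nonneg_starAlgEquiv _ (coeff_one_nonneg (hf0 n)))
    · rw [norm_smul, norm_inv, Complex.norm_natCast, inv_mul_le_iff₀ (by positivity), mul_one]
      refine (norm_sum_le _ _).trans ?_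
      have : ∀ g ∈ Finset.univ, ‖α g (eval A n c₀)‖ ≤ (1 : ℝ) := fun g _ => by
        rw [StarAlgEquiv.norm_map, hc₀n]
        exact (norm_coeff_one_le _).trans (hf1 n)
      simpa using Finset.sum_le_sum this
  have hSF : ∀ a, a = v ∨ a ∈ F → ∀ g, Y g * SeqAlg.map (incl α) (SeqAlg.const A a) =
      SeqAlg.map (incl α) (SeqAlg.const A a) * Y g := fun a ha g => by
    rw [SeqAlg.map_const, hcommY _ (hSa a ha)]
  have hca : ∀ a, a = v ∨ a ∈ F →
      SeqAlg.mk A c * SeqAlg.const A a = SeqAlg.const A a * SeqAlg.mk A c := fun a ha => by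
    refine hinj ?_
    rw [map_mul, map_mul, hc, hSF a ha]
  have hcf : SeqAlg.mk (CrossedProduct α) (BddSeq.map (incl α) c) =
      SeqAlg.mk (CrossedProduct α) (∑ ω, f ω) := by rw [← SeqAlg.map_mk, hc, hY1]
  refine ⟨c, t, ⟨hc0, fun n k => ?_, hinj ?_, fun g => hinj ?_, fun g k => hinj ?_,
    fun a ha => hca a (Or.inr ha), fun g => hinj ?_, fun g a ha => hinj ?_, fun g k => hinj ?_⟩,
    ?_, ?_⟩
  · rw [hcn, map_smul, map_sum]
    refine congrArg _ (Fintype.sum_equiv (Equiv.mulLeft k) _ _ fun g => ?_)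
    rw [Equiv.coe_mulLeft, apply_mul]
  · rw [ht, hU1, mul_one, hc]
  · rw [map_star, ht, ht, star_mul, hYstar, hUstar, hUY]
  · rw [map_mul, map_mul, ht, ht, ht, hc, mul_assoc, ← mul_assoc (U g), hUY, mul_assoc, hUU,
      ← mul_assoc, ← mul_assoc, hYY, hYY, one_mul]
  · rw [map_mul, map_mul, ht, hc, mul_assoc, hUY, ← mul_assoc, ← mul_assoc, hYY, hYY, mul_comm 1]
  · rw [map_incl_map_autHom, map_star (SeqAlg.const (CrossedProduct α)), hU, map_mul, map_mul,
      map_mul, map_mul, map_star, hc, ht, star_mul, hYstar, hUstar]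
    exact conj_eq_of_commute (hUY g 1) (hUY g g⁻¹) (hUY g⁻¹ g⁻¹) (hSF a (Or.inr ha) 1)
      (hSF a (Or.inr ha) g⁻¹) (by rw [hYY, hYY, mul_inv_cancel, mul_one])
  · rw [map_incl_map_autHom, map_star, hU, ht, ht, hUstar, ← mul_assoc, hUY, mul_assoc, mul_assoc,
      hUU, hUU, mul_comm g k, mul_inv_cancel_right]
    simp
  · filter_upwards [SeqAlg.mk_eq_mk_iff_norm.mp hcf ε hε] with n hn
    rw [BddSeq.eval_map, map_sum] at hn
    refine htrans _ ?_
    have hsa := (hc0 n).1.isSelfAdjoint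
    have hsa' : IsSelfAdjoint (1 - incl α (eval A n c)) := .sub (.one _) (hsa.map (incl α))
    rw [incl_cutDown α (.sub (.one _) hsa), map_sub, map_one]
    refine CuntzSubequiv.trans (.cutDown_of_le hsa' ?_) (hcuntz n)
    rw [← sub_le_iff_le_add']
    refine (hsa'.sub (.sub (.one _) (hf0 n).isSelfAdjoint)).le_algebraMap_norm_self.trans
      (algebraMap_mono _ ?_)
    rw [sub_sub_sub_cancel_left, norm_sub_rev]
    exact hn.le
  · refine OneLeLiminfNorm.of_conj (y := y) (v := v) (fun n => (hc0 n).1.isSelfAdjoint)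
      (fun n => (hc0 n).2) hε (hca v (Or.inl rfl)) hv hvx fun δ hδ => ?_
    have := hnorm.congr (b := BddSeq.map (incl α) (c * BddSeq.const A y * c)) (by
      rw [← SeqAlg.map_mk, map_mul, map_mul, map_mul, map_mul, map_mul, map_mul, hc, hY1]
      rfl)
    filter_upwards [this δ hδ] with n hn
    rwa [BddSeq.eval_map, norm_incl] at hn

end Duality
theorem mainTheorem1 {A : Type*} [CStarAlgebra A] [PartialOrder A] [StarOrderedRing A]
    {G : Type*} [CommGroup G] [Fintype G] [DecidableEq G] [TopologicalSpace G] [DiscreteTopology G]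
    (hA : IsSimpleCStarAlgebra A) (hinf : ¬ FiniteDimensional ℂ A)
    (α : G →* (A ≃⋆ₐ[ℂ] A)) (hα : IsPointwiseOuter α) :
    (HasWeakTracialRokhlinProperty α ↔
      IsWeaklyTraciallyApproxRepresentable (CrossedProduct.dualAction α)) ∧
    (IsWeaklyTraciallyApproxRepresentable α ↔
      HasWeakTracialRokhlinProperty (CrossedProduct.dualAction α)) := by
  have := hA.isSimpleRing
  have := CrossedProduct.isSimpleRing_of_isPointwiseOuter hα
  exact ⟨⟨isWeaklyTraciallyApproxRepresentable_dual, hasWeakTracialRokhlinProperty_of_dual hinf⟩,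
    ⟨hasWeakTracialRokhlinProperty_dual hinf, isWeaklyTraciallyApproxRepresentable_of_dual hinf⟩⟩
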